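/- Let $\mathbf M$ be a complete and cocomplete closed symmetric monoidal category with unit object $I$. Let $\mathbf{Mon}_{\mathbf M}$ be the category of monoids in $\mathbf M$, and for a small category $\mathbf C$ let $\mathbf{Mon}_{\mathbf M}^{\mathbf C}$ be the category of functors $\mathbf C\to\mathbf{Mon}_{\mathbf M}$. An orthogonal category $\overline{\mathbf C}=(\mathbf C,\perp)$ is a small category $\mathbf C$ with a symmetric relation $\perp$ on pairs of morphisms with common target such that $f_1\perp f_2$ implies $g f_1 h_1\perp g f_2 h_2$ for all composable $g,h_1,h_2$. An orthogonal functor $F:\overline{\mathbf C}\to\overline{\mathbf D}$ is a functor $F:\mathbf C\to\mathbf D$ such that $f_1\perp_{\mathbf C} f_2$ implies $F(f_1)\perp_{\mathbf D}F(f_2)$. Let $\mathcal O_{\mathbf C}$ be the symmetric coloured operad in sets whose colours are the objects of $\mathbf C$, with $$\mathcal O_{\mathbf C}\big({\textstyle{t \atop (c_1,\dots,c_n)}}\big)=\Sigma_n\times\prod_{i=1}^n\mathbf C(c_i,t),$$ permutation action $(\sigma,f)\mapsto(\sigma\sigma',f\sigma')$, units $(e,\mathrm{id}_t)$ and composition $$\gamma\big((\sigma,f),(\tau_1,g_1),\dots,(\tau_m,g_m)\big)=\big(\sigma\langle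 k_{\sigma^{-1}(1)},\dots,k_{\sigma^{-1}(m)}\rangle(\tau_1\oplus\cdots\oplus\tau_m),\ f(g_1,\dots,g_m)\big),$$ where $k_i$ is the length of the $i$-th input profile, $\sigma\langle\cdots\rangle$ is the block permutation and $f(g_1,\dots,g_m)$ is the family $(f_i\,g_{ij})$. Let $\mathcal O_{\overline{\mathbf C}}$ be the quotient operad of $\mathcal O_{\mathbf C}$ in which $(\sigma,f)\sim_\perp(\sigma',f')$ if and only if $f=f'$ and $\sigma'$ arises from $\sigma$ by finitely many transpositions of adjacent orthogonal entries of the sequence $f\sigma^{-1}=(f_{\sigma^{-1}(1)},\dots,f_{\sigma^{-1}(n)})$. Write $p_{\overline{\mathbf C}}:\mathcal O_{\mathbf C}\to\mathcal O_{\overline{\mathbf C}}$ for the projection, and for an orthogonal functor $F$ write $\mathcal O_F:\mathcal O_{\overline{\mathbf C}}\to\mathcal O_{\overline{\mathbf D}}$ for the operad morphism that is $F$ on colours and $[\sigma,f]\mapsto[\sigma,F(f)]$ on operations. For a coloured operad $\mathcal O$ in sets, $\mathbf{Alg}(\mathcal O)$ denotes the category of algebras in $\mathbf M$ over the $\mathbf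 M$-valued operad with objects $\mathcal O({t\atop c})\otimes I=\coprod_{\mathcal O({t\atop c})}I$. A morphism $\Phi$ of coloured operads induces a pullback functor $\Phi^*$ between categories of algebras. Composing pullback along $p_{\overline{\mathbf C}}$ with the functor $\mathbf{Alg}(\mathcal O_{\mathbf C})\to\mathbf{Mon}_{\mathbf M}^{\mathbf C}$ that takes the underlying monoid-valued functor (the multiplication on $A(t)$ is the operation $(e,(\mathrm{id}_t,\mathrm{id}_t))$, the unit is the $0$-ary operation, and $A(f)$ is the operation $(e,f)$), one obtains a functor $$p_{\overline{\mathbf C}}^*:\mathbf{Alg}(\mathcal O_{\overline{\mathbf C}})\to\mathbf{Mon}_{\mathbf M}^{\mathbf C}.$$ Then: 1. For every orthogonal category $\overline{\mathbf C}$ the functor $p_{\overline{\mathbf C}}^*$ is fully faithful and has a left adjoint $p_{\overline{\mathbf C}!}$ ("$\perp$-abelianization"), so that $\mathbf{Alg}(\mathcal O_{\overline{\mathbf C}})$ is a full reflective subcategory of $\mathbf{Mon}_{\mathbf M}^{\mathbf C}$. In particular, the counit $p_{\overline{\mathbf C}!}\,p_{\overline{\mathbf C}}^*\to\mathrm{id}$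 of every such adjunction is a natural isomorphism. 2. For every orthogonal functor $F:\overline{\mathbf C}\to\overline{\mathbf D}$, the pullback functor $\mathcal O_F^*:\mathbf{Alg}(\mathcal O_{\overline{\mathbf D}})\to\mathbf{Alg}(\mathcal O_{\overline{\mathbf C}})$ has a left adjoint $\mathcal O_{F!}$, all left Kan extensions along $F$ of functors $\mathbf C\to\mathbf{Mon}_{\mathbf M}$ exist, and, with $\operatorname{Lan}_F\dashv F^*:\mathbf{Mon}_{\mathbf M}^{\mathbf D}\to\mathbf{Mon}_{\mathbf M}^{\mathbf C}$, there is a natural isomorphism $$\mathcal O_{F!}\;\cong\;p_{\overline{\mathbf D}!}\,\operatorname{Lan}_F\,p_{\overline{\mathbf C}}^*$$ of functors $\mathbf{Alg}(\mathcal O_{\overline{\mathbf C}})\to\mathbf{Alg}(\mathcal O_{\overline{\mathbf D}})$ (for any choice of the three left adjoints). -/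

import Mathlib

open CategoryTheory MonoidalCategory Limits

universe v u

-- Composition and identities are always written with the quiver that underlies the category.
attribute [-instance] CategoryTheory.catToReflQuiver
namespace QFTOperad

/-- The total number `k 0 + ⋯ + k (m-1)` of inputs of a family of `m` blocks of sizes `k i`. -/
def total : (m : ℕ) → (Fin m → ℕ) → ℕ
  | 0, _ => 0
  | m + 1, k => total m (fun i => k i.succ) + k 0

/-- The position of the `j`-th element of the `i`-th block when the blocks are placed one after
the other. A profile `c : Fin (total m k) → 𝔠` is the concatenation `b₁ ⊗ ⋯ ⊗ bₘ` of the
profiles `bᵢ = fun j => c (inBlock k i j)`. -/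
def inBlock : {m : ℕ} → (k : Fin m → ℕ) → (i : Fin m) → Fin (k i) → Fin (total m k)
  | 0, _ => fun i => i.elim0
  | m + 1, k => Fin.cases
      (fun j => Fin.castLE (Nat.le_add_left (k 0) (total m fun i => k i.succ)) j)
      (fun i j => (inBlock (fun i => k i.succ) i j).addNat (k 0))

theorem inBlock_zero {m : ℕ} (k : Fin (m + 1) → ℕ) (j : Fin (k 0)) :
    (inBlock k 0 j).val = j.val := rfl

theorem inBlock_succ {m : ℕ} (k : Fin (m + 1) → ℕ) (i : Fin m) (j : Fin (k i.succ)) :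
    (inBlock k i.succ j).val = (inBlock (fun i => k i.succ) i j).val + k 0 := rfl

theorem inBlock_lt_iff : {m : ℕ} → (k : Fin m → ℕ) → (i i' : Fin m) → (j : Fin (k i)) →
    (j' : Fin (k i')) →
    (inBlock k i j < inBlock k i' j' ↔ i < i' ∨ (i = i' ∧ j.val < j'.val))
  | 0, _, i, _, _, _ => i.elim0
  | m + 1, k, i, i', j, j' => by
    rw [Fin.lt_def]
    induction i using Fin.cases with
    | zero =>
      induction i' using Fin.cases with
      | zero => simp [inBlock_zero]
      | succ i' =>
        have := j.isLt
        simp only [inBlock_zero, inBlock_succ, Fin.succ_pos, true_or, iff_true]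
        omega
    | succ i =>
      induction i' using Fin.cases with
      | zero =>
        have := j'.isLt
        have h : ¬ (i.succ = 0) := Fin.succ_ne_zero i
        simp only [inBlock_zero, inBlock_succ, Fin.not_lt_zero, h, false_and, or_self, iff_false]
        omega
      | succ i' =>
        have := inBlock_lt_iff (fun i => k i.succ) i i' j j'
        rw [Fin.lt_def] at this
        simp only [inBlock_succ, Nat.add_lt_add_iff_right, this, Fin.succ_lt_succ_iff,
          Fin.succ_inj]

theorem inBlock_surj : {m : ℕ} → (k : Fin m → ℕ) → (p : Fin (total m k)) →
    ∃ i j, inBlock k i j = p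
  | 0, _, p => p.elim0
  | m + 1, k, p => by
    by_cases h : p.val < k 0
    · exact ⟨0, ⟨p.val, h⟩, rfl⟩
    · have hp : p.val < total m (fun i => k i.succ) + k 0 := p.isLt
      obtain ⟨i, j, hij⟩ := inBlock_surj (fun i => k i.succ)
        ⟨p.val - k 0, by omega⟩
      refine ⟨i.succ, j, Fin.ext ?_⟩
      rw [inBlock_succ, hij]
      simp only
      omega

/-- Positions of a concatenation are pairs of a block and a position in that block. -/
noncomputable def blockEquiv {m : ℕ} (k : Fin m → ℕ) : (Σ i, Fin (k i)) ≃ Fin (total m k) :=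
  Equiv.ofBijective (fun x => inBlock k x.1 x.2) <| by
    refine ⟨?_, fun p => ?_⟩
    · rintro ⟨i, j⟩ ⟨i', j'⟩ h
      have h1 := (inBlock_lt_iff k i i' j j').not.1 (by simp only at h; simp [h])
      have h2 := (inBlock_lt_iff k i' i j' j).not.1 (by simp only at h; simp [h])
      push Not at h1 h2
      obtain rfl : i = i' := le_antisymm h2.1 h1.1
      have : j = j' := Fin.ext (le_antisymm (h2.2 rfl) (h1.2 rfl))
      rw [this]
    · obtain ⟨i, j, h⟩ := inBlock_surj k p
      exact ⟨⟨i, j⟩, h⟩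

@[simp] theorem blockEquiv_apply {m : ℕ} (k : Fin m → ℕ) (i : Fin m) (j : Fin (k i)) :
    blockEquiv k ⟨i, j⟩ = inBlock k i j := rfl

@[simp] theorem blockEquiv_symm {m : ℕ} (k : Fin m → ℕ) (i : Fin m) (j : Fin (k i)) :
    (blockEquiv k).symm (inBlock k i j) = ⟨i, j⟩ := by
  rw [Equiv.symm_apply_eq]; rfl

/-- The block sum `τ₁ ⊕ ⋯ ⊕ τₘ`. -/
noncomputable def blockSum {m : ℕ} (k : Fin m → ℕ) (τ : ∀ i, Equiv.Perm (Fin (k i))) :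
    Equiv.Perm (Fin (total m k)) :=
  (blockEquiv k).symm.trans ((Equiv.sigmaCongrRight τ).trans (blockEquiv k))

/-- The block permutation `σ⟨k₁, …, kₘ⟩`, as the right permutation
`b₁ ⊗ ⋯ ⊗ bₘ ⟶ b_{σ(1)} ⊗ ⋯ ⊗ b_{σ(m)}` for profiles `bᵢ` of length `kᵢ`. -/
noncomputable def blockPerm {m : ℕ} (σ : Equiv.Perm (Fin m)) (k : Fin m → ℕ) :
    Fin (total m (fun i => k (σ i))) ≃ Fin (total m k) :=
  (blockEquiv (fun i => k (σ i))).symm.trans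
    ((Equiv.sigmaCongrLeft (β := fun i => Fin (k i)) σ).trans (blockEquiv k))

@[simp] theorem blockSum_inBlock {m : ℕ} (k : Fin m → ℕ) (τ : ∀ i, Equiv.Perm (Fin (k i)))
    (i : Fin m) (j : Fin (k i)) : blockSum k τ (inBlock k i j) = inBlock k i (τ i j) := by
  simp [blockSum]

@[simp] theorem blockPerm_inBlock {m : ℕ} (σ : Equiv.Perm (Fin m)) (k : Fin m → ℕ)
    (i : Fin m) (j : Fin (k (σ i))) :
    blockPerm σ k (inBlock (fun i => k (σ i)) i j) = inBlock k (σ i) j := by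
  simp only [blockPerm, Equiv.trans_apply, blockEquiv_symm]
  rfl

theorem total_eq_sum : {m : ℕ} → (k : Fin m → ℕ) → total m k = ∑ i, k i
  | 0, _ => by simp [total]
  | m + 1, k => by rw [total, total_eq_sum, Fin.sum_univ_succ, add_comm]

theorem total_perm {m : ℕ} (σ : Equiv.Perm (Fin m)) (k : Fin m → ℕ) :
    total m (fun i => k (σ i)) = total m k := by
  rw [total_eq_sum, total_eq_sum, Equiv.sum_comp]

theorem total_congr {m : ℕ} {k k' : Fin m → ℕ} (h : ∀ i, k i = k' i) : total m k = total m k' := by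
  rw [funext h]

/-- The permutation `σ⟨k_{σ⁻¹(1)}, …, k_{σ⁻¹(m)}⟩ (τ₁ ⊕ ⋯ ⊕ τₘ)`. -/
noncomputable def compPerm {m : ℕ} (k : Fin m → ℕ) (σ : Equiv.Perm (Fin m))
    (τ : ∀ i, Equiv.Perm (Fin (k i))) : Equiv.Perm (Fin (total m k)) :=
  (blockSum k τ).trans <|
    (finCongr (total_congr (k' := fun i => k (σ.symm (σ i))) (by simp))).trans <|
      (blockPerm σ (fun i => k (σ.symm i))).trans (finCongr (total_perm σ.symm k))

theorem inBlock_congr {m : ℕ} {k k' : Fin m → ℕ} (h : ∀ i, k i = k' i) (i : Fin m)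
    (j : Fin (k i)) : finCongr (total_congr h) (inBlock k i j) = inBlock k' i (Fin.cast (h i) j) := by
  obtain rfl : k = k' := funext h
  rfl

theorem compPerm_inBlock {m : ℕ} (k : Fin m → ℕ) (σ : Equiv.Perm (Fin m))
    (τ : ∀ i, Equiv.Perm (Fin (k i))) (i : Fin m) (j : Fin (k i)) :
    compPerm k σ τ (inBlock k i j) = Fin.cast (total_perm σ.symm k)
      (inBlock (fun i => k (σ.symm i)) (σ i) (Fin.cast (by simp) (τ i j))) := by
  have h := inBlock_congr (k' := fun i => k (σ.symm (σ i))) (by simp) i (τ i j)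
  have h' := blockPerm_inBlock σ (fun i => k (σ.symm i)) i (Fin.cast (by simp) (τ i j))
  simp only [compPerm, Equiv.trans_apply, blockSum_inBlock]
  rw [h, h', finCongr_apply]

theorem compPerm_lt_iff {m : ℕ} (k : Fin m → ℕ) (σ : Equiv.Perm (Fin m))
    (τ : ∀ i, Equiv.Perm (Fin (k i))) (i i' : Fin m) (j : Fin (k i)) (j' : Fin (k i')) :
    compPerm k σ τ (inBlock k i j) < compPerm k σ τ (inBlock k i' j') ↔
      σ i < σ i' ∨ (i = i' ∧ (τ i j).val < (τ i' j').val) := by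
  rw [compPerm_inBlock, compPerm_inBlock, Fin.lt_def, Fin.val_cast, Fin.val_cast, ← Fin.lt_def,
    inBlock_lt_iff]
  simp

/-- A bijection between finite ordinals is determined by the order it induces. -/
theorem equiv_ext_of_lt {n m : ℕ} (σ τ : Fin n ≃ Fin m) (h : ∀ p q, σ p < σ q → τ p < τ q) :
    σ = τ := by
  obtain rfl : n = m := by simpa using Fintype.card_congr σ
  have hm : StrictMono (σ.symm.trans τ) := fun p q hpq => by
    simpa using h (σ.symm p) (σ.symm q) (by simpa using hpq)
  have h1 : hm.orderIsoOfSurjective _ (σ.symm.trans τ).surjective = OrderIso.refl _ :=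
    Subsingleton.elim _ _
  ext p
  have := congrArg (fun e : Fin n ≃o Fin n => e (σ p)) h1
  simp at this
  simp [this]


section Tensor

variable {M : Type u} [Category.{v} M] [MonoidalCategory M]

/-- The `n`-fold tensor product `X₁ ⊗ (X₂ ⊗ ⋯ (Xₙ ⊗ 𝟙))`. -/
def tpow : (n : ℕ) → (Fin n → M) → M
  | 0, _ => 𝟙_ M
  | n + 1, X => X 0 ⊗ tpow n (fun i => X i.succ)

/-- Functoriality of the `n`-fold tensor product. -/
def tmap : {n : ℕ} → {X Y : Fin n → M} → (∀ i, X i ⟶ Y i) → (tpow n X ⟶ tpow n Y)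
  | 0, _, _, _ => 𝟙 (𝟙_ M)
  | _ + 1, _, _, f => f 0 ⊗ₘ tmap (fun i => f i.succ)

theorem tmap_id : {n : ℕ} → (X : Fin n → M) → tmap (fun i => 𝟙 (X i)) = 𝟙 (tpow n X)
  | 0, _ => rfl
  | _ + 1, X => by
    rw [tmap, tmap_id (fun i => X i.succ)]
    exact id_tensorHom_id _ _

theorem tmap_comp : {n : ℕ} → {X Y Z : Fin n → M} → (f : ∀ i, X i ⟶ Y i) →
    (g : ∀ i, Y i ⟶ Z i) → tmap (fun i => f i ≫ g i) = tmap f ≫ tmap g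
  | 0, _, _, _, _, _ => (Category.id_comp _).symm
  | _ + 1, _, _, _, f, g => by
    rw [tmap, tmap_comp (fun i => f i.succ) (fun i => g i.succ)]
    exact (tensorHom_comp_tensorHom _ _ _ _).symm

/-- The canonical isomorphism splitting off the first `p` tensor factors. -/
def tsplit : (p q : ℕ) → (Z : Fin (q + p) → M) →
    (tpow (q + p) Z ≅ tpow p (fun i => Z (Fin.castLE (Nat.le_add_left p q) i)) ⊗
      tpow q (fun i => Z (i.addNat p)))
  | 0, _, _ => (λ_ _).symm
  | p + 1, q, Z =>
      whiskerLeftIso (Z 0) (tsplit p q (fun i => Z i.succ)) ≪≫ (α_ _ _ _).symm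

/-- The canonical isomorphism from the tensor product over a concatenation to the tensor product
of the tensor products over the blocks. -/
def tblocks : {m : ℕ} → (k : Fin m → ℕ) → (Z : Fin (total m k) → M) →
    (tpow (total m k) Z ≅ tpow m (fun i => tpow (k i) (fun j => Z (inBlock k i j))))
  | 0, _, _ => Iso.refl _
  | _ + 1, k, Z => tsplit (k 0) _ Z ≪≫
      whiskerLeftIso _ (tblocks (fun i => k i.succ) (fun p => Z (p.addNat (k 0))))

/-- The increasing injection of `Fin n` into `Fin (n + 1)` that misses `i`. -/
def skip : {n : ℕ} → Fin (n + 1) → Fin n → Fin (n + 1)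
  | 0, _ => fun j => j.elim0
  | _ + 1, i => fun j =>
      Fin.cases j.succ (fun i' => Fin.cases 0 (fun j' => (skip i' j').succ) j) i

theorem skip_eq_succAbove : {n : ℕ} → (i : Fin (n + 1)) → (j : Fin n) →
    skip i j = i.succAbove j
  | 0, _, j => j.elim0
  | n + 1, i, j => by
    induction i using Fin.cases with
    | zero => simp [skip]
    | succ i =>
      induction j using Fin.cases with
      | zero => simp [skip]
      | succ j => simp [skip, skip_eq_succAbove i j]

/-- The permutation of the inputs other than the first one that is induced by `σ`. -/
def restPerm {n : ℕ} (σ : Equiv.Perm (Fin (n + 1))) : Equiv.Perm (Fin n) :=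
  (finSuccAboveEquiv 0).trans
    ((σ.subtypeEquiv (by simp)).trans (finSuccAboveEquiv (σ 0)).symm)

theorem skip_restPerm {n : ℕ} (σ : Equiv.Perm (Fin (n + 1))) (j : Fin n) :
    skip (σ 0) (restPerm σ j) = σ j.succ := by
  rw [skip_eq_succAbove]
  have h := finSuccAboveEquiv_apply (σ 0) (restPerm σ j)
  have h2 := congrArg Subtype.val h
  refine h2.symm.trans ?_
  simp [restPerm, finSuccAboveEquiv_apply]

variable [BraidedCategory M]

/-- Moving the `i`-th tensor factor to the front with the braiding. -/
def tpull : {n : ℕ} → (X : Fin (n + 1) → M) → (i : Fin (n + 1)) →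
    (tpow (n + 1) X ⟶ X i ⊗ tpow n (fun j => X (skip i j)))
  | 0, _ => Fin.cases (𝟙 _) (fun i => i.elim0)
  | _ + 1, X => Fin.cases (𝟙 _) (fun i =>
      (X 0 ◁ tpull (fun j => X j.succ) i) ≫ (α_ _ _ _).inv ≫
        ((β_ (X 0) (X i.succ)).hom ▷ _) ≫ (α_ _ _ _).hom)

/-- The morphism that permutes the tensor factors, putting the factor `X (σ i)` in place `i`,
followed by morphisms `X (σ i) ⟶ Y i`. -/
def tpermMap : {n : ℕ} → (σ : Equiv.Perm (Fin n)) → {X Y : Fin n → M} →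
    (∀ i, X (σ i) ⟶ Y i) → (tpow n X ⟶ tpow n Y)
  | 0, _, _, _, _ => 𝟙 (𝟙_ M)
  | _ + 1, σ, X, _, f => tpull X (σ 0) ≫
      (f 0 ⊗ₘ tpermMap (restPerm σ)
        (fun j => eqToHom (congrArg X (skip_restPerm σ j)) ≫ f j.succ))

/-- The permutation `τ_σ` of tensor factors, sending `⨂ᵢ Xᵢ` to `⨂ᵢ X_{σ(i)}`. -/
def tperm {n : ℕ} (σ : Equiv.Perm (Fin n)) (X : Fin n → M) :
    tpow n X ⟶ tpow n (fun i => X (σ i)) :=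
  tpermMap σ (fun i => 𝟙 (X (σ i)))

end Tensor

section Operad

/-- The identification of positions in the two bracketings of a twofold concatenation: the
`x`-th input of the `j`-th subblock of the `i`-th block goes to the same input. -/
noncomputable def assocEquiv {m : ℕ} (k : Fin m → ℕ) (l : Fin (total m k) → ℕ) :
    Fin (total m fun i => total (k i) fun j => l (inBlock k i j)) ≃ Fin (total (total m k) l) :=
  (blockEquiv _).symm.trans <|
    (Equiv.sigmaCongrRight fun i => (blockEquiv fun j => l (inBlock k i j)).symm).trans <|
      (Equiv.sigmaAssoc fun i j => Fin (l (inBlock k i j))).symm.trans <|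
        (Equiv.sigmaCongrLeft (β := fun p => Fin (l p)) (blockEquiv k)).trans (blockEquiv l)

@[simp] theorem assocEquiv_inBlock {m : ℕ} (k : Fin m → ℕ) (l : Fin (total m k) → ℕ)
    (i : Fin m) (j : Fin (k i)) (x : Fin (l (inBlock k i j))) :
    assocEquiv k l (inBlock (fun i => total (k i) fun j => l (inBlock k i j)) i
      (inBlock (fun j => l (inBlock k i j)) j x)) = inBlock l (inBlock k i j) x := by
  simp [assocEquiv]
  rfl

/-- The concatenation of `m` profiles of length one has `m` entries. -/
noncomputable def singlesEquiv (m : ℕ) : Fin (total m fun _ => 1) ≃ Fin m :=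
  (blockEquiv _).symm.trans (Equiv.sigmaUnique (Fin m) fun _ => Fin 1)

@[simp] theorem singlesEquiv_inBlock (m : ℕ) (i : Fin m) (j : Fin 1) :
    singlesEquiv m (inBlock (fun _ => 1) i j) = i := by
  simp [singlesEquiv]

/-- The concatenation of a single profile of length `n` has `n` entries. -/
noncomputable def oneBlockEquiv (n : ℕ) : Fin (total 1 fun _ => n) ≃ Fin n :=
  (blockEquiv _).symm.trans (Equiv.uniqueSigma fun _ : Fin 1 => Fin n)

@[simp] theorem oneBlockEquiv_inBlock (n : ℕ) (i : Fin 1) (j : Fin n) :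
    oneBlockEquiv n (inBlock (fun _ => n) i j) = j := by
  obtain rfl : i = 0 := Subsingleton.elim _ _
  simp [oneBlockEquiv]
  rfl

theorem reflEq {α : Type v} {n : ℕ} {c c' : Fin n → α} (h : ∀ j, c' j = c j) :
    ∀ j, c' j = c (Equiv.refl (Fin n) j) := h

/-- A symmetric operad in sets with set of colours `𝔠`. A morphism of profiles from
`c : Fin n → 𝔠` to `c' : Fin n' → 𝔠` is a bijection `σ` with `c' i = c (σ i)`, that is, a right
permutation `c ⟶ cσ` (necessarily `n' = n`). -/
structure ColoredOperad (𝔠 : Type v) where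
  /-- The set of operations with inputs `c` and output `t`. -/
  ops : {n : ℕ} → (Fin n → 𝔠) → 𝔠 → Type v
  /-- The right action of permutations. -/
  map : {n n' : ℕ} → {c : Fin n → 𝔠} → {c' : Fin n' → 𝔠} → {t : 𝔠} → (σ : Fin n' ≃ Fin n) →
    (∀ i, c' i = c (σ i)) → ops c t → ops c' t
  /-- The composition `γ`. -/
  comp : {m : ℕ} → {k : Fin m → ℕ} → {a : Fin m → 𝔠} → {c : Fin (total m k) → 𝔠} → {t : 𝔠} →
    ops a t → (∀ i, ops (fun j => c (inBlock k i j)) (a i)) → ops c t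
  /-- The operadic units. -/
  one : (t : 𝔠) → ops (fun _ : Fin 1 => t) t
  map_refl : ∀ {n : ℕ} {c : Fin n → 𝔠} {t : 𝔠} (o : ops c t),
    map (Equiv.refl _) (reflEq fun _ => rfl) o = o
  map_map : ∀ {n n' n'' : ℕ} {c : Fin n → 𝔠} {c' : Fin n' → 𝔠} {c'' : Fin n'' → 𝔠} {t : 𝔠}
    (σ : Fin n' ≃ Fin n) (h : ∀ i, c' i = c (σ i)) (σ' : Fin n'' ≃ Fin n')
    (h' : ∀ i, c'' i = c' (σ' i)) (o : ops c t),
    map σ' h' (map σ h o) = map (σ'.trans σ) (fun i => (h' i).trans (h _)) o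
  /-- Equivariance of the composition for permutations of the blocks. -/
  map_blockPerm : ∀ {m : ℕ} {k : Fin m → ℕ} {a : Fin m → 𝔠} {c : Fin (total m k) → 𝔠} {t : 𝔠}
    (σ : Equiv.Perm (Fin m)) (o : ops a t) (q : ∀ i, ops (fun j => c (inBlock k i j)) (a i)),
    map (blockPerm σ k) (fun _ => rfl) (comp o q) =
      comp (k := fun i => k (σ i)) (c := fun p => c (blockPerm σ k p))
        (map (c' := fun i => a (σ i)) σ (fun _ => rfl) o)
        (fun i => map (Equiv.refl _) (reflEq fun j => by simp) (q (σ i)))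
  /-- Equivariance of the composition for permutations inside the blocks. -/
  map_blockSum : ∀ {m : ℕ} {k : Fin m → ℕ} {a : Fin m → 𝔠} {c : Fin (total m k) → 𝔠} {t : 𝔠}
    (τ : ∀ i, Equiv.Perm (Fin (k i))) (o : ops a t)
    (q : ∀ i, ops (fun j => c (inBlock k i j)) (a i)),
    map (blockSum k τ) (fun _ => rfl) (comp o q) =
      comp (k := k) (c := fun p => c (blockSum k τ p)) o
        (fun i => map (τ i) (fun j => by simp) (q i))
  /-- Associativity. -/
  comp_assoc : ∀ {m : ℕ} {k : Fin m → ℕ} {a : Fin m → 𝔠} {b : Fin (total m k) → 𝔠}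
    {l : Fin (total m k) → ℕ} {c : Fin (total (total m k) l) → 𝔠} {t : 𝔠} (o : ops a t)
    (q : ∀ i, ops (fun j => b (inBlock k i j)) (a i))
    (r : ∀ p, ops (fun x => c (inBlock l p x)) (b p)),
    map (assocEquiv k l) (fun _ => rfl) (comp (comp o q) r) =
      comp (k := fun i => total (k i) fun j => l (inBlock k i j))
        (c := fun p => c (assocEquiv k l p)) o
        (fun i => comp (q i)
          (fun j => map (Equiv.refl _) (reflEq fun x => by simp) (r (inBlock k i j))))
  /-- Unitality with respect to the units of the inputs. -/
  comp_one : ∀ {m : ℕ} {a : Fin m → 𝔠} {t : 𝔠} (o : ops a t),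
    comp (k := fun _ => 1) (c := fun p => a (singlesEquiv m p)) o
        (fun i => map (Equiv.refl _) (reflEq fun j => by simp) (one (a i))) =
      map (singlesEquiv m) (fun _ => rfl) o
  /-- Unitality with respect to the unit of the output. -/
  one_comp : ∀ {n : ℕ} {c : Fin n → 𝔠} {t : 𝔠} (o : ops c t),
    comp (k := fun _ : Fin 1 => n) (c := fun p => c (oneBlockEquiv n p)) (one t)
        (fun i => map (Equiv.refl _) (reflEq fun j => by simp) o) =
      map (oneBlockEquiv n) (fun _ => rfl) o

/-- A morphism of operads with varying colours: a map of colours `f` together with a morphism of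
operads `φ` from `O` to the pullback of `P` along `f`. -/
structure OperadHom {𝔠 𝔡 : Type v} (O : ColoredOperad 𝔠) (P : ColoredOperad 𝔡) where
  f : 𝔠 → 𝔡
  φ : {n : ℕ} → {c : Fin n → 𝔠} → {t : 𝔠} → O.ops c t → P.ops (fun i => f (c i)) (f t)
  φ_map : ∀ {n n' : ℕ} {c : Fin n → 𝔠} {c' : Fin n' → 𝔠} {t : 𝔠} (σ : Fin n' ≃ Fin n)
    (h : ∀ i, c' i = c (σ i)) (o : O.ops c t),
    φ (O.map σ h o) = P.map σ (fun i => congrArg f (h i)) (φ o)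
  φ_comp : ∀ {m : ℕ} {k : Fin m → ℕ} {a : Fin m → 𝔠} {c : Fin (total m k) → 𝔠} {t : 𝔠}
    (o : O.ops a t) (q : ∀ i, O.ops (fun j => c (inBlock k i j)) (a i)),
    φ (O.comp o q) = P.comp (c := fun p => f (c p)) (φ o) (fun i => φ (q i))
  φ_one : ∀ t, φ (O.one t) = P.one (f t)

end Operad

section Algebra

variable {𝔠 𝔡 : Type v} (O : ColoredOperad.{v} 𝔠) (P : ColoredOperad.{v} 𝔡)
variable (M : Type u) [Category.{v} M] [MonoidalCategory M] [BraidedCategory M] [HasColimits M]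

/-- The objects `O(c; t) ⊗ I = ∐_{O(c; t)} I` of the `M`-valued operad `O ⊗ I` obtained from the
set-valued operad `O` by change of base category. Its permutation actions, composition and units
are those of `O`, applied to the summands. -/
noncomputable abbrev ColoredOperad.baseChange {n : ℕ} (c : Fin n → 𝔠) (t : 𝔠) : M :=
  ∐ fun _ : O.ops c t => 𝟙_ M

variable {M}

variable {O} in
/-- The operation `⨂ᵢ Xᵢ ⟶ Y` that a morphism `(O(c; t) ⊗ I) ⊗ ⨂ᵢ Xᵢ ⟶ Y` assigns to an
element `o` of `O(c; t)`. -/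
noncomputable def operation {n : ℕ} {c : Fin n → 𝔠} {t : 𝔠} {X Y : M}
    (α : O.baseChange M c t ⊗ X ⟶ Y) (o : O.ops c t) : X ⟶ Y :=
  (λ_ X).inv ≫ (Sigma.ι (fun _ : O.ops c t => 𝟙_ M) o ▷ X) ≫ α

variable (M) in
/-- An algebra over the `M`-valued operad `O ⊗ I`. Since `M` is closed, the axioms can be (and
are) stated on the summands of the coproducts `O(c; t) ⊗ I`. -/
structure Algebra where
  /-- The underlying coloured object. -/
  obj : 𝔠 → M
  /-- The structure maps. -/
  str : {n : ℕ} → (c : Fin n → 𝔠) → (t : 𝔠) →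
    (O.baseChange M c t ⊗ tpow n (fun i => obj (c i)) ⟶ obj t)
  equivariance : ∀ {n : ℕ} {c : Fin n → 𝔠} {t : 𝔠} (σ : Equiv.Perm (Fin n)) (o : O.ops c t),
    tperm σ (fun i => obj (c i)) ≫
        operation (str (fun i => c (σ i)) t) (O.map σ (fun _ => rfl) o) =
      operation (str c t) o
  associativity : ∀ {m : ℕ} {k : Fin m → ℕ} {a : Fin m → 𝔠} {c : Fin (total m k) → 𝔠} {t : 𝔠}
    (o : O.ops a t) (q : ∀ i, O.ops (fun j => c (inBlock k i j)) (a i)),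
    operation (str c t) (O.comp o q) =
      (tblocks k fun p => obj (c p)).hom ≫
        tmap (fun i => operation (str (fun j => c (inBlock k i j)) (a i)) (q i)) ≫
          operation (str a t) o
  unitality : ∀ t : 𝔠,
    operation (str (fun _ : Fin 1 => t) t) (O.one t) = (ρ_ (obj t)).hom

namespace Algebra

variable {O P}

/-- A morphism of algebras. -/
@[ext] structure Hom (A B : Algebra O M) where
  hom : ∀ t, A.obj t ⟶ B.obj t
  comm : ∀ {n : ℕ} (c : Fin n → 𝔠) (t : 𝔠),
    A.str c t ≫ hom t = (O.baseChange M c t ◁ tmap (fun i => hom (c i))) ≫ B.str c t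

instance : Category (Algebra O M) where
  Hom := Hom
  id A := ⟨fun t => 𝟙 _, fun c t => by simp [tmap_id]⟩
  comp f g := ⟨fun t => f.hom t ≫ g.hom t, fun c t => by
    rw [tmap_comp, MonoidalCategory.whiskerLeft_comp, Category.assoc, ← g.comm,
      ← Category.assoc, f.comm, Category.assoc]⟩
  id_comp f := Hom.ext (by funext t; exact Category.id_comp _)
  comp_id f := Hom.ext (by funext t; exact Category.comp_id _)
  assoc f g h := Hom.ext (by funext t; exact Category.assoc _ _ _)

/-- The operation on an algebra given by an element of the operad. -/
noncomputable def op (A : Algebra O M) {n : ℕ} {c : Fin n → 𝔠} {t : 𝔠} (o : O.ops c t) :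
    tpow n (fun i => A.obj (c i)) ⟶ A.obj t :=
  operation (A.str c t) o

theorem Hom.op_comm {A B : Algebra O M} (f : A ⟶ B) {n : ℕ} {c : Fin n → 𝔠} {t : 𝔠}
    (o : O.ops c t) : A.op o ≫ Hom.hom f t = tmap (fun i => Hom.hom f (c i)) ≫ B.op o := by
  simp only [op, operation, Category.assoc, Hom.comm]
  rw [← whisker_exchange_assoc, leftUnitor_inv_naturality_assoc]

/-- The structure maps of the pullback of an algebra. -/
noncomputable def pullbackStr (F : OperadHom O P) (B : Algebra P M) {n : ℕ} (c : Fin n → 𝔠)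
    (t : 𝔠) : O.baseChange M c t ⊗ tpow n (fun i => B.obj (F.f (c i))) ⟶ B.obj (F.f t) :=
  (Sigma.desc (fun o : O.ops c t =>
      Sigma.ι (fun _ : P.ops (fun i => F.f (c i)) (F.f t) => 𝟙_ M) (F.φ o)) ▷ _) ≫
    B.str (fun i => F.f (c i)) (F.f t)

theorem operation_pullbackStr (F : OperadHom O P) (B : Algebra P M) {n : ℕ} {c : Fin n → 𝔠}
    {t : 𝔠} (o : O.ops c t) :
    operation (pullbackStr F B c t) o =
      operation (B.str (fun i => F.f (c i)) (F.f t)) (F.φ o) := by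
  simp only [operation, pullbackStr]
  rw [← comp_whiskerRight_assoc, Sigma.ι_desc]

/-- The pullback functor `(f, φ)^* : Alg(P) ⥤ Alg(O)` along a morphism of operads. -/
noncomputable def pullback (M : Type u) [Category.{v} M] [MonoidalCategory M] [BraidedCategory M]
    [HasColimits M] (F : OperadHom O P) : Algebra P M ⥤ Algebra O M where
  obj B :=
    { obj := fun t => B.obj (F.f t)
      str := pullbackStr F B
      equivariance := fun σ o => by
        rw [operation_pullbackStr, operation_pullbackStr, F.φ_map]
        exact B.equivariance σ (F.φ o)
      associativity := fun {m k a c t} o q => by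
        simp only [operation_pullbackStr, F.φ_comp]
        exact B.associativity (c := fun p => F.f (c p)) (F.φ o) (fun i => F.φ (q i))
      unitality := fun t => by
        rw [operation_pullbackStr, F.φ_one]
        exact B.unitality (F.f t) }
  map {A B} g :=
    { hom := fun t => Hom.hom g (F.f t)
      comm := fun c t => by
        simp only [pullbackStr, Category.assoc, Hom.comm]
        rw [whisker_exchange_assoc] }
  map_id A := rfl
  map_comp f g := rfl

end Algebra

end Algebra

section QFT

variable (C : Type v) [SmallCategory C]

/-- An orthogonality relation on a small category: a symmetric relation on the pairs of morphisms
with the same target that is stable under post-composition and under pre-composition. -/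
structure OrthogonalityRelation where
  perp : {c₁ c₂ c : C} → (c₁ ⟶ c) → (c₂ ⟶ c) → Prop
  symm : ∀ {c₁ c₂ c : C} {f₁ : c₁ ⟶ c} {f₂ : c₂ ⟶ c}, perp f₁ f₂ → perp f₂ f₁
  postcomp : ∀ {c₁ c₂ c d : C} {f₁ : c₁ ⟶ c} {f₂ : c₂ ⟶ c} (g : c ⟶ d),
    perp f₁ f₂ → perp (f₁ ≫ g) (f₂ ≫ g)
  precomp : ∀ {b₁ b₂ c₁ c₂ c : C} {f₁ : c₁ ⟶ c} {f₂ : c₂ ⟶ c} (h₁ : b₁ ⟶ c₁) (h₂ : b₂ ⟶ c₂),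
    perp f₁ f₂ → perp (h₁ ≫ f₁) (h₂ ≫ f₂)

variable {C}

/-- The elements `(σ, f)` of `Σₙ × ∏ᵢ C(cᵢ, t)`. -/
abbrev Word {n : ℕ} (c : Fin n → C) (t : C) : Type v := Equiv.Perm (Fin n) × (∀ i, c i ⟶ t)

namespace Word

/-- The right action `(σ, f) ↦ (σσ', fσ')` of `σ' : c ⟶ c'`. The numbers `n` and `n'` are equal,
but not definitionally so. -/
def map {n n' : ℕ} {c : Fin n → C} {c' : Fin n' → C} {t : C} (σ' : Fin n' ≃ Fin n)
    (h : ∀ i, c' i = c (σ' i)) (x : Word c t) : Word c' t :=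
  ⟨σ'.trans (x.1.trans (finCongr (by simpa using (Fintype.card_congr σ').symm))),
    fun i => eqToHom (h i) ≫ x.2 (σ' i)⟩

/-- The family `f(g₁, …, gₘ) = (fᵢ gᵢⱼ)` over the concatenated profile. -/
noncomputable def compHom {m : ℕ} {k : Fin m → ℕ} {a : Fin m → C} {c : Fin (total m k) → C} {t : C}
    (f : ∀ i, a i ⟶ t) (g : ∀ i j, c (inBlock k i j) ⟶ a i) : ∀ p, c p ⟶ t :=
  Equiv.piCongrLeft (fun p => c p ⟶ t) (blockEquiv k) (fun x => g x.1 x.2 ≫ f x.1)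

@[simp] theorem compHom_inBlock {m : ℕ} {k : Fin m → ℕ} {a : Fin m → C}
    {c : Fin (total m k) → C} {t : C} (f : ∀ i, a i ⟶ t)
    (g : ∀ i j, c (inBlock k i j) ⟶ a i) (i : Fin m) (j : Fin (k i)) :
    compHom f g (inBlock k i j) = g i j ≫ f i :=
  Equiv.piCongrLeft_apply_apply (P := fun p => c p ⟶ t) (e := blockEquiv k)
    (fun x => g x.1 x.2 ≫ f x.1) ⟨i, j⟩

/-- The composition
`((σ, f), (τᵢ, gᵢ)) ↦ (σ⟨k_{σ⁻¹(1)}, …, k_{σ⁻¹(m)}⟩ (τ₁ ⊕ ⋯ ⊕ τₘ), f(g₁, …, gₘ))`. -/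
noncomputable def comp {m : ℕ} {k : Fin m → ℕ} {a : Fin m → C} {c : Fin (total m k) → C} {t : C}
    (x : Word a t) (y : ∀ i, Word (fun j => c (inBlock k i j)) (a i)) : Word c t :=
  ⟨compPerm k x.1 (fun i => (y i).1), compHom x.2 (fun i => (y i).2)⟩

/-- The unit `(e, id)`. -/
def one (t : C) : Word (fun _ : Fin 1 => t) t := ⟨1, fun _ => 𝟙 t⟩

theorem ext_of_lt {n : ℕ} {c : Fin n → C} {t : C} {x y : Word c t}
    (h : ∀ p q, x.1 p < x.1 q ↔ y.1 p < y.1 q) (h' : ∀ p, x.2 p = y.2 p) : x = y :=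
  Prod.ext (equiv_ext_of_lt _ _ fun p q => (h p q).1) (funext h')

theorem hom_congr {n : ℕ} {c : Fin n → C} {t : C} (f : ∀ i, c i ⟶ t) {p q : Fin n} (h : p = q) :
    f p = eqToHom (congrArg c h) ≫ f q := by
  subst h; simp

theorem map_lt {n n' : ℕ} {c : Fin n → C} {c' : Fin n' → C} {t : C} (σ' : Fin n' ≃ Fin n)
    (h : ∀ i, c' i = c (σ' i)) (x : Word c t) (p q : Fin n') :
    (map σ' h x).1 p < (map σ' h x).1 q ↔ x.1 (σ' p) < x.1 (σ' q) := by
  simp [map]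

theorem comp_lt {m : ℕ} {k : Fin m → ℕ} {a : Fin m → C} {c : Fin (total m k) → C} {t : C}
    (x : Word a t) (y : ∀ i, Word (fun j => c (inBlock k i j)) (a i)) (i i' : Fin m)
    (j : Fin (k i)) (j' : Fin (k i')) :
    (comp x y).1 (inBlock k i j) < (comp x y).1 (inBlock k i' j') ↔
      x.1 i < x.1 i' ∨ (i = i' ∧ ((y i).1 j).val < ((y i').1 j').val) :=
  compPerm_lt_iff _ _ _ _ _ _ _

theorem map_val {n n' : ℕ} {c : Fin n → C} {c' : Fin n' → C} {t : C} (σ' : Fin n' ≃ Fin n)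
    (h : ∀ i, c' i = c (σ' i)) (x : Word c t) (p : Fin n') :
    ((map σ' h x).1 p).val = (x.1 (σ' p)).val := rfl

theorem map_hom {n n' : ℕ} {c : Fin n → C} {c' : Fin n' → C} {t : C} (σ' : Fin n' ≃ Fin n)
    (h : ∀ i, c' i = c (σ' i)) (x : Word c t) (p : Fin n') :
    (map σ' h x).2 p = eqToHom (h p) ≫ x.2 (σ' p) := rfl

theorem comp_hom {m : ℕ} {k : Fin m → ℕ} {a : Fin m → C} {c : Fin (total m k) → C} {t : C}
    (x : Word a t) (y : ∀ i, Word (fun j => c (inBlock k i j)) (a i)) (i : Fin m)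
    (j : Fin (k i)) : (comp x y).2 (inBlock k i j) = (y i).2 j ≫ x.2 i :=
  compHom_inBlock x.2 (fun i => (y i).2) i j

theorem map_refl {n : ℕ} {c : Fin n → C} {t : C} (h : ∀ i, c i = c (Equiv.refl _ i))
    (o : Word c t) : map (Equiv.refl _) h o = o :=
  ext_of_lt (fun p q => by rw [map_lt]; rfl) (fun p => Category.id_comp (o.2 p))

theorem map_map {n n' n'' : ℕ} {c : Fin n → C} {c' : Fin n' → C} {c'' : Fin n'' → C} {t : C}
    (σ : Fin n' ≃ Fin n) (h : ∀ i, c' i = c (σ i)) (σ' : Fin n'' ≃ Fin n')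
    (h' : ∀ i, c'' i = c' (σ' i)) (o : Word c t) :
    map σ' h' (map σ h o) = map (σ'.trans σ) (fun i => (h' i).trans (h _)) o :=
  ext_of_lt (fun p q => by rw [map_lt, map_lt, map_lt]; rfl) (fun p => by simp [map_hom])

theorem map_blockPerm {m : ℕ} {k : Fin m → ℕ} {a : Fin m → C} {c : Fin (total m k) → C} {t : C}
    (σ : Equiv.Perm (Fin m))
    (h : ∀ p, c (blockPerm σ k p) = c (blockPerm σ k p))
    (o : Word a t) (q : ∀ i, Word (fun j => c (inBlock k i j)) (a i))
    (h' : ∀ i j, c (blockPerm σ k (inBlock (fun i => k (σ i)) i j)) =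
      c (inBlock k (σ i) (Equiv.refl _ j))) :
    map (c' := fun p => c (blockPerm σ k p)) (blockPerm σ k) h (comp o q) =
      comp (k := fun i => k (σ i)) (c := fun p => c (blockPerm σ k p))
        (map (c' := fun i => a (σ i)) σ (fun _ => rfl) o)
        (fun i => map (Equiv.refl _) (h' i) (q (σ i))) := by
  refine ext_of_lt (fun p p' => ?_) (fun p => ?_)
  · obtain ⟨i, j, rfl⟩ := inBlock_surj _ p
    obtain ⟨i', j', rfl⟩ := inBlock_surj _ p'
    rw [map_lt, comp_lt, blockPerm_inBlock, blockPerm_inBlock, comp_lt, map_lt, map_val, map_val]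
    simp
  · obtain ⟨i, j, rfl⟩ := inBlock_surj _ p
    rw [map_hom, comp_hom, hom_congr (comp o q).2 (blockPerm_inBlock σ k i j), comp_hom,
      map_hom, map_hom]
    simp

theorem map_blockSum {m : ℕ} {k : Fin m → ℕ} {a : Fin m → C} {c : Fin (total m k) → C} {t : C}
    (τ : ∀ i, Equiv.Perm (Fin (k i)))
    (h : ∀ p, c (blockSum k τ p) = c (blockSum k τ p)) (o : Word a t)
    (q : ∀ i, Word (fun j => c (inBlock k i j)) (a i))
    (h' : ∀ i j, c (blockSum k τ (inBlock k i j)) = c (inBlock k i (τ i j))) :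
    map (c' := fun p => c (blockSum k τ p)) (blockSum k τ) h (comp o q) =
      comp (k := k) (c := fun p => c (blockSum k τ p)) o
        (fun i => map (τ i) (h' i) (q i)) := by
  refine ext_of_lt (fun p p' => ?_) (fun p => ?_)
  · obtain ⟨i, j, rfl⟩ := inBlock_surj _ p
    obtain ⟨i', j', rfl⟩ := inBlock_surj _ p'
    rw [map_lt, comp_lt, blockSum_inBlock, blockSum_inBlock, comp_lt, map_val, map_val]
  · obtain ⟨i, j, rfl⟩ := inBlock_surj _ p
    rw [map_hom, comp_hom, hom_congr (comp o q).2 (blockSum_inBlock k τ i j), comp_hom,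
      map_hom]
    simp

theorem comp_assoc {m : ℕ} {k : Fin m → ℕ} {a : Fin m → C} {b : Fin (total m k) → C}
    {l : Fin (total m k) → ℕ} {c : Fin (total (total m k) l) → C} {t : C}
    (h : ∀ p, c (assocEquiv k l p) = c (assocEquiv k l p)) (o : Word a t)
    (q : ∀ i, Word (fun j => b (inBlock k i j)) (a i))
    (r : ∀ p, Word (fun x => c (inBlock l p x)) (b p))
    (h' : ∀ i j x, c (assocEquiv k l (inBlock (fun i => total (k i) fun j => l (inBlock k i j)) i
      (inBlock (fun j => l (inBlock k i j)) j x))) =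
        c (inBlock l (inBlock k i j) (Equiv.refl _ x))) :
    map (c' := fun p => c (assocEquiv k l p)) (assocEquiv k l) h (comp (comp o q) r) =
      comp (k := fun i => total (k i) fun j => l (inBlock k i j))
        (c := fun p => c (assocEquiv k l p)) o
        (fun i => comp (q i)
          (fun j => map (Equiv.refl _) (h' i j) (r (inBlock k i j)))) := by
  refine ext_of_lt (fun p p' => ?_) (fun p => ?_)
  · obtain ⟨i, j, rfl⟩ := inBlock_surj _ p
    obtain ⟨j, x, rfl⟩ := inBlock_surj _ j
    obtain ⟨i', j', rfl⟩ := inBlock_surj _ p'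
    obtain ⟨j', x', rfl⟩ := inBlock_surj _ j'
    rw [map_lt, comp_lt, assocEquiv_inBlock, assocEquiv_inBlock, comp_lt, comp_lt]
    by_cases hi : i = i'
    · subst hi
      have key := comp_lt
        (c := fun y => c (assocEquiv k l
          (inBlock (fun i => total (k i) fun j => l (inBlock k i j)) i y))) (q i)
        (fun j => map (Equiv.refl _) (h' i j) (r (inBlock k i j))) j j' x x'
      rw [map_val, map_val, Fin.lt_def] at key
      rw [key]
      have e : inBlock k i j = inBlock k i j' ↔ j = j' := by
        constructor
        · intro e
          have := congrArg (blockEquiv k).symm e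
          simpa using this
        · rintro rfl; rfl
      simp [e]
    · have e : inBlock k i j ≠ inBlock k i' j' := by
        intro e
        have := congrArg (fun z => ((blockEquiv k).symm z).1) e
        simp at this
        exact hi this
      simp [hi, e]
  · obtain ⟨i, j, rfl⟩ := inBlock_surj _ p
    obtain ⟨j, x, rfl⟩ := inBlock_surj _ j
    rw [map_hom, comp_hom, hom_congr (comp (comp o q) r).2 (assocEquiv_inBlock k l i j x),
      comp_hom, comp_hom, comp_hom, map_hom]
    simp

theorem comp_one {m : ℕ} {a : Fin m → C} {t : C}
    (h : ∀ p, a (singlesEquiv m p) = a (singlesEquiv m p)) (o : Word a t)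
    (h' : ∀ i j, a (singlesEquiv m (inBlock (fun _ => 1) i j)) = a i) :
    comp (k := fun _ => 1) (c := fun p => a (singlesEquiv m p)) o
        (fun i => map (Equiv.refl _) (h' i) (one (a i))) =
      map (c' := fun p => a (singlesEquiv m p)) (singlesEquiv m) h o := by
  refine ext_of_lt (fun p p' => ?_) (fun p => ?_)
  · obtain ⟨i, j, rfl⟩ := inBlock_surj _ p
    obtain ⟨i', j', rfl⟩ := inBlock_surj _ p'
    rw [map_lt, comp_lt, singlesEquiv_inBlock, singlesEquiv_inBlock]
    simp
  · obtain ⟨i, j, rfl⟩ := inBlock_surj _ p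
    rw [map_hom, comp_hom, hom_congr o.2 (singlesEquiv_inBlock m i j), map_hom]
    simp [one]

theorem one_comp {n : ℕ} {c : Fin n → C} {t : C}
    (h : ∀ p, c (oneBlockEquiv n p) = c (oneBlockEquiv n p)) (o : Word c t)
    (h' : ∀ (i : Fin 1) j, c (oneBlockEquiv n (inBlock (fun _ => n) i j)) =
      c (Equiv.refl _ j)) :
    comp (k := fun _ : Fin 1 => n) (c := fun p => c (oneBlockEquiv n p)) (one t)
        (fun i => map (Equiv.refl _) (h' i) o) =
      map (c' := fun p => c (oneBlockEquiv n p)) (oneBlockEquiv n) h o := by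
  refine ext_of_lt (fun p p' => ?_) (fun p => ?_)
  · obtain ⟨i, j, rfl⟩ := inBlock_surj _ p
    obtain ⟨i', j', rfl⟩ := inBlock_surj _ p'
    obtain rfl : i = i' := Subsingleton.elim _ _
    rw [map_lt, comp_lt, oneBlockEquiv_inBlock, oneBlockEquiv_inBlock, map_val, map_val]
    simp
  · obtain ⟨i, j, rfl⟩ := inBlock_surj _ p
    rw [map_hom, comp_hom, hom_congr o.2 (oneBlockEquiv_inBlock n i j), map_hom]
    simp [one]

end Word

variable (C) in
/-- The operad `O_C`. -/
noncomputable def monOperad : ColoredOperad.{v} C where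
  ops c t := Word c t
  map := Word.map
  comp := Word.comp
  one := Word.one
  map_refl o := Word.map_refl _ o
  map_map σ h σ' h' o := Word.map_map σ h σ' h' o
  map_blockPerm σ o q := Word.map_blockPerm σ _ o q _
  map_blockSum τ o q := Word.map_blockSum τ _ o q _
  comp_assoc o q r := Word.comp_assoc _ o q r _
  comp_one o := Word.comp_one _ o _
  one_comp o := Word.one_comp _ o _

namespace Word

variable (R : OrthogonalityRelation C)

/-- One transposition of an adjacent orthogonal pair: `y` arises from `x = (σ, f)` by replacing
`σ` by `τσ`, where `τ` transposes two adjacent places `p` and `q = p + 1` at which the sequence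
`fσ⁻¹` has orthogonal entries. -/
def Step {n : ℕ} {c : Fin n → C} {t : C} (x y : Word c t) : Prop :=
  x.2 = y.2 ∧ ∃ p q : Fin n, q.val = p.val + 1 ∧
    R.perp (x.2 (x.1.symm p)) (x.2 (x.1.symm q)) ∧ y.1 = Equiv.swap p q * x.1

/-- The relation `∼_⊥`: the families of morphisms agree and the permutations are related by a
finite sequence of transpositions of adjacent orthogonal pairs. -/
def Rel {n : ℕ} {c : Fin n → C} {t : C} : Word c t → Word c t → Prop :=
  Relation.ReflTransGen (Step R)

variable {R}

theorem Step.symm {n : ℕ} {c : Fin n → C} {t : C} {x y : Word c t} (h : Step R x y) :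
    Step R y x := by
  obtain ⟨x1, x2⟩ := x
  obtain ⟨y1, y2⟩ := y
  obtain ⟨h1, p, q, hpq, hp, h2⟩ := h
  simp only at h1 h2 hp
  subst h1 h2
  refine ⟨rfl, p, q, hpq, ?_, ?_⟩
  · have e1 : (Equiv.swap p q * x1).symm p = x1.symm q := by
      rw [Equiv.symm_apply_eq]; simp
    have e2 : (Equiv.swap p q * x1).symm q = x1.symm p := by
      rw [Equiv.symm_apply_eq]; simp
    change R.perp (x2 ((Equiv.swap p q * x1).symm p)) (x2 ((Equiv.swap p q * x1).symm q))
    rw [e1, e2]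
    exact R.symm hp
  · simp

theorem swap_lt {n : ℕ} {p q a b : Fin n} (hpq : q.val = p.val + 1)
    (h : ¬ (a = p ∧ b = q)) (hab : a < b) : Equiv.swap p q a < Equiv.swap p q b := by
  simp only [Equiv.swap_apply_def, Fin.lt_def, Fin.ext_iff] at *
  split_ifs <;> omega

/-- Two words with the same morphisms are related if and only if all pairs whose relative order
differs are orthogonal. -/
theorem rel_iff {n : ℕ} {c : Fin n → C} {t : C} (x y : Word c t) :
    Rel R x y ↔ x.2 = y.2 ∧ ∀ i j, x.1 i < x.1 j → y.1 j < y.1 i → R.perp (x.2 i) (x.2 j) := by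
  constructor
  · intro h
    induction h with
    | refl => exact ⟨rfl, fun i j h h' => absurd h' h.asymm⟩
    | @tail y z _ hyz ih =>
      obtain ⟨ih1, ih2⟩ := ih
      obtain ⟨h1, p, q, hpq, hp, h2⟩ := hyz
      refine ⟨ih1.trans h1, fun i j hij hji => ?_⟩
      rcases lt_trichotomy (y.1 i) (y.1 j) with h | h | h
      · by_cases hh : y.1 i = p ∧ y.1 j = q
        · rw [← hh.1, ← hh.2] at hp
          rw [Equiv.symm_apply_apply, Equiv.symm_apply_apply] at hp
          rw [ih1]
          exact hp
        · have := swap_lt hpq hh h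
          rw [h2] at hji
          exact absurd hji this.asymm
      · rw [y.1.injective h] at hij
        exact absurd hij (lt_irrefl _)
      · exact ih2 i j hij h
  · rintro ⟨h1, h2⟩
    generalize hN : (Finset.univ.filter fun z : Fin n × Fin n =>
      x.1 z.1 < x.1 z.2 ∧ y.1 z.2 < y.1 z.1).card = N
    induction N using Nat.strong_induction_on generalizing x with
    | _ N ih =>
      by_cases hm : ∃ p q : Fin n, q.val = p.val + 1 ∧ y.1 (x.1.symm q) < y.1 (x.1.symm p)
      · obtain ⟨p, q, hpq, hlt⟩ := hm
        have hpq' : p < q := Fin.lt_def.2 (by omega)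
        have hp : R.perp (x.2 (x.1.symm p)) (x.2 (x.1.symm q)) :=
          h2 _ _ (by simpa using hpq') hlt
        let x' : Word c t := (Equiv.swap p q * x.1, x.2)
        have hs : Step R x x' := ⟨rfl, p, q, hpq, hp, rfl⟩
        have hlt' : ∀ i j, x'.1 i < x'.1 j → y.1 j < y.1 i → x.1 i < x.1 j := by
          intro i j hij hji
          by_contra hcon
          rcases (not_lt.1 hcon).lt_or_eq with h | h
          · by_cases hh : x.1 j = p ∧ x.1 i = q
            · rw [← hh.1, ← hh.2] at hlt
              simp only [Equiv.symm_apply_apply] at hlt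
              exact absurd hji hlt.asymm
            · exact absurd hij (swap_lt hpq hh h).asymm
          · rw [x.1.injective h] at hji
            exact absurd hji (lt_irrefl _)
        refine Relation.ReflTransGen.head hs (ih _ ?_ x' h1
          (fun i j hij hji => h2 i j (hlt' i j hij hji) hji) rfl)
        rw [← hN]
        refine Finset.card_lt_card ⟨fun z hz => ?_, fun hsub => ?_⟩
        · simp only [Finset.mem_filter, Finset.mem_univ, true_and] at hz ⊢
          exact ⟨hlt' _ _ hz.1 hz.2, hz.2⟩
        · have := @hsub (x.1.symm p, x.1.symm q) (by simpa using ⟨hpq', hlt⟩)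
          rw [Finset.mem_filter] at this
          have := this.2.1
          simp [x'] at this
          exact hpq'.asymm this
      · push Not at hm
        have he : x.1 = y.1 := by
          have hmono : Monotone (fun p => y.1 (x.1.symm p)) := by
            cases n with
            | zero => intro a; exact a.elim0
            | succ n => exact Fin.monotone_iff_le_succ.2 fun i => hm _ _ (by simp)
          refine equiv_ext_of_lt _ _ fun i j hij => ?_
          have := hmono hij.le
          simp only [Equiv.symm_apply_apply] at this
          refine lt_of_le_of_ne this fun h => ?_
          rw [y.1.injective h] at hij
          exact lt_irrefl _ hij
        have : x = y := Prod.ext he h1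
        subst this
        exact Relation.ReflTransGen.refl

variable (R)

theorem rel_symm {n : ℕ} {c : Fin n → C} {t : C} {x y : Word c t} (h : Rel R x y) :
    Rel R y x := by
  induction h with
  | refl => exact Relation.ReflTransGen.refl
  | tail _ h ih => exact Relation.ReflTransGen.head h.symm ih

/-- The equivalence relation `∼_⊥` on `O_C(c; t)`. -/
def setoid {n : ℕ} (c : Fin n → C) (t : C) : Setoid (Word c t) where
  r := Rel R
  iseqv := ⟨fun _ => Relation.ReflTransGen.refl,
    fun h => rel_symm R h,
    fun h h' => Relation.ReflTransGen.trans h h'⟩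

variable {R}

theorem Rel.map {n n' : ℕ} {c : Fin n → C} {c' : Fin n' → C} {t : C} (σ' : Fin n' ≃ Fin n)
    (h : ∀ i, c' i = c (σ' i)) {x y : Word c t} (hxy : Rel R x y) :
    Rel R (Word.map σ' h x) (Word.map σ' h y) := by
  rw [rel_iff] at hxy ⊢
  refine ⟨funext fun p => by rw [map_hom, map_hom, hxy.1], fun i j hij hji => ?_⟩
  rw [map_lt] at hij hji
  exact R.precomp _ _ (hxy.2 _ _ hij hji)

theorem Rel.comp {m : ℕ} {k : Fin m → ℕ} {a : Fin m → C} {c : Fin (total m k) → C} {t : C}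
    {x x' : Word a t} (hx : Rel R x x') {y y' : ∀ i, Word (fun j => c (inBlock k i j)) (a i)}
    (hy : ∀ i, Rel R (y i) (y' i)) : Rel R (Word.comp x y) (Word.comp x' y') := by
  simp only [rel_iff] at hx hy ⊢
  refine ⟨funext fun p => ?_, fun p p' hij hji => ?_⟩
  · obtain ⟨i, j, rfl⟩ := inBlock_surj _ p
    rw [comp_hom, comp_hom, hx.1, (hy i).1]
  · obtain ⟨i, j, rfl⟩ := inBlock_surj _ p
    obtain ⟨i', j', rfl⟩ := inBlock_surj _ p'
    rw [comp_lt] at hij hji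
    rw [comp_hom, comp_hom]
    by_cases hi : i = i'
    · subst hi
      have h1 : (y i).1 j < (y i).1 j' := by simpa using hij
      have h2 : (y' i).1 j' < (y' i).1 j := by simpa using hji
      exact R.postcomp _ ((hy i).2 _ _ h1 h2)
    · have h1 : x.1 i < x.1 i' := by simpa [hi] using hij
      have h2 : x'.1 i' < x'.1 i := by simpa [Ne.symm hi] using hji
      exact R.precomp _ _ (hx.2 _ _ h1 h2)

end Word

variable (R : OrthogonalityRelation C)

/-- The set `O_C̄(c; t) = O_C(c; t) / ∼_⊥`. -/
abbrev OrthWord {n : ℕ} (c : Fin n → C) (t : C) : Type v := Quotient (Word.setoid R c t)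

namespace OrthWord

variable {R}

/-- The class of a word. -/
abbrev mk {n : ℕ} {c : Fin n → C} {t : C} (x : Word c t) : OrthWord R c t :=
  Quotient.mk (Word.setoid R c t) x

/-- The action of permutations, induced on the quotient. -/
def map {n n' : ℕ} {c : Fin n → C} {c' : Fin n' → C} {t : C} (σ' : Fin n' ≃ Fin n)
    (h : ∀ i, c' i = c (σ' i)) : OrthWord R c t → OrthWord R c' t :=
  Quotient.map (Word.map σ' h) fun _ _ hxy => Word.Rel.map σ' h hxy

theorem map_mk {n n' : ℕ} {c : Fin n → C} {c' : Fin n' → C} {t : C} (σ' : Fin n' ≃ Fin n)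
    (h : ∀ i, c' i = c (σ' i)) (x : Word c t) :
    map (R := R) σ' h (mk x) = mk (Word.map σ' h x) := rfl

/-- The composition, induced on the quotient: it is computed on representatives, and by `comp_mk`
it does not depend on their choice. -/
noncomputable def comp {m : ℕ} {k : Fin m → ℕ} {a : Fin m → C} {c : Fin (total m k) → C} {t : C}
    (x : OrthWord R a t) (y : ∀ i, OrthWord R (fun j => c (inBlock k i j)) (a i)) :
    OrthWord R c t :=
  mk (Word.comp x.out fun i => (y i).out)

theorem comp_mk {m : ℕ} {k : Fin m → ℕ} {a : Fin m → C} {c : Fin (total m k) → C} {t : C}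
    (x : Word a t) (y : ∀ i, Word (fun j => c (inBlock k i j)) (a i)) :
    comp (R := R) (c := c) (mk x) (fun i => mk (y i)) = mk (Word.comp x y) :=
  Quotient.sound (Word.Rel.comp (Quotient.mk_out (s := Word.setoid R _ _) x)
    fun i => Quotient.mk_out (s := Word.setoid R _ _) (y i))

theorem exists_rep {m : ℕ} {k : Fin m → ℕ} {a : Fin m → C} {c : Fin (total m k) → C}
    (y : ∀ i, OrthWord R (fun j => c (inBlock k i j)) (a i)) :
    ∃ z : ∀ i, Word (fun j => c (inBlock k i j)) (a i), (fun i => mk (z i)) = y :=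
  ⟨fun i => (y i).out, funext fun _ => Quotient.out_eq _⟩

end OrthWord

/-- The operad `O_C̄` of an orthogonal category `C̄ = (C, ⊥)`. -/
noncomputable def orthOperad : ColoredOperad.{v} C where
  ops c t := OrthWord R c t
  map := OrthWord.map
  comp := OrthWord.comp
  one t := OrthWord.mk (Word.one t)
  map_refl o := by
    obtain ⟨o, rfl⟩ := Quotient.exists_rep o
    rw [OrthWord.map_mk, Word.map_refl]
  map_map σ h σ' h' o := by
    obtain ⟨o, rfl⟩ := Quotient.exists_rep o
    rw [OrthWord.map_mk, OrthWord.map_mk, Word.map_map]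
    rfl
  map_blockPerm σ o q := by
    obtain ⟨o, rfl⟩ := Quotient.exists_rep o
    obtain ⟨q, rfl⟩ := OrthWord.exists_rep q
    simp only [OrthWord.comp_mk, OrthWord.map_mk]
    rw [Word.map_blockPerm]
  map_blockSum τ o q := by
    obtain ⟨o, rfl⟩ := Quotient.exists_rep o
    obtain ⟨q, rfl⟩ := OrthWord.exists_rep q
    simp only [OrthWord.comp_mk, OrthWord.map_mk]
    rw [Word.map_blockSum]
  comp_assoc o q r := by
    obtain ⟨o, rfl⟩ := Quotient.exists_rep o
    obtain ⟨q, rfl⟩ := OrthWord.exists_rep q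
    obtain ⟨r, rfl⟩ := OrthWord.exists_rep r
    simp only [OrthWord.comp_mk, OrthWord.map_mk]
    rw [Word.comp_assoc]
  comp_one o := by
    obtain ⟨o, rfl⟩ := Quotient.exists_rep o
    simp only [OrthWord.comp_mk, OrthWord.map_mk]
    rw [Word.comp_one]
  one_comp o := by
    obtain ⟨o, rfl⟩ := Quotient.exists_rep o
    simp only [OrthWord.comp_mk, OrthWord.map_mk]
    rw [Word.one_comp]

/-- The projection `p_C̄ : O_C ⟶ O_C̄`. -/
noncomputable def projHom : OperadHom (monOperad C) (orthOperad R) where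
  f c := c
  φ x := OrthWord.mk x
  φ_map _ _ _ := rfl
  φ_comp o q := (OrthWord.comp_mk o q).symm
  φ_one _ := rfl

section Functoriality

variable {D : Type v} [SmallCategory D] {R} {S : OrthogonalityRelation D} (F : C ⥤ D)

/-- The map `(σ, f) ↦ (σ, F(f))`. -/
def Word.mapFunctor {n : ℕ} {c : Fin n → C} {t : C} (x : Word c t) :
    Word (fun i => F.obj (c i)) (F.obj t) :=
  ⟨x.1, fun i => F.map (x.2 i)⟩

variable (R S) in
/-- A functor is orthogonal if it preserves the orthogonality relations. -/
def IsOrthogonalFunctor : Prop :=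
  ∀ {c₁ c₂ c : C} (f₁ : c₁ ⟶ c) (f₂ : c₂ ⟶ c), R.perp f₁ f₂ → S.perp (F.map f₁) (F.map f₂)

theorem Word.Rel.mapFunctor (hF : IsOrthogonalFunctor R S F) {n : ℕ} {c : Fin n → C} {t : C}
    {x y : Word c t} (h : Word.Rel R x y) : Word.Rel S (x.mapFunctor F) (y.mapFunctor F) := by
  rw [Word.rel_iff] at h ⊢
  refine ⟨funext fun i => ?_, fun i j hij hji => hF _ _ (h.2 i j hij hji)⟩
  simp only [Word.mapFunctor, h.1]

/-- The morphism of operads `O_F : O_C̄ ⟶ O_D̄` of an orthogonal functor `F`. -/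
noncomputable def orthOperadHom (hF : IsOrthogonalFunctor R S F) :
    OperadHom (orthOperad R) (orthOperad S) where
  f c := F.obj c
  φ := Quotient.map (Word.mapFunctor F) fun _ _ h => Word.Rel.mapFunctor F hF h
  φ_map σ h o := by
    obtain ⟨o, rfl⟩ := Quotient.exists_rep o
    refine congrArg (OrthWord.mk (R := S)) (Prod.ext rfl (funext fun i => ?_))
    simp [Word.mapFunctor, Word.map, eqToHom_map]
  φ_comp {m k a c t} o q := by
    obtain ⟨o, rfl⟩ := Quotient.exists_rep o
    obtain ⟨q, rfl⟩ := OrthWord.exists_rep q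
    refine (congrArg (Quotient.map _ _) (OrthWord.comp_mk o q)).trans
      (Eq.trans ?_ (OrthWord.comp_mk (c := fun p => F.obj (c p))
        (o.mapFunctor F) (fun i => (q i).mapFunctor F)).symm)
    refine congrArg (OrthWord.mk (R := S)) (Prod.ext rfl (funext fun p => ?_))
    obtain ⟨i, j, rfl⟩ := inBlock_surj _ p
    rw [Word.comp_hom]
    simp only [Word.mapFunctor]
    rw [Word.comp_hom, F.map_comp]
  φ_one t := by
    refine congrArg (OrthWord.mk (R := S)) (Prod.ext rfl (funext fun p => ?_))
    exact F.map_id t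

end Functoriality


section Underlying

variable {M : Type u} [Category.{v} M] [MonoidalCategory M] [BraidedCategory M] [HasColimits M]

namespace Algebra

variable (A : Algebra (monOperad C) M)

/-- The operation given by the element `(e, f)` of `O_C(c; t)`, that is
`a₁ ⊗ ⋯ ⊗ aₙ ↦ A(f₁)(a₁) ⋯ A(fₙ)(aₙ)`. -/
noncomputable def prodOp {n : ℕ} {c : Fin n → C} {t : C} (f : ∀ i, c i ⟶ t) :
    tpow n (fun i => A.obj (c i)) ⟶ A.obj t :=
  A.op (O := monOperad C) (c := c) (t := t) ((1, f) : Word c t)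

theorem prodOp_comp {m : ℕ} (k : Fin m → ℕ) {a : Fin m → C} {c : Fin (total m k) → C} {t : C}
    (f : ∀ i, a i ⟶ t) (g : ∀ i j, c (inBlock k i j) ⟶ a i) (h : ∀ p, c p ⟶ t)
    (hh : ∀ i j, h (inBlock k i j) = g i j ≫ f i) :
    A.prodOp h = (tblocks k fun p => A.obj (c p)).hom ≫
      tmap (fun i => A.prodOp (g i)) ≫ A.prodOp f := by
  have e : ((1, h) : Word c t) =
      Word.comp ((1, f) : Word a t) (fun i => ((1, g i) : Word _ (a i))) := by
    refine Word.ext_of_lt (fun p p' => ?_) (fun p => ?_)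
    · obtain ⟨i, j, rfl⟩ := inBlock_surj _ p
      obtain ⟨i', j', rfl⟩ := inBlock_surj _ p'
      rw [Word.comp_lt]
      exact inBlock_lt_iff k i i' j j'
    · obtain ⟨i, j, rfl⟩ := inBlock_surj _ p
      rw [Word.comp_hom]
      exact hh i j
  have := A.associativity (c := c) (t := t) ((1, f) : Word a t)
    (fun i => ((1, g i) : Word _ (a i)))
  refine Eq.trans ?_ this
  exact congrArg (A.op (O := monOperad C) (c := c) (t := t)) e

theorem prodOp_id (t : C) :
    A.prodOp (c := fun _ : Fin 1 => t) (fun _ => 𝟙 t) = (ρ_ (A.obj t)).hom :=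
  A.unitality t

/-- The operation `A(c) ⊗ I ⟶ A(t)` given by the element `(e, f)` for `f : c ⟶ t`. -/
noncomputable def unOp {c t : C} (f : c ⟶ t) : A.obj c ⊗ 𝟙_ M ⟶ A.obj t :=
  A.prodOp (c := fun _ : Fin 1 => c) (fun _ => f)

/-- The operation `A(c) ⊗ (A(c) ⊗ I) ⟶ A(t)` given by the element `(e, (f, f))` for
`f : c ⟶ t`. -/
noncomputable def binOp {c t : C} (f : c ⟶ t) : A.obj c ⊗ (A.obj c ⊗ 𝟙_ M) ⟶ A.obj t :=
  A.prodOp (c := fun _ : Fin 2 => c) (fun _ => f)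

/-- The multiplication `A(t) ⊗ A(t) ⟶ A(t)`, given by the element `(e, (id, id))`. -/
noncomputable def mulOp (t : C) : A.obj t ⊗ A.obj t ⟶ A.obj t :=
  (A.obj t ◁ (ρ_ (A.obj t)).inv) ≫ A.binOp (𝟙 t)

/-- The unit `I ⟶ A(t)`, given by the only element of `O_C(∅; t)`. -/
noncomputable def oneOp (t : C) : 𝟙_ M ⟶ A.obj t :=
  A.prodOp (c := fun _ : Fin 0 => t) (fun _ => 𝟙 t)

/-- The morphism `A(f) : A(c) ⟶ A(t)`, given by the element `(e, f)`. -/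
noncomputable def mapOp {c t : C} (f : c ⟶ t) : A.obj c ⟶ A.obj t :=
  (ρ_ (A.obj c)).inv ≫ A.unOp f

theorem unOp_id (t : C) : A.unOp (𝟙 t) = (ρ_ (A.obj t)).hom := A.prodOp_id t

theorem prodOp_elim0 {c : Fin 0 → C} {t : C} (f : ∀ i, c i ⟶ t) : A.prodOp f = A.oneOp t := by
  obtain rfl : c = fun _ => t := funext fun i => i.elim0
  exact congrArg A.prodOp (funext fun i => i.elim0)

theorem one_mulOp (t : C) : A.oneOp t ▷ A.obj t ≫ A.mulOp t = (λ_ (A.obj t)).hom := by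
  have h : A.unOp (𝟙 t) =
      ((λ_ (A.obj t ⊗ 𝟙_ M)).inv ≫ 𝟙_ M ◁ ((A.obj t ◁ (λ_ (𝟙_ M)).inv ≫
        (α_ (A.obj t) (𝟙_ M) (𝟙_ M)).inv) ≫ (A.obj t ⊗ 𝟙_ M) ◁ 𝟙 (𝟙_ M))) ≫
      (A.oneOp t ⊗ₘ (A.unOp (𝟙 t) ⊗ₘ 𝟙 (𝟙_ M))) ≫
        A.binOp (𝟙 t) :=
    A.prodOp_comp (@Fin.cases 1 (fun _ => ℕ) 0 (fun _ => 1)) (a := fun _ => t) (c := fun _ => t)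
      (fun _ => 𝟙 t) (fun _ _ => 𝟙 t) (fun _ => 𝟙 t) (fun _ _ => (Category.id_comp _).symm)
  rw [unOp_id] at h
  have e : A.oneOp t ▷ A.obj t ≫ A.mulOp t = (λ_ (A.obj t)).hom ≫ (ρ_ (A.obj t)).inv ≫
      (((λ_ (A.obj t ⊗ 𝟙_ M)).inv ≫ 𝟙_ M ◁ ((A.obj t ◁ (λ_ (𝟙_ M)).inv ≫
        (α_ (A.obj t) (𝟙_ M) (𝟙_ M)).inv) ≫ (A.obj t ⊗ 𝟙_ M) ◁ 𝟙 (𝟙_ M))) ≫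
      (A.oneOp t ⊗ₘ ((ρ_ (A.obj t)).hom ⊗ₘ 𝟙 (𝟙_ M))) ≫
        A.binOp (𝟙 t)) := by
    rw [mulOp]
    monoidal
  rw [e, ← h]
  simp

theorem mul_oneOp (t : C) : A.obj t ◁ A.oneOp t ≫ A.mulOp t = (ρ_ (A.obj t)).hom := by
  have h : A.unOp (𝟙 t) =
      ((A.obj t ◁ (λ_ (𝟙_ M)).inv ≫ (α_ (A.obj t) (𝟙_ M) (𝟙_ M)).inv) ≫
        (A.obj t ⊗ 𝟙_ M) ◁ ((λ_ (𝟙_ M)).inv ≫ 𝟙_ M ◁ 𝟙 (𝟙_ M))) ≫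
      (A.unOp (𝟙 t) ⊗ₘ (A.oneOp t ⊗ₘ 𝟙 (𝟙_ M))) ≫
        A.binOp (𝟙 t) :=
    A.prodOp_comp (@Fin.cases 1 (fun _ => ℕ) 1 (fun _ => 0)) (a := fun _ => t) (c := fun _ => t)
      (fun _ => 𝟙 t) (fun _ _ => 𝟙 t) (fun _ => 𝟙 t) (fun _ _ => (Category.id_comp _).symm)
  rw [unOp_id] at h
  have e : A.obj t ◁ A.oneOp t ≫ A.mulOp t =
      (((A.obj t ◁ (λ_ (𝟙_ M)).inv ≫ (α_ (A.obj t) (𝟙_ M) (𝟙_ M)).inv) ≫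
        (A.obj t ⊗ 𝟙_ M) ◁ ((λ_ (𝟙_ M)).inv ≫ 𝟙_ M ◁ 𝟙 (𝟙_ M))) ≫
      ((ρ_ (A.obj t)).hom ⊗ₘ (A.oneOp t ⊗ₘ 𝟙 (𝟙_ M))) ≫
        A.binOp (𝟙 t)) := by
    rw [mulOp]
    monoidal
  rw [e, ← h]

theorem mulOp_assoc (t : C) : A.mulOp t ▷ A.obj t ≫ A.mulOp t =
    (α_ (A.obj t) (A.obj t) (A.obj t)).hom ≫ A.obj t ◁ A.mulOp t ≫ A.mulOp t := by
  have h : A.prodOp (c := fun _ : Fin 3 => t) (fun _ => 𝟙 t) =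
      ((A.obj t ◁ (A.obj t ◁ (λ_ (A.obj t ⊗ 𝟙_ M)).inv ≫
          (α_ (A.obj t) (𝟙_ M) (A.obj t ⊗ 𝟙_ M)).inv) ≫
          (α_ (A.obj t) (A.obj t ⊗ 𝟙_ M) (A.obj t ⊗ 𝟙_ M)).inv) ≫
        (A.obj t ⊗ (A.obj t ⊗ 𝟙_ M)) ◁ ((A.obj t ◁ (λ_ (𝟙_ M)).inv ≫
          (α_ (A.obj t) (𝟙_ M) (𝟙_ M)).inv) ≫ (A.obj t ⊗ 𝟙_ M) ◁ 𝟙 (𝟙_ M))) ≫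
      (A.binOp (𝟙 t) ⊗ₘ
        (A.unOp (𝟙 t) ⊗ₘ 𝟙 (𝟙_ M))) ≫
        A.binOp (𝟙 t) :=
    A.prodOp_comp (@Fin.cases 1 (fun _ => ℕ) 2 (fun _ => 1)) (a := fun _ => t) (c := fun _ => t)
      (fun _ => 𝟙 t) (fun _ _ => 𝟙 t) (fun _ => 𝟙 t) (fun _ _ => (Category.id_comp _).symm)
  have h' : A.prodOp (c := fun _ : Fin 3 => t) (fun _ => 𝟙 t) =
      ((A.obj t ◁ (λ_ (A.obj t ⊗ (A.obj t ⊗ 𝟙_ M))).inv ≫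
          (α_ (A.obj t) (𝟙_ M) (A.obj t ⊗ (A.obj t ⊗ 𝟙_ M))).inv) ≫
        (A.obj t ⊗ 𝟙_ M) ◁ ((A.obj t ◁ (A.obj t ◁ (λ_ (𝟙_ M)).inv ≫
          (α_ (A.obj t) (𝟙_ M) (𝟙_ M)).inv) ≫ (α_ (A.obj t) (A.obj t ⊗ 𝟙_ M) (𝟙_ M)).inv) ≫
          (A.obj t ⊗ (A.obj t ⊗ 𝟙_ M)) ◁ 𝟙 (𝟙_ M))) ≫
      (A.unOp (𝟙 t) ⊗ₘ
        (A.binOp (𝟙 t) ⊗ₘ 𝟙 (𝟙_ M))) ≫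
        A.binOp (𝟙 t) :=
    A.prodOp_comp (@Fin.cases 1 (fun _ => ℕ) 1 (fun _ => 2)) (a := fun _ => t) (c := fun _ => t)
      (fun _ => 𝟙 t) (fun _ _ => 𝟙 t) (fun _ => 𝟙 t) (fun _ _ => (Category.id_comp _).symm)
  rw [h, unOp_id] at h'
  simp only [mulOp]
  have h2 := congrArg (fun z => (α_ (A.obj t) (A.obj t) (A.obj t)).hom ≫
    (A.obj t ◁ (A.obj t ◁ (ρ_ (A.obj t)).inv)) ≫ z) h'
  refine Eq.trans (Eq.trans ?_ h2) ?_ <;> monoidal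

theorem mapOp_id (t : C) : A.mapOp (𝟙 t) = 𝟙 (A.obj t) := by
  rw [mapOp, unOp_id, Iso.inv_hom_id]

theorem mapOp_comp {b c t : C} (f : b ⟶ c) (g : c ⟶ t) :
    A.mapOp (f ≫ g) = A.mapOp f ≫ A.mapOp g := by
  have h : A.unOp (f ≫ g) =
      ((A.obj b ◁ (λ_ (𝟙_ M)).inv ≫ (α_ (A.obj b) (𝟙_ M) (𝟙_ M)).inv) ≫
        (A.obj b ⊗ 𝟙_ M) ◁ 𝟙 (𝟙_ M)) ≫
      (A.unOp f ⊗ₘ 𝟙 (𝟙_ M)) ≫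
        A.unOp g :=
    A.prodOp_comp (fun _ : Fin 1 => 1) (a := fun _ => c) (c := fun _ => b)
      (fun _ => g) (fun _ _ => f) (fun _ => f ≫ g) (fun _ _ => rfl)
  simp only [mapOp]
  rw [h]
  monoidal

theorem one_mapOp {c t : C} (f : c ⟶ t) : A.oneOp c ≫ A.mapOp f = A.oneOp t := by
  have h : A.prodOp (c := fun _ : Fin 0 => c) (fun _ => f) =
      ((λ_ (𝟙_ M)).inv ≫ 𝟙_ M ◁ 𝟙 (𝟙_ M)) ≫ (A.oneOp c ⊗ₘ 𝟙 (𝟙_ M)) ≫ A.unOp f :=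
    A.prodOp_comp (fun _ : Fin 1 => 0) (a := fun _ => c) (c := fun _ => c)
      (fun _ => f) (fun _ _ => 𝟙 c) (fun _ => f) (fun _ j => j.elim0)
  rw [mapOp, ← A.prodOp_elim0 (fun _ => f), h]
  monoidal

theorem mul_mapOp {c t : C} (f : c ⟶ t) :
    A.mulOp c ≫ A.mapOp f = (A.mapOp f ⊗ₘ A.mapOp f) ≫ A.mulOp t := by
  have h : A.binOp f =
      ((A.obj c ◁ (A.obj c ◁ (λ_ (𝟙_ M)).inv ≫
          (α_ (A.obj c) (𝟙_ M) (𝟙_ M)).inv) ≫ (α_ (A.obj c) (A.obj c ⊗ 𝟙_ M) (𝟙_ M)).inv) ≫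
          (A.obj c ⊗ (A.obj c ⊗ 𝟙_ M)) ◁ 𝟙 (𝟙_ M)) ≫
      (A.binOp (𝟙 c) ⊗ₘ 𝟙 (𝟙_ M)) ≫
        A.unOp f :=
    A.prodOp_comp (fun _ : Fin 1 => 2) (a := fun _ => c) (c := fun _ => c)
      (fun _ => f) (fun _ _ => 𝟙 c) (fun _ => f) (fun _ _ => (Category.id_comp _).symm)
  have h' : A.binOp f =
      ((A.obj c ◁ (λ_ (A.obj c ⊗ 𝟙_ M)).inv ≫
          (α_ (A.obj c) (𝟙_ M) (A.obj c ⊗ 𝟙_ M)).inv) ≫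
        (A.obj c ⊗ 𝟙_ M) ◁ ((A.obj c ◁ (λ_ (𝟙_ M)).inv ≫
          (α_ (A.obj c) (𝟙_ M) (𝟙_ M)).inv) ≫ (A.obj c ⊗ 𝟙_ M) ◁ 𝟙 (𝟙_ M))) ≫
      (A.unOp f ⊗ₘ
        (A.unOp f ⊗ₘ 𝟙 (𝟙_ M))) ≫
        A.binOp (𝟙 t) :=
    A.prodOp_comp (@Fin.cases 1 (fun _ => ℕ) 1 (fun _ => 1)) (a := fun _ => t) (c := fun _ => c)
      (fun _ => 𝟙 t) (fun _ _ => f) (fun _ => f) (fun _ _ => (Category.comp_id _).symm)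
  rw [h] at h'
  simp only [mulOp, mapOp]
  have h2 := congrArg (fun z => (A.obj c ◁ (ρ_ (A.obj c)).inv) ≫ z) h'
  refine Eq.trans (Eq.trans ?_ h2) ?_ <;> monoidal

variable {A} {B : Algebra (monOperad C) M} (φ : A ⟶ B)

theorem oneOp_hom (t : C) : A.oneOp t ≫ Hom.hom φ t = B.oneOp t :=
  (Hom.op_comm φ _).trans (Category.id_comp _)

theorem mulOp_hom (t : C) :
    A.mulOp t ≫ Hom.hom φ t = (Hom.hom φ t ⊗ₘ Hom.hom φ t) ≫ B.mulOp t := by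
  have h : A.binOp (𝟙 t) ≫ Hom.hom φ t =
      (Hom.hom φ t ⊗ₘ (Hom.hom φ t ⊗ₘ 𝟙 (𝟙_ M))) ≫
        B.binOp (𝟙 t) := Hom.op_comm φ _
  rw [mulOp, mulOp, Category.assoc, h]
  monoidal

theorem mapOp_hom {c t : C} (f : c ⟶ t) :
    A.mapOp f ≫ Hom.hom φ t = Hom.hom φ c ≫ B.mapOp f := by
  have h : A.unOp f ≫ Hom.hom φ t =
      (Hom.hom φ c ⊗ₘ 𝟙 (𝟙_ M)) ≫ B.unOp f :=
    Hom.op_comm φ _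
  rw [mapOp, mapOp, Category.assoc, h]
  monoidal

end Algebra

/-- The monoid `(A(t), mulOp, oneOp)`. -/
noncomputable def Algebra.toMon (A : Algebra (monOperad C) M) (t : C) : Mon M :=
  { X := A.obj t
    mon :=
      { one := A.oneOp t
        mul := A.mulOp t
        one_mul := A.one_mulOp t
        mul_one := A.mul_oneOp t
        mul_assoc := A.mulOp_assoc t } }

/-- The functor `C ⥤ Mon_M`, `t ↦ A(t)`, `f ↦ A(f)`. -/
noncomputable def Algebra.toFunctor (A : Algebra (monOperad C) M) : C ⥤ Mon M where
  obj t := A.toMon t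
  map {c t} f := Mon.Hom.mk' (M := A.toMon c) (N := A.toMon t) (A.mapOp f) (A.one_mapOp f)
    (A.mul_mapOp f)
  map_id t := Mon.Hom.ext (A.mapOp_id t)
  map_comp f g := Mon.Hom.ext (A.mapOp_comp f g)

variable (C M) in
/-- The functor `Alg(O_C) ⥤ Mon_M^C` that assigns to an algebra over `O_C` its underlying
monoid-valued functor. -/
noncomputable def underlying : Algebra (monOperad C) M ⥤ (C ⥤ Mon M) where
  obj A := A.toFunctor
  map {A B} φ :=
    { app := fun t => Mon.Hom.mk' (M := A.toMon t) (N := B.toMon t) (Algebra.Hom.hom φ t)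
        (Algebra.oneOp_hom φ t) (Algebra.mulOp_hom φ t)
      naturality := fun _ _ f => Mon.Hom.ext (Algebra.mapOp_hom φ f) }
  map_id _ := rfl
  map_comp _ _ := rfl

/-- The functor `p_C̄^* : Alg(O_C̄) ⥤ Mon_M^C`, pullback along the projection
`p_C̄ : O_C ⟶ O_C̄` followed by the identification of `Alg(O_C)` with `Mon_M^C`. -/
noncomputable def projPullback (R : OrthogonalityRelation C) (M : Type u) [Category.{v} M]
    [MonoidalCategory M] [BraidedCategory M] [HasColimits M] :
    Algebra (orthOperad R) M ⥤ (C ⥤ Mon M) :=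
  Algebra.pullback M (projHom R) ⋙ underlying C M

end Underlying

end QFT

end QFTOperad

/-! `projPullback R M` identifies the algebras over `orthOperad R` with the functors `B : C ⥤ Mon M`
that are `IsPerpCommutative`: orthogonal morphisms into `t` have commuting images in `B t`. In an
algebra the operation of a word `(σ, f)` has no freedom. Equivariance removes `σ`, and associativity
splits what remains into binary products, so the operation is `wordOp`, the product of the elements
`B(fᵢ)(aᵢ)` in the order given by `σ⁻¹` (`prodOp_eq_seqProd`, `op_mk_eq_wordOp`). Hence a natural
transformation of monoid-valued functors respects all operations, which is fullness. Two words that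
differ by an orthogonal transposition are equal in the quotient operad, which is commutativity.
Conversely, `wordOp` turns a commutative functor into an algebra (`Algebra.ofFunctor`).

The work in the converse is symmetric monoidal coherence. Tensor factors are labelled by lists, and
permutations of factors are sequences of adjacent transpositions (`ListPerm`). By
`ListPerm.eval_eq`, if the labels are distinct, the resulting morphism depends only on the two
lists. Composites of permutations are therefore compared by comparing lists. This gives equivariance
(`permProd_perm`) and operadic associativity (`permProd_blocks`).

The reflection imposes the missing commutations objectwise (`exists_perpAbelianization`). As `M` is
closed, tensoring preserves colimits. A quotient of a monoid by relations is thus a coequalizer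
already in `M` (`exists_mon_quotient`), and its projection is an epimorphism there. Stability of
orthogonality under postcomposition makes the quotients functorial. Initial objects in the comma
categories then give the left adjoint, and full faithfulness makes every counit invertible.

`Mon M` is cocomplete, a colimit being a quotient of a free monoid (`hasColimit_mon`), so left Kan
extensions exist. Restricting algebras along `F` and then forgetting is the same as forgetting and
then restricting functors. The composite adjunction for `Lan` and `p` therefore restricts along the
fully faithful `projPullback R M` to an adjunction whose right adjoint is the pullback along
`orthOperadHom F hF` (`extensionAdjunction`). Uniqueness of left adjoints finishes the proof. -/

namespace QFTOperad

/-! ### Tensor products along lists and coherence for sequences of transpositions. -/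

section ListTensor

variable {M : Type u} [Category.{v} M] [MonoidalCategory M] {ι : Type*} (X : ι → M)

/-- The tensor product of the objects `X a` along a list of labels `a`. -/
def listTensor : List ι → M
  | [] => 𝟙_ M
  | a :: L => X a ⊗ listTensor L

/-- A composable sequence of adjacent transpositions of list entries. -/
inductive ListPerm {ι : Type*} : List ι → List ι → Type _
  | refl (L : List ι) : ListPerm L L
  | cons (a : ι) {L L' : List ι} : ListPerm L L' → ListPerm (a :: L) (a :: L')
  | swap (a b : ι) (L : List ι) : ListPerm (a :: b :: L) (b :: a :: L)
  | trans {L L' L'' : List ι} : ListPerm L L' → ListPerm L' L'' → ListPerm L L''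

theorem ListPerm.toPerm {L L' : List ι} (π : ListPerm L L') : L.Perm L' := by
  induction π with
  | refl L => exact List.Perm.refl L
  | cons a _ ih => exact ih.cons a
  | swap a b L => exact List.Perm.swap b a L
  | trans _ _ h h' => exact h.trans h'

/-- `List.Perm` is a proposition and carries no morphism. This supplies a sequence of transpositions
that can be evaluated; which one it is will not matter, by `ListPerm.eval_eq`. -/
theorem ListPerm.nonempty_of_perm {L L' : List ι} (h : L.Perm L') : Nonempty (ListPerm L L') := by
  induction h with
  | nil => exact ⟨.refl _⟩
  | cons a _ ih => exact ⟨.cons a ih.some⟩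
  | swap a b L => exact ⟨.swap b a L⟩
  | trans _ _ h h' => exact ⟨.trans h.some h'.some⟩

/-- The list permutation of an equality. -/
def ListPerm.ofEq {L L' : List ι} (h : L = L') : ListPerm L L' := h ▸ .refl L

/-- The comparison morphism of an equality of lists. -/
def listCast {L L' : List ι} (h : L = L') : listTensor X L ⟶ listTensor X L' :=
  eqToHom (congrArg (listTensor X) h)

@[simp] theorem listCast_rfl {L : List ι} (h : L = L) : listCast X h = 𝟙 _ := rfl

/-- The tensor product of a family of morphisms along a list of labels. -/
def listTensorMap {X Y : ι → M} (f : ∀ a, X a ⟶ Y a) :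
    (L : List ι) → (listTensor X L ⟶ listTensor Y L)
  | [] => 𝟙 (𝟙_ M)
  | a :: L => f a ⊗ₘ listTensorMap f L

/-- The canonical isomorphism for a concatenation of lists. -/
def listAppend : (L L' : List ι) → (listTensor X (L ++ L') ≅ listTensor X L ⊗ listTensor X L')
  | [], L' => (λ_ (listTensor X L')).symm
  | a :: L, L' => whiskerLeftIso (X a) (listAppend L L') ≪≫
      (α_ (X a) (listTensor X L) (listTensor X L')).symm

/-- The canonical isomorphism for a concatenation of a list of lists. -/
def listFlat {κ : Type*} (B : κ → List ι) : (L : List κ) →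
    (listTensor X (L.flatMap B) ≅ listTensor (fun i => listTensor X (B i)) L)
  | [] => Iso.refl _
  | i :: L => listAppend X (B i) (L.flatMap B) ≪≫
      whiskerLeftIso (listTensor X (B i)) (listFlat B L)

variable [SymmetricCategory M]

/-- The interchange of the first two of three tensor factors. -/
def swapHeads (A B T : M) : A ⊗ (B ⊗ T) ⟶ B ⊗ (A ⊗ T) :=
  (α_ A B T).inv ≫ ((β_ A B).hom ▷ T) ≫ (α_ B A T).hom

theorem swapHeads_swapHeads (A B T : M) : swapHeads A B T ≫ swapHeads B A T = 𝟙 _ := by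
  simp only [swapHeads, Category.assoc, Iso.hom_inv_id_assoc]
  rw [← comp_whiskerRight_assoc]
  simp

theorem swapHeads_naturality {A A' B B' T T' : M} (f : A ⟶ A') (g : B ⟶ B') (h : T ⟶ T') :
    (f ⊗ₘ (g ⊗ₘ h)) ≫ swapHeads A' B' T' = swapHeads A B T ≫ (g ⊗ₘ (f ⊗ₘ h)) := by
  simp only [swapHeads, Category.assoc]
  rw [← associator_naturality, associator_inv_naturality_assoc,
    ← tensorHom_id, ← tensorHom_id, tensorHom_comp_tensorHom_assoc,
    tensorHom_comp_tensorHom_assoc]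
  simp

/-- The braid relation for three factors, with a fourth factor `T` carried along unchanged. -/
theorem swapHeads_yang_baxter (A B D T : M) :
    swapHeads A B (D ⊗ T) ≫ B ◁ swapHeads A D T ≫ swapHeads B D (A ⊗ T) =
      A ◁ swapHeads B D T ≫ swapHeads A D (B ⊗ T) ≫ D ◁ swapHeads A B T := by
  have h := BraidedCategory.yang_baxter A B D
  have h2 := congrArg (fun z => A ◁ (α_ B D T).inv ≫ (α_ A (B ⊗ D) T).inv ≫
    z ▷ T ≫ (α_ D (B ⊗ A) T).hom ≫ D ◁ (α_ B A T).hom) h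
  simp only [swapHeads]
  refine Eq.trans (Eq.trans ?_ h2) ?_ <;> monoidal

/-- The inductive step for pulling a factor `B` to the front past one further leading factor `A`. -/
theorem whiskerLeft_swapHeads {A B T T' U : M} (f : T ⟶ U) (p : T ⟶ B ⊗ T') {U' : M}
    (p' : U ⟶ B ⊗ U') (h : T' ⟶ U') (w : f ≫ p' = p ≫ B ◁ h) :
    A ◁ f ≫ A ◁ p' ≫ swapHeads A B U' = (A ◁ p ≫ swapHeads A B T') ≫ B ◁ A ◁ h := by
  have := swapHeads_naturality (𝟙 A) (𝟙 B) h
  simp only [id_tensorHom] at this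
  rw [← whiskerLeft_comp_assoc, w, Category.assoc, ← this, whiskerLeft_comp_assoc]

theorem swapHeads_whiskerLeft_swapHeads {A B D T T' : M} (p : T ⟶ D ⊗ T') :
    swapHeads A B T ≫ B ◁ (A ◁ p ≫ swapHeads A D T') ≫ swapHeads B D (A ⊗ T') =
      (A ◁ (B ◁ p ≫ swapHeads B D T') ≫ swapHeads A D (B ⊗ T')) ≫ D ◁ swapHeads A B T' := by
  have := swapHeads_naturality (𝟙 A) (𝟙 B) p
  simp only [id_tensorHom] at this
  simp only [MonoidalCategory.whiskerLeft_comp, Category.assoc]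
  rw [← reassoc_of% this, swapHeads_yang_baxter]

namespace ListPerm

/-- The morphism that permutes the tensor factors. -/
def eval (X : ι → M) : {L L' : List ι} → ListPerm L L' → (listTensor X L ⟶ listTensor X L')
  | _, _, refl L => 𝟙 (listTensor X L)
  | _, _, cons a π => X a ◁ eval X π
  | _, _, swap a b L => swapHeads (X a) (X b) (listTensor X L)
  | _, _, trans π ρ => eval X π ≫ eval X ρ

theorem eval_naturality {X Y : ι → M} (f : ∀ a, X a ⟶ Y a) {L L' : List ι} (π : ListPerm L L') :
    listTensorMap f L ≫ π.eval Y = π.eval X ≫ listTensorMap f L' := by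
  induction π with
  | refl L => simp [eval]
  | cons a π ih =>
    simp only [eval, listTensorMap]
    rw [← id_tensorHom, ← id_tensorHom]
    refine (tensorHom_comp_tensorHom _ _ _ _).trans
      (Eq.trans ?_ (tensorHom_comp_tensorHom _ _ _ _).symm)
    rw [ih]; simp
  | swap a b L => exact swapHeads_naturality _ _ _
  | trans π ρ ih ih' => simp only [eval]; rw [reassoc_of% ih, ih', Category.assoc]

end ListPerm

/-- Moving a given list entry to the front. -/
def listPull (X : ι → M) (b : ι) (S : List ι) :
    (P : List ι) → (listTensor X (P ++ b :: S) ⟶ X b ⊗ listTensor X (P ++ S))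
  | [] => 𝟙 (X b ⊗ listTensor X S)
  | a :: P => X a ◁ listPull X b S P ≫ swapHeads (X a) (X b) (listTensor X (P ++ S))

/-- The entry `b` of the target is traced back through `π` to its place in the source; the rest of
`π` then permutes the other entries. This peels one entry off a permutation and drives the induction
in `ListPerm.eval_eq`. -/
theorem ListPerm.eval_listPull (X : ι → M) {L L' : List ι} (π : ListPerm L L') :
    ∀ (P' S' : List ι) (b : ι) (e : L' = P' ++ b :: S'),
      ∃ (P S : List ι) (e' : L = P ++ b :: S) (ρ : ListPerm (P ++ S) (P' ++ S')),
        π.eval X ≫ listCast X e ≫ listPull X b S' P' =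
          listCast X e' ≫ listPull X b S P ≫ X b ◁ ρ.eval X := by
  induction π with
  | refl L =>
    rintro P' S' b rfl
    refine ⟨P', S', rfl, .refl _, ?_⟩
    simp [eval]
  | trans π ρ ih ih' =>
    rintro P' S' b rfl
    obtain ⟨P, S, rfl, τ, h⟩ := ih' P' S' b rfl
    obtain ⟨P, S, rfl, τ', h'⟩ := ih P S b rfl
    refine ⟨P, S, rfl, τ'.trans τ, ?_⟩
    simp only [listCast_rfl, Category.id_comp, eval, Category.assoc] at h h' ⊢
    rw [h, reassoc_of% h']
    simp
  | cons a π ih =>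
    rintro (_ | ⟨a', P'⟩) S' b e
    · obtain ⟨rfl, rfl⟩ := List.cons.inj e
      refine ⟨[], _, rfl, π, ?_⟩
      have : ∀ {A B : M} (f : A ⟶ B), f ≫ 𝟙 B ≫ 𝟙 B = 𝟙 A ≫ 𝟙 A ≫ f := by simp
      exact this _
    · obtain ⟨rfl, rfl⟩ := List.cons.inj e
      obtain ⟨P, S, rfl, τ, h⟩ := ih P' S' b rfl
      refine ⟨a :: P, S, rfl, τ.cons a, ?_⟩
      simp only [listCast_rfl, Category.id_comp] at h ⊢
      exact whiskerLeft_swapHeads _ _ _ _ h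
  | swap a c L =>
    -- The entry `b` can stand in three places of `c :: a :: L`. At the head the claim unfolds
    -- `listPull`, in second place it is the symmetry of the braiding, and further back it is the
    -- Yang–Baxter identity.
    rintro (_ | ⟨c', _ | ⟨a', P'⟩⟩) S' b e
    · obtain ⟨rfl, rfl⟩ := List.cons.inj e
      refine ⟨[a], L, rfl, .refl _, ?_⟩
      simp only [listCast_rfl, Category.id_comp]
      have : ∀ (A B T : M), swapHeads A B T ≫ 𝟙 _ =
          (A ◁ 𝟙 (B ⊗ T) ≫ swapHeads A B T) ≫ B ◁ 𝟙 (A ⊗ T) := by simp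
      exact this _ _ _
    · obtain ⟨rfl, e'⟩ := List.cons.inj e
      obtain ⟨rfl, rfl⟩ := List.cons.inj e'
      refine ⟨[], c :: L, rfl, .refl _, ?_⟩
      simp only [listCast_rfl, Category.id_comp]
      have : ∀ (A B T : M), swapHeads A B T ≫ B ◁ 𝟙 (A ⊗ T) ≫ swapHeads B A T =
          𝟙 _ ≫ A ◁ 𝟙 (B ⊗ T) := by simp [swapHeads_swapHeads]
      exact this _ _ _
    · obtain ⟨rfl, e'⟩ := List.cons.inj e
      obtain ⟨rfl, rfl⟩ := List.cons.inj e'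
      refine ⟨a :: c :: P', S', rfl, .swap a c _, ?_⟩
      simp only [listCast_rfl, Category.id_comp]
      exact swapHeads_whiskerLeft_swapHeads _

theorem ListPerm.eval_nil (X : ι → M) {L L' : List ι} (π : ListPerm L L') (e : L = [])
    (e' : L' = []) : π.eval X = listCast X (e.trans e'.symm) := by
  induction π with
  | refl L => rfl
  | cons a _ _ => cases e
  | swap a b L => cases e
  | trans π ρ ih ih' =>
    subst e e'
    obtain rfl := π.toPerm.nil_eq
    simp only [eval, ih rfl rfl, ih' rfl rfl]
    simp

theorem append_cons_inj_of_nodup {L P S P' S' : List ι} {b : ι} (h : L.Nodup)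
    (e : L = P ++ b :: S) (e' : L = P' ++ b :: S') : P = P' ∧ S = S' := by
  subst e
  have hb := List.nodup_middle.1 h
  have hb' := List.nodup_middle.1 (e' ▸ h)
  simp only [List.nodup_cons, List.mem_append, not_or] at hb hb'
  rcases List.append_eq_append_iff.1 e' with ⟨a, h1, h2⟩ | ⟨a, h1, h2⟩
  all_goals
    cases a with
    | nil => simp_all
    | cons x a =>
      simp only [List.cons_append, List.cons.injEq] at h2
      simp [h1, h2.1] at hb hb'

/-- Coherence: the morphism given by a sequence of transpositions of a list without duplicates
depends only on the resulting list. -/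
theorem ListPerm.eval_eq (X : ι → M) {L' : List ι} :
    ∀ {L : List ι}, L.Nodup → ∀ (π ρ : ListPerm L L'), π.eval X = ρ.eval X := by
  induction L' with
  | nil =>
    intro L _ π ρ
    obtain rfl := π.toPerm.eq_nil
    rw [eval_nil X π rfl rfl, eval_nil X ρ rfl rfl]
  | cons b L' ih =>
    intro L hL π ρ
    -- On the target `b :: L'` pulling `b` is the identity, so `π` itself is a pull of `b` followed
    -- by a permutation of the remaining entries; likewise for `ρ`.
    obtain ⟨P, S, e, τ, h⟩ := π.eval_listPull X [] L' b rfl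
    obtain ⟨P', S', e', τ', h'⟩ := ρ.eval_listPull X [] L' b rfl
    -- Here distinctness enters: both sequences pull `b` from the same place. On `[a, a]` the
    -- identity and the swap would evaluate to different morphisms in general.
    obtain ⟨rfl, rfl⟩ := append_cons_inj_of_nodup hL e e'
    subst e
    have hn : (P ++ S).Nodup := (List.nodup_cons.1 (List.nodup_middle.1 hL)).2
    rw [ih hn τ' τ, ← h] at h'
    have key : ∀ {A B : M} (f g : A ⟶ B), f ≫ 𝟙 B ≫ 𝟙 B = g ≫ 𝟙 B ≫ 𝟙 B → g = f := by
      intro A B f g h; simpa using h.symm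
    exact key _ _ h'

end ListTensor

/-! ### Permutations of blocks realised by permutations of single entries. -/

section ListBlocks

variable {M : Type u} [Category.{v} M] [MonoidalCategory M] [SymmetricCategory M]
  {ι κ : Type*} (X : ι → M)

theorem swapHeads_unit (B S : M) : swapHeads (𝟙_ M) B S = (λ_ _).hom ≫ B ◁ (λ_ S).inv := by
  rw [swapHeads, braiding_tensorUnit_left]
  monoidal

theorem swapHeads_unit_right (B S : M) : swapHeads B (𝟙_ M) S = B ◁ (λ_ S).hom ≫ (λ_ _).inv := by
  rw [swapHeads, braiding_tensorUnit_right]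
  monoidal

/-- By the hexagon identity, a composite factor may cross `Q` one piece at a time. -/
theorem swapHeads_tensor_left (A P Q S : M) :
    swapHeads (A ⊗ P) Q S = (α_ A P (Q ⊗ S)).hom ≫ A ◁ swapHeads P Q S ≫
      swapHeads A Q (P ⊗ S) ≫ Q ◁ (α_ A P S).inv := by
  have h : (β_ (A ⊗ P) Q).hom = (α_ A P Q).hom ≫ A ◁ (β_ P Q).hom ≫ (α_ A Q P).inv ≫
      (β_ A Q).hom ▷ P ≫ (α_ Q A P).hom := BraidedCategory.braiding_tensor_left_hom _ _ _
  rw [swapHeads, h]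
  simp only [swapHeads]
  monoidal

theorem swapHeads_tensor_right (A P Q S : M) :
    swapHeads A (P ⊗ Q) S = A ◁ (α_ P Q S).hom ≫ swapHeads A P (Q ⊗ S) ≫
      P ◁ swapHeads A Q S ≫ (α_ P Q (A ⊗ S)).inv := by
  have h : (β_ A (P ⊗ Q)).hom = (α_ A P Q).inv ≫ (β_ A P).hom ▷ Q ≫ (α_ P A Q).hom ≫
      P ◁ (β_ A Q).hom ≫ (α_ P Q A).inv := BraidedCategory.braiding_tensor_right_hom _ _ _
  rw [swapHeads, h]
  simp only [swapHeads]
  monoidal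

namespace ListPerm

/-- The sequence is whiskered by the entries of `P` one after another. Here and below only the
existence of a sequence is recorded, since coherence makes the choice irrelevant for distinct
labels. -/
theorem exists_append_left (P : List ι) {L L' : List ι} (π : ListPerm L L') :
    ∃ ρ : ListPerm (P ++ L) (P ++ L'), ρ.eval X ≫ (listAppend X P L').hom =
      (listAppend X P L).hom ≫ listTensor X P ◁ π.eval X := by
  induction P with
  | nil => exact ⟨π, (leftUnitor_inv_naturality _)⟩
  | cons a P ih =>
    obtain ⟨ρ, h⟩ := ih
    refine ⟨.cons a ρ, ?_⟩
    -- Stated for arbitrary objects, the identity involves only tensor products and no lists; it is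
    -- then applied to the unfolded list tensors. The same device recurs below.
    have key : ∀ {A P T T' U U' : M} (r : T ⟶ T') (u : T ⟶ P ⊗ U) (u' : T' ⟶ P ⊗ U')
        (p : U ⟶ U'), r ≫ u' = u ≫ P ◁ p →
        A ◁ r ≫ A ◁ u' ≫ (α_ _ _ _).inv = (A ◁ u ≫ (α_ _ _ _).inv) ≫ (A ⊗ P) ◁ p := by
      intro A P T T' U U' r u u' p h
      rw [← whiskerLeft_comp_assoc, h]
      simp
    exact key _ _ _ _ h

/-- The single entry `a` passes the entries of `Q` one by one; the hexagon identity assembles these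
crossings into the crossing of the whole block. -/
theorem exists_move (a : ι) (Q T : List ι) :
    ∃ ρ : ListPerm (a :: (Q ++ T)) (Q ++ a :: T), ρ.eval X ≫ (listAppend X Q (a :: T)).hom =
      X a ◁ (listAppend X Q T).hom ≫ swapHeads (X a) (listTensor X Q) (listTensor X T) := by
  induction Q with
  | nil =>
    refine ⟨.refl _, ?_⟩
    have key : ∀ A S : M, 𝟙 (A ⊗ S) ≫ (λ_ (A ⊗ S)).inv = A ◁ (λ_ S).inv ≫ swapHeads A (𝟙_ M) S := by
      intro A S
      rw [swapHeads_unit_right]; simp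
    exact key _ _
  | cons q Q ih =>
    obtain ⟨ρ, h⟩ := ih
    refine ⟨(swap a q (Q ++ T)).trans (.cons q ρ), ?_⟩
    have key : ∀ {A Q P S U V : M} (r : A ⊗ U ⟶ V) (u : V ⟶ P ⊗ (A ⊗ S)) (t : U ⟶ P ⊗ S),
        r ≫ u = A ◁ t ≫ swapHeads A P S →
        (swapHeads A Q U ≫ Q ◁ r) ≫ Q ◁ u ≫ (α_ _ _ _).inv =
          A ◁ (Q ◁ t ≫ (α_ _ _ _).inv) ≫ swapHeads A (Q ⊗ P) S := by
      intro A Q P S U V r u t h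
      rw [swapHeads_tensor_right, Category.assoc, ← whiskerLeft_comp_assoc, h]
      have := swapHeads_naturality (𝟙 A) (𝟙 Q) t
      simp only [id_tensorHom] at this
      simp only [MonoidalCategory.whiskerLeft_comp, Category.assoc]
      rw [← reassoc_of% this]
      simp
    exact key _ _ _ h

/-- Induction on `P`: the tail of `P` crosses `Q` first, and then its head does by `exists_move`. -/
theorem exists_swap_blocks (P Q S : List ι) :
    ∃ ρ : ListPerm (P ++ (Q ++ S)) (Q ++ (P ++ S)),
      ρ.eval X ≫ (listAppend X Q (P ++ S)).hom ≫ listTensor X Q ◁ (listAppend X P S).hom =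
        (listAppend X P (Q ++ S)).hom ≫ listTensor X P ◁ (listAppend X Q S).hom ≫
          swapHeads _ _ _ := by
  induction P with
  | nil =>
    refine ⟨.refl _, ?_⟩
    have key : ∀ {Q S U : M} (u : U ⟶ Q ⊗ S), 𝟙 U ≫ u ≫ Q ◁ (λ_ S).inv =
        (λ_ U).inv ≫ 𝟙_ M ◁ u ≫ swapHeads (𝟙_ M) Q S := by
      intro Q S U u
      rw [swapHeads_unit]; simp
    exact key _
  | cons a P ih =>
    obtain ⟨ρ, h⟩ := ih
    obtain ⟨τ, h'⟩ := exists_move X a Q (P ++ S)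
    refine ⟨(ρ.cons a).trans τ, ?_⟩
    have key : ∀ {A P Q S U U' V V' W W' : M} (r : U ⟶ U') (t : A ⊗ U' ⟶ W) (w : W ⟶ Q ⊗ (A ⊗ V))
        (e : U' ⟶ Q ⊗ V) (p : V ⟶ P ⊗ S) (w' : U ⟶ P ⊗ W') (q : W' ⟶ Q ⊗ S)
        (_ : t ≫ w = A ◁ e ≫ swapHeads A Q V)
        (_ : r ≫ e ≫ Q ◁ p = w' ≫ P ◁ q ≫ swapHeads P Q S),
        (A ◁ r ≫ t) ≫ w ≫ Q ◁ (A ◁ p ≫ (α_ _ _ _).inv) =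
          (A ◁ w' ≫ (α_ _ _ _).inv) ≫ (A ⊗ P) ◁ q ≫ swapHeads (A ⊗ P) Q S := by
      intro A P Q S U U' V V' W W' r t w e p w' q h1 h2
      rw [Category.assoc, reassoc_of% h1, swapHeads_tensor_left]
      have := swapHeads_naturality (𝟙 A) (𝟙 Q) p
      simp only [id_tensorHom] at this
      have h3 := congrArg (fun z => A ◁ z) h2
      simp only [MonoidalCategory.whiskerLeft_comp, Category.assoc, tensor_whiskerLeft,
        Iso.inv_hom_id_assoc] at h3 ⊢
      rw [← reassoc_of% this, reassoc_of% h3]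
    exact key (V' := 𝟙_ M) _ _ _ _ _ _ _ h' h

/-- A permutation of blocks becomes a permutation of the concatenated entries: each transposition of
neighbouring blocks is expanded by `exists_swap_blocks`. -/
theorem exists_flat (B : κ → List ι) {L L' : List κ} (π : ListPerm L L') :
    ∃ ρ : ListPerm (L.flatMap B) (L'.flatMap B), ρ.eval X ≫ (listFlat X B L').hom =
      (listFlat X B L).hom ≫ π.eval (fun i => listTensor X (B i)) := by
  induction π with
  | refl L => exact ⟨.refl _, (Category.id_comp _).trans (Category.comp_id _).symm⟩
  | trans π ρ ih ih' =>
    obtain ⟨π', h⟩ := ih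
    obtain ⟨ρ', h'⟩ := ih'
    refine ⟨π'.trans ρ', ?_⟩
    simp only [eval, Category.assoc]
    rw [h', reassoc_of% h]
  | @cons i L L' π ih =>
    obtain ⟨ρ, h⟩ := ih
    obtain ⟨τ, h'⟩ := exists_append_left X (B i) ρ
    refine ⟨τ, ?_⟩
    have key : ∀ {P U U' V V' W W' : M} (t : U ⟶ V) (a : V ⟶ P ⊗ V') (a' : U ⟶ P ⊗ U')
        (r : U' ⟶ V') (f : V' ⟶ W) (f' : U' ⟶ W') (p : W' ⟶ W), t ≫ a = a' ≫ P ◁ r →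
        r ≫ f = f' ≫ p → t ≫ a ≫ P ◁ f = (a' ≫ P ◁ f') ≫ P ◁ p := by
      intro P U U' V V' W W' t a a' r f f' p h1 h2
      rw [reassoc_of% h1]
      simp only [Category.assoc, ← MonoidalCategory.whiskerLeft_comp, h2]
    exact key _ _ _ _ _ _ _ h' h
  | swap i j L =>
    obtain ⟨ρ, h⟩ := exists_swap_blocks X (B i) (B j) (L.flatMap B)
    refine ⟨ρ, ?_⟩
    have key : ∀ {P Q R U V W W' T : M} (r : U ⟶ V) (w : V ⟶ Q ⊗ W) (p : W ⟶ P ⊗ R)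
        (w' : U ⟶ P ⊗ W') (q : W' ⟶ Q ⊗ R) (f : R ⟶ T),
        r ≫ w ≫ Q ◁ p = w' ≫ P ◁ q ≫ swapHeads P Q R →
        r ≫ w ≫ Q ◁ (p ≫ P ◁ f) = (w' ≫ P ◁ (q ≫ Q ◁ f)) ≫ swapHeads P Q T := by
      intro P Q R U V W W' T r w p w' q f h
      have := swapHeads_naturality (𝟙 P) (𝟙 Q) f
      simp only [id_tensorHom] at this
      simp only [MonoidalCategory.whiskerLeft_comp, Category.assoc]
      rw [this, reassoc_of% h]
    exact key _ _ _ _ _ _ h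

theorem exists_append_right {L L' : List ι} (π : ListPerm L L') (S : List ι) :
    ∃ ρ : ListPerm (L ++ S) (L' ++ S), ρ.eval X ≫ (listAppend X L' S).hom =
      (listAppend X L S).hom ≫ π.eval X ▷ listTensor X S := by
  induction π with
  | refl L => exact ⟨.refl _, by simp [eval]⟩
  | trans π ρ ih ih' =>
    obtain ⟨π', h⟩ := ih
    obtain ⟨ρ', h'⟩ := ih'
    refine ⟨π'.trans ρ', ?_⟩
    simp only [eval, Category.assoc, comp_whiskerRight]
    rw [h', reassoc_of% h]
  | cons a π ih =>
    obtain ⟨ρ, h⟩ := ih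
    refine ⟨ρ.cons a, ?_⟩
    have key : ∀ {A P P' S U V : M} (r : U ⟶ V) (u : U ⟶ P ⊗ S) (w : V ⟶ P' ⊗ S) (p : P ⟶ P'),
        r ≫ w = u ≫ p ▷ S → A ◁ r ≫ A ◁ w ≫ (α_ _ _ _).inv =
          (A ◁ u ≫ (α_ _ _ _).inv) ≫ (A ◁ p) ▷ S := by
      intro A P P' S U V r u w p h
      rw [← whiskerLeft_comp_assoc, h]
      simp
    exact key _ _ _ _ h
  | swap a b L =>
    refine ⟨.swap a b (L ++ S), ?_⟩
    have key : ∀ {A B T S U : M} (u : U ⟶ T ⊗ S),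
        swapHeads A B U ≫ B ◁ (A ◁ u ≫ (α_ _ _ _).inv) ≫ (α_ _ _ _).inv =
          (A ◁ (B ◁ u ≫ (α_ _ _ _).inv) ≫ (α_ _ _ _).inv) ≫ swapHeads A B T ▷ S := by
      intro A B T S U u
      have := swapHeads_naturality (𝟙 A) (𝟙 B) u
      simp only [id_tensorHom] at this
      simp only [MonoidalCategory.whiskerLeft_comp, Category.assoc]
      rw [← reassoc_of% this]
      simp only [swapHeads]
      monoidal
    exact key _

end ListPerm

end ListBlocks

/-! ### Translation between tensor products of sequences and of lists. -/

section Bridge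

variable {M : Type u} [Category.{v} M] [MonoidalCategory M] {κ : Type*} (X : κ → M)

/-- The list of values of a finite sequence. -/
def toList : {n : ℕ} → (Fin n → κ) → List κ
  | 0, _ => []
  | _ + 1, a => a 0 :: toList (fun i => a i.succ)

theorem toList_eq_ofFn : {n : ℕ} → (a : Fin n → κ) → toList a = List.ofFn a
  | 0, _ => (List.ofFn_zero).symm
  | n + 1, a => by rw [toList, toList_eq_ofFn, List.ofFn_succ]

/-- Tensor products of sequences are tensor products of lists. -/
def tpowIso : {n : ℕ} → (a : Fin n → κ) → (tpow n (fun i => X (a i)) ≅ listTensor X (toList a))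
  | 0, _ => Iso.refl _
  | _ + 1, a => whiskerLeftIso (X (a 0)) (tpowIso (fun i => a i.succ))

theorem tpowIso_naturality {X Y : κ → M} (f : ∀ a, X a ⟶ Y a) :
    {n : ℕ} → (a : Fin n → κ) → tmap (fun i => f (a i)) ≫ (tpowIso Y a).hom =
      (tpowIso X a).hom ≫ listTensorMap f (toList a)
  | 0, _ => rfl
  | _ + 1, a => by
    have h := tpowIso_naturality f (fun i => a i.succ)
    have key : ∀ {A B P Q R S : M} (f : A ⟶ B) (t : P ⟶ Q) (u : Q ⟶ S) (r : P ⟶ R) (s : R ⟶ S),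
        t ≫ u = r ≫ s → (f ⊗ₘ t) ≫ B ◁ u = A ◁ r ≫ (f ⊗ₘ s) := by
      intro A B P Q R S f t u r s h
      rw [← id_tensorHom, ← id_tensorHom, tensorHom_comp_tensorHom, tensorHom_comp_tensorHom, h]
      simp
    exact key _ _ _ _ _ h

variable [SymmetricCategory M]

theorem exists_tpull : {n : ℕ} → (a : Fin (n + 1) → κ) → (i : Fin (n + 1)) →
    ∃ ρ : ListPerm (toList a) (a i :: toList (fun j => a (skip i j))),
      (tpowIso X a).hom ≫ ρ.eval X =
        tpull (fun j => X (a j)) i ≫ X (a i) ◁ (tpowIso X (fun j => a (skip i j))).hom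
  | 0, a, i => by
    obtain rfl : i = 0 := Fin.fin_one_eq_zero i
    refine ⟨.refl _, (Category.comp_id _).trans (Category.id_comp _).symm⟩
  | n + 1, a, i => by
    induction i using Fin.cases with
    | zero => exact ⟨.refl _, (Category.comp_id _).trans (Category.id_comp _).symm⟩
    | succ i =>
      obtain ⟨ρ, h⟩ := exists_tpull (fun j => a j.succ) i
      refine ⟨(ρ.cons (a 0)).trans (.swap _ _ _), ?_⟩
      have key : ∀ {A B U V P Q : M} (u : U ⟶ V) (r : V ⟶ B ⊗ P) (t : U ⟶ B ⊗ Q) (s : Q ⟶ P),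
          u ≫ r = t ≫ B ◁ s → A ◁ u ≫ A ◁ r ≫ swapHeads A B P =
            (A ◁ t ≫ swapHeads A B Q) ≫ B ◁ A ◁ s := by
        intro A B U V P Q u r t s h
        exact whiskerLeft_swapHeads _ _ _ _ h
      exact key _ _ _ _ h

/-- The equalities `h` are left general because the recursion for `tpermMap` meets `skip (σ 0)
(restPerm σ j)` where `σ j.succ` is wanted, and these agree only propositionally. -/
theorem exists_tpermMap : {n : ℕ} → (σ : Equiv.Perm (Fin n)) → (a a' : Fin n → κ) →
    (h : ∀ i, a (σ i) = a' i) →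
    ∃ ρ : ListPerm (toList a) (toList a'), (tpowIso X a).hom ≫ ρ.eval X =
      tpermMap (X := fun i => X (a i)) (Y := fun i => X (a' i)) σ
        (fun i => eqToHom (congrArg X (h i))) ≫ (tpowIso X a').hom
  | 0, _, _, _, _ => ⟨.refl _, rfl⟩
  | n + 1, σ, a, a', h => by
    obtain rfl : (fun i => a (σ i)) = a' := funext h
    obtain ⟨ρ, e⟩ := exists_tpull X a (σ 0)
    obtain ⟨τ, e'⟩ := exists_tpermMap (restPerm σ) (fun j => a (skip (σ 0) j))
      (fun j => a (σ j.succ)) (fun j => congrArg a (skip_restPerm σ j))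
    refine ⟨ρ.trans (.cons _ τ), ?_⟩
    have key : ∀ {A U V W W' R Y : M} (u : U ⟶ V) (r : V ⟶ A ⊗ W) (t : W ⟶ W') (p : U ⟶ A ⊗ R)
        (q : R ⟶ W) (z z' : R ⟶ Y) (y : Y ⟶ W'), u ≫ r = p ≫ A ◁ q → q ≫ t = z ≫ y → z' = z →
        u ≫ r ≫ A ◁ t = (p ≫ (𝟙 A ⊗ₘ z')) ≫ A ◁ y := by
      rintro A U V W W' R Y u r t p q z _ y h1 h2 rfl
      rw [reassoc_of% h1, ← MonoidalCategory.whiskerLeft_comp, h2]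
      simp
    refine key _ _ _ _ _ _ _ _ e e' ?_
    congr 1
    funext j
    exact Category.comp_id _

theorem exists_tperm {n : ℕ} (σ : Equiv.Perm (Fin n)) (a : Fin n → κ) :
    ∃ ρ : ListPerm (toList a) (toList fun i => a (σ i)), (tpowIso X a).hom ≫ ρ.eval X =
      tperm σ (fun i => X (a i)) ≫ (tpowIso X fun i => a (σ i)).hom :=
  exists_tpermMap X σ a _ fun _ => rfl

theorem exists_tsplit : (p q : ℕ) → (c : Fin (q + p) → κ) →
    ∃ ρ : ListPerm (toList c) (toList (fun i => c (Fin.castLE (Nat.le_add_left p q) i)) ++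
        toList (fun i => c (i.addNat p))),
      (tpowIso X c).hom ≫ ρ.eval X ≫ (listAppend X _ _).hom =
        (tsplit p q fun i => X (c i)).hom ≫ ((tpowIso X _).hom ⊗ₘ (tpowIso X _).hom)
  | 0, q, c => by
    refine ⟨.refl _, ?_⟩
    have key : ∀ {A B : M} (u : A ⟶ B), u ≫ 𝟙 B ≫ (λ_ B).inv = (λ_ A).inv ≫ (𝟙 (𝟙_ M) ⊗ₘ u) := by
      intro A B u; simp
    exact key _
  | p + 1, q, c => by
    obtain ⟨ρ, h⟩ := exists_tsplit p q (fun i => c i.succ)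
    refine ⟨ρ.cons _, ?_⟩
    have key : ∀ {A U V W P P' Q Q' : M} (u : U ⟶ V) (r : V ⟶ W) (a : W ⟶ P ⊗ Q)
        (t : U ⟶ P' ⊗ Q') (f : P' ⟶ P) (g : Q' ⟶ Q), u ≫ r ≫ a = t ≫ (f ⊗ₘ g) →
        A ◁ u ≫ A ◁ r ≫ A ◁ a ≫ (α_ _ _ _).inv = (A ◁ t ≫ (α_ _ _ _).inv) ≫ (A ◁ f ⊗ₘ g) := by
      intro A U V W P P' Q Q' u r a t f g h
      have := congrArg (fun z => A ◁ z ≫ (α_ _ _ _).inv) h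
      simp only [MonoidalCategory.whiskerLeft_comp, Category.assoc] at this
      rw [this, Category.assoc, ← id_tensorHom A (f ⊗ₘ g), associator_inv_naturality,
      id_tensorHom A f]
    exact key _ _ _ _ _ _ h

/-- Rebracketing into blocks and permuting inside each block are done together, so that the blocks
arrive in the order `B (d i)` ready for a permutation of blocks. -/
theorem exists_tblocks {κ' : Type*} (B : κ' → List κ) : {m : ℕ} → (k : Fin m → ℕ) →
    (c : Fin (total m k) → κ) → (d : Fin m → κ') →
    (π : ∀ i, ListPerm (toList fun j => c (inBlock k i j)) (B (d i))) →
    ∃ ρ : ListPerm (toList c) ((toList d).flatMap B),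
      (tpowIso X c).hom ≫ ρ.eval X ≫ (listFlat X B (toList d)).hom =
        (tblocks k fun p => X (c p)).hom ≫ tmap (fun i => (tpowIso X _).hom ≫ (π i).eval X) ≫
          (tpowIso (fun i => listTensor X (B i)) d).hom
  | 0, k, c, d, π => ⟨.refl _, rfl⟩
  | m + 1, k, c, d, π => by
    obtain ⟨ρ, h⟩ := exists_tsplit X (k 0) (total m fun i => k i.succ) c
    obtain ⟨ρ', h'⟩ := exists_tblocks B (fun i => k i.succ) (fun p => c (p.addNat (k 0)))
      (fun i => d i.succ) (fun i => π i.succ)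
    obtain ⟨τ, e⟩ := (π 0).exists_append_right X (toList fun p => c (p.addNat (k 0)))
    obtain ⟨τ', e'⟩ := ρ'.exists_append_left X (B (d 0))
    refine ⟨(ρ.trans τ).trans τ', ?_⟩
    have key : ∀ {U U1 U2 U3 U4 P P' P'' Q Q' Q'' S S' R : M} (u : U ⟶ U1) (r : U1 ⟶ U2)
        (t : U2 ⟶ U3)
        (t' : U3 ⟶ U4) (a : U4 ⟶ P ⊗ Q) (a2 : U2 ⟶ P' ⊗ Q') (a3 : U3 ⟶ P ⊗ Q') (s : U ⟶ P'' ⊗ Q'')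
        (f : P'' ⟶ P') (g : Q'' ⟶ Q') (p : P' ⟶ P) (q : Q' ⟶ Q) (l : Q ⟶ R) (b : Q'' ⟶ S)
        (c : S ⟶ S') (d : S' ⟶ R),
        u ≫ r ≫ a2 = s ≫ (f ⊗ₘ g) → t ≫ a3 = a2 ≫ p ▷ Q' → t' ≫ a = a3 ≫ P ◁ q →
        g ≫ q ≫ l = b ≫ c ≫ d →
        u ≫ ((r ≫ t) ≫ t') ≫ a ≫ P ◁ l = (s ≫ P'' ◁ b) ≫ ((f ≫ p) ⊗ₘ c) ≫ P ◁ d := by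
      intro U U1 U2 U3 U4 P P' P'' Q Q' Q'' S S' R u r t t' a a2 a3 s f g p q l b c d h1 h2 h3 h4
      simp only [Category.assoc]
      rw [reassoc_of% h3, reassoc_of% h2, reassoc_of% h1]
      simp only [← id_tensorHom, ← tensorHom_id, tensorHom_comp_tensorHom,
        Category.comp_id, Category.id_comp, h4]
    exact key _ _ _ _ _ _ _ _ _ _ _ _ _ _ _ _ h e e' h'

end Bridge

open scoped MonObj

/-! ### Products of generalized elements of a monoid, in permuted order. -/

section Products

variable {M : Type u} [Category.{v} M] [MonoidalCategory M] {κ : Type*} {X : κ → M} {A : M}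
  [MonObj A]

/-- The product in a monoid of a list of generalized elements. -/
def listProd (g : ∀ a, X a ⟶ A) : (L : List κ) → (listTensor X L ⟶ A)
  | [] => η[A]
  | a :: L => (g a ⊗ₘ listProd g L) ≫ μ[A]

/-- The product in a monoid of a finite sequence of generalized elements. -/
def seqProd : {n : ℕ} → {X : Fin n → M} → (∀ i, X i ⟶ A) → (tpow n X ⟶ A)
  | 0, _, _ => η[A]
  | _ + 1, _, g => (g 0 ⊗ₘ seqProd (fun i => g i.succ)) ≫ μ[A]

theorem seqProd_eq (g : ∀ a, X a ⟶ A) : {n : ℕ} → (a : Fin n → κ) →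
    seqProd (fun i => g (a i)) = (tpowIso X a).hom ≫ listProd g (toList a)
  | 0, _ => (Category.id_comp _).symm
  | n + 1, a => by
    have key : ∀ {P U V : M} (f : P ⟶ A) (s : U ⟶ A) (u : U ⟶ V) (l : V ⟶ A), s = u ≫ l →
        (f ⊗ₘ s) ≫ μ[A] = P ◁ u ≫ (f ⊗ₘ l) ≫ μ[A] := by
      rintro P U V f _ u l rfl
      rw [← id_tensorHom, tensorHom_comp_tensorHom_assoc, Category.id_comp]
    exact key _ _ _ _ (seqProd_eq g fun i => a i.succ)

theorem listProd_map {Y : κ → M} (f : ∀ a, X a ⟶ Y a) (g : ∀ a, Y a ⟶ A) : (L : List κ) →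
    listTensorMap f L ≫ listProd g L = listProd (fun a => f a ≫ g a) L
  | [] => Category.id_comp _
  | a :: L => by
    rw [listProd, listProd, ← listProd_map f g L]
    exact tensorHom_comp_tensorHom_assoc _ _ _ _ _

theorem listProd_hom {B : M} [MonObj B] (f : A ⟶ B) [IsMonHom f] (g : ∀ a, X a ⟶ A) :
    (L : List κ) → listProd g L ≫ f = listProd (fun a => g a ≫ f) L
  | [] => IsMonHom.one_hom f
  | a :: L => by
    have key : ∀ {P Q : M} (p : P ⟶ A) (q : Q ⟶ A),
        ((p ⊗ₘ q) ≫ μ[A]) ≫ f = ((p ≫ f) ⊗ₘ (q ≫ f)) ≫ μ[B] := by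
      intro P Q p q
      rw [Category.assoc, IsMonHom.mul_hom, tensorHom_comp_tensorHom_assoc]
    refine (key _ _).trans ?_
    rw [listProd_hom f g L]
    rfl

theorem listProd_append (g : ∀ a, X a ⟶ A) (L' : List κ) : (L : List κ) →
    (listAppend X L L').hom ≫ (listProd g L ⊗ₘ listProd g L') ≫ μ[A] = listProd g (L ++ L')
  | [] => by
    have key : ∀ {U : M} (l : U ⟶ A), (λ_ U).inv ≫ (η[A] ⊗ₘ l) ≫ μ[A] = l := by
      intro U l
      rw [MonoidalCategory.tensorHom_def', Category.assoc, MonObj.one_mul]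
      simp
    exact key _
  | a :: L => by
    have h := listProd_append g L' L
    have key : ∀ {P U V W : M} (u : U ⟶ V ⊗ W) (f : P ⟶ A) (l : V ⟶ A) (l' : W ⟶ A) (r : U ⟶ A),
        u ≫ (l ⊗ₘ l') ≫ μ[A] = r →
        (P ◁ u ≫ (α_ _ _ _).inv) ≫ (((f ⊗ₘ l) ≫ μ[A]) ⊗ₘ l') ≫ μ[A] = (f ⊗ₘ r) ≫ μ[A] := by
      rintro P U V W u f l l' _ rfl
      have h1 : ((f ⊗ₘ l) ≫ μ[A]) ⊗ₘ l' = ((f ⊗ₘ l) ⊗ₘ l') ≫ (μ[A] ▷ A) := by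
        rw [← tensorHom_id, tensorHom_comp_tensorHom, Category.comp_id]
      have h2 : f ⊗ₘ (u ≫ (l ⊗ₘ l') ≫ μ[A]) = P ◁ u ≫ (f ⊗ₘ (l ⊗ₘ l')) ≫ (A ◁ μ[A]) := by
        rw [← id_tensorHom, ← id_tensorHom, tensorHom_comp_tensorHom, tensorHom_comp_tensorHom]
        simp
      rw [h1, h2]
      simp only [Category.assoc, MonObj.mul_assoc]
      rw [← associator_inv_naturality_assoc, Iso.inv_hom_id_assoc]
    exact key _ _ _ _ _ h

theorem listProd_flat {κ' : Type*} (B : κ' → List κ) (g : ∀ a, X a ⟶ A) : (L : List κ') →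
    (listFlat X B L).hom ≫ listProd (X := fun i => listTensor X (B i))
      (fun i => listProd g (B i)) L = listProd g (L.flatMap B)
  | [] => Category.id_comp _
  | i :: L => by
    have h := listProd_flat B g L
    refine Eq.trans ?_ (listProd_append g (L.flatMap B) (B i))
    have key : ∀ {P Q U V : M} (u : U ⟶ P ⊗ V) (l : V ⟶ Q) (f : P ⟶ A) (p : Q ⟶ A) (r : V ⟶ A),
        l ≫ p = r → (u ≫ P ◁ l) ≫ (f ⊗ₘ p) ≫ μ[A] = u ≫ (f ⊗ₘ r) ≫ μ[A] := by
      rintro P Q U V u l f p _ rfl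
      rw [Category.assoc, ← id_tensorHom, tensorHom_comp_tensorHom_assoc, Category.id_comp]
    exact key _ _ _ _ _ h

variable [SymmetricCategory M]

/-- Associativity rebrackets the product so that the two neighbours are multiplied first; there the
commutation hypothesis applies. Prefix entries are added by induction. -/
theorem listProd_swap (g : ∀ a, X a ⟶ A) {a b : κ}
    (h : (g a ⊗ₘ g b) ≫ μ[A] = (β_ (X a) (X b)).hom ≫ (g b ⊗ₘ g a) ≫ μ[A]) (S : List κ) :
    (P : List κ) → ∃ ρ : ListPerm (P ++ a :: b :: S) (P ++ b :: a :: S),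
      ρ.eval X ≫ listProd g (P ++ b :: a :: S) = listProd g (P ++ a :: b :: S)
  | [] => by
    refine ⟨.swap a b S, ?_⟩
    have key : ∀ {P Q U : M} (f : P ⟶ A) (g : Q ⟶ A) (l : U ⟶ A)
        (_ : (f ⊗ₘ g) ≫ μ[A] = (β_ P Q).hom ≫ (g ⊗ₘ f) ≫ μ[A]),
        swapHeads P Q U ≫ (g ⊗ₘ ((f ⊗ₘ l) ≫ μ[A])) ≫ μ[A] =
          (f ⊗ₘ ((g ⊗ₘ l) ≫ μ[A])) ≫ μ[A] := by
      intro P Q U f g l h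
      have h1 : ∀ {P Q : M} (f : P ⟶ A) (g : Q ⟶ A), (f ⊗ₘ ((g ⊗ₘ l) ≫ μ[A])) ≫ μ[A] =
          (α_ _ _ _).inv ≫ (((f ⊗ₘ g) ≫ μ[A]) ⊗ₘ l) ≫ μ[A] := by
        intro P Q f g
        have h2 : f ⊗ₘ ((g ⊗ₘ l) ≫ μ[A]) = (f ⊗ₘ (g ⊗ₘ l)) ≫ A ◁ μ[A] := by
          rw [← id_tensorHom, tensorHom_comp_tensorHom, Category.comp_id]
        have h3 : ((f ⊗ₘ g) ≫ μ[A]) ⊗ₘ l = ((f ⊗ₘ g) ⊗ₘ l) ≫ μ[A] ▷ A := by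
          rw [← tensorHom_id, tensorHom_comp_tensorHom, Category.comp_id]
        rw [h2, h3]
        simp only [Category.assoc, MonObj.mul_assoc]
        rw [← associator_inv_naturality_assoc, Iso.inv_hom_id_assoc]
      rw [h1, h1, h, swapHeads]
      simp only [Category.assoc, Iso.hom_inv_id_assoc]
      rw [← tensorHom_id, tensorHom_comp_tensorHom_assoc, Category.id_comp]
    exact key _ _ _ h
  | c :: P => by
    obtain ⟨ρ, e⟩ := listProd_swap g h S P
    refine ⟨ρ.cons c, ?_⟩
    have key : ∀ {P U V : M} (r : U ⟶ V) (f : P ⟶ A) (l : V ⟶ A) (p : U ⟶ A), r ≫ l = p →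
        P ◁ r ≫ (f ⊗ₘ l) ≫ μ[A] = (f ⊗ₘ p) ≫ μ[A] := by
      rintro P U V r f l _ rfl
      rw [← id_tensorHom, tensorHom_comp_tensorHom_assoc, Category.id_comp]
    exact key _ _ _ _ e

/-- The product `g_{σ⁻¹(1)} ⋯ g_{σ⁻¹(n)}` in a monoid of generalized elements `g₁, …, gₙ`. -/
def permProd {n : ℕ} {X : Fin n → M} (σ : Equiv.Perm (Fin n)) (g : ∀ i, X i ⟶ A) :
    tpow n X ⟶ A :=
  tperm σ.symm X ≫ seqProd (fun i => g (σ.symm i))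

theorem nodup_toList {n : ℕ} {a : Fin n → κ} (ha : Function.Injective a) : (toList a).Nodup := by
  rw [toList_eq_ofFn]
  exact List.nodup_ofFn.2 ha

/-- Products in permuted order can be computed with any sequence of transpositions. -/
theorem permProd_eq (X : κ → M) {n : ℕ} {a : Fin n → κ} (ha : Function.Injective a)
    (σ : Equiv.Perm (Fin n)) {L : List κ} (hL : L = toList fun i => a (σ.symm i))
    (π : ListPerm (toList a) L) (g : ∀ k, X k ⟶ A) :
    permProd σ (fun i => g (a i)) = (tpowIso X a).hom ≫ π.eval X ≫ listProd g L := by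
  subst hL
  obtain ⟨ρ, h⟩ := exists_tperm X σ.symm a
  rw [ListPerm.eval_eq X (nodup_toList ha) π ρ, reassoc_of% h, ← seqProd_eq]
  rfl

theorem exists_listPerm {n : ℕ} (a : Fin n → κ) (σ : Equiv.Perm (Fin n)) :
    Nonempty (ListPerm (toList a) (toList fun i => a (σ i))) := by
  apply ListPerm.nonempty_of_perm
  rw [toList_eq_ofFn, toList_eq_ofFn]
  exact (Equiv.Perm.ofFn_comp_perm σ a).symm

theorem permProd_map {n : ℕ} {X Y : Fin n → M} (σ : Equiv.Perm (Fin n)) (f : ∀ i, X i ⟶ Y i)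
    (g : ∀ i, Y i ⟶ A) : tmap f ≫ permProd σ g = permProd σ (fun i => f i ≫ g i) := by
  obtain ⟨π⟩ := exists_listPerm (fun i => i) σ.symm
  have h := permProd_eq Y (a := fun i => i) (fun _ _ h => h) σ rfl π g
  have h' := permProd_eq X (a := fun i => i) (fun _ _ h => h) σ rfl π (fun i => f i ≫ g i)
  refine (congrArg (tmap f ≫ ·) h).trans (Eq.trans ?_ h'.symm)
  rw [← listProd_map, ← reassoc_of% ListPerm.eval_naturality f π]
  exact (reassoc_of% tpowIso_naturality f (fun i => i)) _

theorem permProd_hom {n : ℕ} {X : Fin n → M} (σ : Equiv.Perm (Fin n)) (g : ∀ i, X i ⟶ A)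
    {B : M} [MonObj B] (f : A ⟶ B) [IsMonHom f] :
    permProd σ g ≫ f = permProd σ (fun i => g i ≫ f) := by
  obtain ⟨π⟩ := exists_listPerm (fun i => i) σ.symm
  have h := permProd_eq X (a := fun i => i) (fun _ _ h => h) σ rfl π g
  have h' := permProd_eq X (a := fun i => i) (fun _ _ h => h) σ rfl π (fun i => g i ≫ f)
  refine (congrArg (· ≫ f) h).trans (Eq.trans ?_ h'.symm)
  rw [← listProd_hom, Category.assoc, Category.assoc]

/-- Both sides arrange the factors into the same final list. The sequence for the right side is
taken to be the one realising `ρ` followed by the one used on the left. -/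
theorem permProd_perm {n : ℕ} {X : Fin n → M} (ρ σ : Equiv.Perm (Fin n)) (g : ∀ i, X i ⟶ A) :
    tperm ρ X ≫ permProd (X := fun i => X (ρ i)) (ρ.trans σ) (fun i => g (ρ i)) =
      permProd σ g := by
  obtain ⟨τ, e⟩ := exists_tperm X ρ (fun i => i)
  obtain ⟨π⟩ := exists_listPerm (fun i => i) σ.symm
  obtain ⟨π'⟩ := exists_listPerm (fun i => ρ i) (ρ.trans σ).symm
  have hl : (toList fun i => σ.symm i) = toList fun i => ρ ((ρ.trans σ).symm i) := by simp
  have h' := permProd_eq X (a := fun i => ρ i) ρ.injective (ρ.trans σ) hl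
    (π'.trans (.ofEq hl.symm)) g
  have h := permProd_eq X (a := fun i => i) (fun _ _ h => h) σ rfl
    (τ.trans (π'.trans (.ofEq hl.symm))) g
  refine (congrArg (tperm ρ X ≫ ·) h').trans (Eq.trans ?_ h.symm)
  simp only [ListPerm.eval, Category.assoc]
  exact ((reassoc_of% e) _).symm

/-- A rearrangement of all of `Fin n` that is increasing for the order induced by `e` is unique.
This reduces an identity of permutations to a statement about order. -/
theorem perm_eq_of_pairwise {n : ℕ} (e : Equiv.Perm (Fin n)) {L : List (Fin n)}
    (h : (toList fun i : Fin n => i).Perm L) (h' : L.Pairwise (fun a b => e a < e b)) :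
    L = toList fun i => e.symm i := by
  have h1 : (toList fun i => e.symm i).Perm L := by
    refine List.Perm.trans ?_ h
    rw [toList_eq_ofFn, toList_eq_ofFn]
    exact Equiv.Perm.ofFn_comp_perm e.symm (fun i => i)
  refine (h1.symm.eq_of_pairwise (fun a b _ _ h h' => absurd h h'.asymm) h' ?_)
  rw [toList_eq_ofFn, List.pairwise_ofFn]
  intro i j hij
  simpa using hij

/-- The core of operadic associativity. Sorting each block by `τ i` and then the blocks by `σ`
produces the list sorted by `compPerm k σ τ`, so coherence equates the two-stage permutation with
the direct one. -/
theorem permProd_blocks {m : ℕ} (k : Fin m → ℕ) {X : Fin (total m k) → M}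
    (σ : Equiv.Perm (Fin m)) (τ : ∀ i, Equiv.Perm (Fin (k i))) (g : ∀ p, X p ⟶ A) :
    permProd (compPerm k σ τ) g = (tblocks k X).hom ≫
      permProd σ (fun i => permProd (τ i) (fun j => g (inBlock k i j))) := by
  let B : Fin m → List (Fin (total m k)) := fun i => toList fun j => inBlock k i ((τ i).symm j)
  have hinj : ∀ i, Function.Injective (inBlock k i) := fun i j j' h => by
    simpa using congrArg (blockEquiv k).symm h
  let π : ∀ i, ListPerm (toList fun j => inBlock k i j) (B i) := fun i =>
    (exists_listPerm (fun j => inBlock k i j) (τ i).symm).some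
  have h1 : ∀ i, permProd (τ i) (fun j => g (inBlock k i j)) =
      ((tpowIso X fun j => inBlock k i j).hom ≫ (π i).eval X) ≫ listProd g (B i) := fun i => by
    rw [permProd_eq X (hinj i) (τ i) rfl (π i) g, Category.assoc]
  obtain ⟨πσ⟩ := exists_listPerm (fun i : Fin m => i) σ.symm
  obtain ⟨ρ, h2⟩ := exists_tblocks X B k (fun p => p) (fun i => i) π
  obtain ⟨ρ', h3⟩ := ListPerm.exists_flat X B πσ
  simp only [h1]
  rw [← permProd_map σ _ (fun i => listProd g (B i))]
  have h4 := permProd_eq (fun i => listTensor X (B i)) (a := fun i => i) (fun _ _ h => h) σ rfl πσ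
    (fun i => listProd g (B i))
  -- The order induced by `compPerm` is lexicographic by `compPerm_lt_iff`: pairs in one block are
  -- compared by `τ i`, pairs in different blocks by `σ`.
  have hL : (toList fun i => σ.symm i).flatMap B = toList fun p => (compPerm k σ τ).symm p := by
    refine perm_eq_of_pairwise _ (ρ.trans ρ').toPerm ?_
    rw [List.pairwise_flatMap]
    constructor
    · intro i _
      simp only [B]
      rw [toList_eq_ofFn, List.pairwise_ofFn]
      intro j j' h
      rw [compPerm_lt_iff]
      simpa using h
    · rw [toList_eq_ofFn, List.pairwise_ofFn]
      intro i i' h x hx y hy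
      simp only [B] at hx hy
      rw [toList_eq_ofFn, List.mem_ofFn] at hx hy
      obtain ⟨j, rfl⟩ := hx
      obtain ⟨j', rfl⟩ := hy
      rw [compPerm_lt_iff]
      simpa using Or.inl h
  have h5 := permProd_eq X (a := fun p => p) (fun _ _ h => h) (compPerm k σ τ) hL (ρ.trans ρ') g
  refine h5.trans ?_
  refine Eq.trans ?_ (congrArg (fun z => (tblocks k X).hom ≫ tmap _ ≫ z) h4.symm)
  rw [← listProd_flat]
  simp only [ListPerm.eval, Category.assoc]
  rw [reassoc_of% h3]
  exact (reassoc_of% h2) _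

end Products

/-! ### Morphisms out of a tensor product with a coproduct of units. -/

section Copower

variable {M : Type u} [Category.{v} M] [MonoidalCategory M] [SymmetricCategory M]
  [MonoidalClosed M] [HasColimits M]

/-- The morphism out of `(∐_S I) ⊗ X` given by a family of morphisms out of `X`. -/
noncomputable def copowerDesc {S : Type v} {X Y : M} (f : S → (X ⟶ Y)) :
    (∐ fun _ : S => 𝟙_ M) ⊗ X ⟶ Y :=
  -- The internal hom is adjoint to tensoring with `X` on the left, hence the braiding.
  (β_ _ X).hom ≫ MonoidalClosed.uncurry
    (Sigma.desc fun s => MonoidalClosed.curry ((ρ_ X).hom ≫ f s))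

theorem ι_copowerDesc {S : Type v} {X Y : M} (f : S → (X ⟶ Y)) (s : S) :
    (λ_ X).inv ≫ (Sigma.ι (fun _ : S => 𝟙_ M) s ▷ X) ≫ copowerDesc f = f s := by
  rw [copowerDesc, BraidedCategory.braiding_naturality_left_assoc,
    ← MonoidalClosed.uncurry_natural_left, Sigma.ι_desc, MonoidalClosed.uncurry_curry]
  simp

/-- Tensoring with `X` preserves the coproduct since `M` is closed, so agreement on the summands
suffices. -/
theorem copower_hom_ext {S : Type v} {X Y : M} {f g : (∐ fun _ : S => 𝟙_ M) ⊗ X ⟶ Y}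
    (h : ∀ s, (λ_ X).inv ≫ (Sigma.ι (fun _ : S => 𝟙_ M) s ▷ X) ≫ f =
      (λ_ X).inv ≫ (Sigma.ι (fun _ : S => 𝟙_ M) s ▷ X) ≫ g) : f = g := by
  rw [← cancel_epi (β_ X _).hom]
  apply MonoidalClosed.curry_injective
  refine Sigma.hom_ext _ _ fun s => ?_
  rw [← MonoidalClosed.curry_natural_left, ← MonoidalClosed.curry_natural_left,
    BraidedCategory.braiding_naturality_right_assoc,
    BraidedCategory.braiding_naturality_right_assoc]
  rw [(cancel_epi (λ_ X).inv).1 (h s)]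

end Copower

/-! ### From commutative functors to algebras over the orthogonal operad. -/

section OfFunctor

/-- Turns the transposition of two adjacent places in a word into the transposition of two
neighbouring list entries, the form used by `listProd_swap`. -/
theorem exists_toList_swap {κ : Type*} : {n : ℕ} → (h : Fin n → κ) → (p q : Fin n) →
    q.val = p.val + 1 → ∃ P S, toList h = P ++ h p :: h q :: S ∧
      (toList fun i => h (Equiv.swap p q i)) = P ++ h q :: h p :: S
  | 0, _, p, _, _ => p.elim0
  | 1, _, p, q, e => by omega
  | n + 2, h, p, q, e => by
    induction p using Fin.cases with
    | zero =>
      obtain rfl : q = 1 := Fin.ext e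
      refine ⟨[], toList fun i => h i.succ.succ, rfl, ?_⟩
      simp only [toList, List.nil_append]
      refine congrArg₂ _ (by simp) (congrArg₂ _ (by simp) (congrArg _ (funext fun i => ?_)))
      exact congrArg h (Equiv.swap_apply_of_ne_of_ne (Fin.succ_ne_zero _)
        fun e => Fin.succ_ne_zero i (Fin.succ_injective _ e))
    | succ p =>
      induction q using Fin.cases with
      | zero => simp at e
      | succ q =>
        obtain ⟨P, S, h1, h2⟩ := exists_toList_swap (fun i => h i.succ) p q (by simpa using e)
        refine ⟨h 0 :: P, S, ?_, ?_⟩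
        · rw [toList, h1]; rfl
        · rw [toList]
          refine congrArg₂ _ (congrArg h (Equiv.swap_apply_of_ne_of_ne (Fin.succ_ne_zero p).symm
            (Fin.succ_ne_zero q).symm)) ?_
          refine Eq.trans (congrArg _ (funext fun i => ?_)) h2
          congr 1
          exact (Fin.succ_injective _).swap_apply p q i

variable {C : Type v} [SmallCategory C] (R : OrthogonalityRelation C)
  {M : Type u} [Category.{v} M] [MonoidalCategory M] [SymmetricCategory M]

/-- A functor to monoids is `⊥`-commutative if orthogonal morphisms have commuting images. -/
def IsPerpCommutative (B : C ⥤ Mon M) : Prop :=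
  ∀ ⦃c₁ c₂ t : C⦄ (f₁ : c₁ ⟶ t) (f₂ : c₂ ⟶ t), R.perp f₁ f₂ →
    ((B.map f₁).hom ⊗ₘ (B.map f₂).hom) ≫ μ[(B.obj t).X] =
      (β_ _ _).hom ≫ ((B.map f₂).hom ⊗ₘ (B.map f₁).hom) ≫ μ[(B.obj t).X]

/-- The operation `(σ, f)` on a functor to monoids. -/
def wordOp (B : C ⥤ Mon M) {n : ℕ} {c : Fin n → C} {t : C} (x : Word c t) :
    tpow n (fun i => (B.obj (c i)).X) ⟶ (B.obj t).X :=
  permProd x.1 fun i => (B.map (x.2 i)).hom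

variable {R}

/-- The inverse of `swap p q * σ` lists the same factors with places `p` and `q` exchanged. These
two factors commute by hypothesis, so the product is unchanged and `wordOp` descends to the quotient
operad. -/
theorem wordOp_step {B : C ⥤ Mon M} (hB : IsPerpCommutative R B) {n : ℕ} {c : Fin n → C} {t : C}
    {x y : Word c t} (h : Word.Step R x y) : wordOp B x = wordOp B y := by
  obtain ⟨σ, f⟩ := x
  obtain ⟨σ', f'⟩ := y
  obtain ⟨h1, p, q, hpq, hp, h2⟩ := h
  simp only at h1 h2 hp
  subst h1 h2
  obtain ⟨P, S, e, e'⟩ := exists_toList_swap (fun i => σ.symm i) p q hpq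
  obtain ⟨ρ, hρ⟩ := listProd_swap (X := fun i => (B.obj (c i)).X) (fun i => (B.map (f i)).hom)
    (hB _ _ hp) S P
  obtain ⟨π⟩ := exists_listPerm (fun i : Fin n => i) σ.symm
  have k1 := permProd_eq (fun i => (B.obj (c i)).X) (a := fun i => i) (fun _ _ h => h) σ e.symm
    (π.trans (.ofEq e)) (fun i => (B.map (f i)).hom)
  have k2 := permProd_eq (fun i => (B.obj (c i)).X) (a := fun i => i) (fun _ _ h => h)
    (Equiv.swap p q * σ) e'.symm
    ((π.trans (.ofEq e)).trans ρ) (fun i => (B.map (f i)).hom)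
  refine k1.trans (Eq.trans ?_ k2.symm)
  rw [← hρ]
  exact congrArg (_ ≫ ·) (Category.assoc _ _ _).symm

theorem wordOp_rel {B : C ⥤ Mon M} (hB : IsPerpCommutative R B) {n : ℕ} {c : Fin n → C} {t : C}
    {x y : Word c t} (h : Word.Rel R x y) : wordOp B x = wordOp B y := by
  induction h with
  | refl => rfl
  | tail _ h ih => exact ih.trans (wordOp_step hB h)

theorem wordOp_map (B : C ⥤ Mon M) {n : ℕ} {c : Fin n → C} {t : C} (σ : Equiv.Perm (Fin n))
    (x : Word c t) : tperm σ (fun i => (B.obj (c i)).X) ≫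
      wordOp B (Word.map (c' := fun i => c (σ i)) σ (fun _ => rfl) x) = wordOp B x := by
  refine Eq.trans ?_ (permProd_perm σ x.1 fun i => (B.map (x.2 i)).hom)
  congr 1
  have : Word.map (c' := fun i => c (σ i)) σ (fun _ => rfl) x =
      (σ.trans x.1, fun i => x.2 (σ i)) :=
    Prod.ext (by ext; rfl) (funext fun i => by simp [Word.map])
  rw [this]
  rfl

/-- The permutations are handled by `permProd_blocks`. Each `B.map (x.2 i)` is a monoid morphism and
so passes inside the product over the `i`-th block, where functoriality forms the composites. -/
theorem wordOp_comp (B : C ⥤ Mon M) {m : ℕ} {k : Fin m → ℕ} {a : Fin m → C}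
    {c : Fin (total m k) → C} {t : C} (x : Word a t)
    (y : ∀ i, Word (fun j => c (inBlock k i j)) (a i)) :
    wordOp B (Word.comp x y) = (tblocks k fun p => (B.obj (c p)).X).hom ≫
      tmap (fun i => wordOp B (y i)) ≫ wordOp B x := by
  refine (permProd_blocks k x.1 (fun i => (y i).1) _).trans ?_
  congr 1
  refine Eq.trans ?_ (permProd_map x.1 _ _).symm
  congr 1
  funext i
  refine Eq.trans ?_ (permProd_hom (y i).1 _ (B.map (x.2 i)).hom).symm
  congr 1
  funext j
  have := Word.comp_hom x y i j
  refine (congrArg (fun z => (B.map z).hom) this).trans ?_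
  simp

theorem permProd_one {A : M} [MonObj A] {n : ℕ} {X : Fin n → M} (g : ∀ i, X i ⟶ A) :
    permProd 1 g = seqProd g := by
  refine (permProd_eq X (a := fun i => i) (fun _ _ h => h) 1 rfl (.refl _) g).trans ?_
  exact (congrArg (_ ≫ ·) (Category.id_comp _)).trans (seqProd_eq g fun i => i).symm

variable [MonoidalClosed M] [HasColimits M]

/-- The algebra over `O_C̄` given by a `⊥`-commutative functor. -/
noncomputable def Algebra.ofFunctor (B : C ⥤ Mon M) (hB : IsPerpCommutative R B) :
    Algebra (orthOperad R) M where
  obj t := (B.obj t).X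
  str c t := copowerDesc (Quotient.lift (wordOp B) fun _ _ h => wordOp_rel hB h)
  equivariance σ o := by
    obtain ⟨x, rfl⟩ := Quotient.exists_rep o
    refine (congrArg (_ ≫ ·) (ι_copowerDesc _ _)).trans (Eq.trans ?_ (ι_copowerDesc _ _).symm)
    exact wordOp_map B σ x
  associativity o q := by
    obtain ⟨x, rfl⟩ := Quotient.exists_rep o
    obtain ⟨y, rfl⟩ := OrthWord.exists_rep q
    have e := OrthWord.comp_mk (R := R) x y
    refine (congrArg _ e).trans ((ι_copowerDesc _ _).trans ((wordOp_comp B x y).trans ?_))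
    congr 1
    refine congrArg₂ (fun f g => tmap f ≫ g) (funext fun i => ?_) ?_
    · exact (ι_copowerDesc (Quotient.lift (wordOp B) fun _ _ h => wordOp_rel hB h)
        (OrthWord.mk (y i))).symm
    · exact (ι_copowerDesc (Quotient.lift (wordOp B) fun _ _ h => wordOp_rel hB h)
        (OrthWord.mk x)).symm
  unitality t := by
    refine (ι_copowerDesc _ _).trans ((permProd_one _).trans ?_)
    have key : ((B.map (𝟙 t)).hom ⊗ₘ η[(B.obj t).X]) ≫ μ[(B.obj t).X] = (ρ_ (B.obj t).X).hom := by
      simp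
    exact key

theorem Algebra.ofFunctor_op (B : C ⥤ Mon M) (hB : IsPerpCommutative R B) {n : ℕ} {c : Fin n → C}
    {t : C} (x : Word c t) :
    Algebra.op (Algebra.ofFunctor B hB) (O := orthOperad R) (OrthWord.mk x) = wordOp B x :=
  ι_copowerDesc _ _

theorem ofFunctor_prodOp (B : C ⥤ Mon M) (hB : IsPerpCommutative R B) {n : ℕ} {c : Fin n → C}
    {t : C} (f : ∀ i, c i ⟶ t) :
    ((Algebra.pullback M (projHom R)).obj (Algebra.ofFunctor B hB)).prodOp f =
      seqProd fun i => (B.map (f i)).hom :=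
  (Algebra.operation_pullbackStr (projHom R) (Algebra.ofFunctor B hB) (1, f)).trans
    ((Algebra.ofFunctor_op B hB (1, f)).trans (permProd_one _))

/-- The functor underlying the algebra given by a `⊥`-commutative functor. -/
noncomputable def projPullbackOfFunctorIso (B : C ⥤ Mon M) (hB : IsPerpCommutative R B) :
    (projPullback R M).obj (Algebra.ofFunctor B hB) ≅ B :=
  NatIso.ofComponents
    (fun t => Mon.mkIso (M := ((projPullback R M).obj (Algebra.ofFunctor B hB)).obj t)
      (N := B.obj t) (Iso.refl (B.obj t).X)
      (by
        refine (Category.comp_id _).trans ?_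
        exact ofFunctor_prodOp B hB _)
      (by
        refine (Category.comp_id _).trans ?_
        -- The multiplication recovered from the algebra is `a · (b · 1)`, with a final empty
        -- product coming from the last unit factor of `tpow`; the unit law removes it.
        have key : ((B.obj t).X ◁ (ρ_ (B.obj t).X).inv) ≫
            ((B.map (𝟙 t)).hom ⊗ₘ (((B.map (𝟙 t)).hom ⊗ₘ η[(B.obj t).X]) ≫ μ[(B.obj t).X])) ≫
              μ[(B.obj t).X] = (𝟙 _ ⊗ₘ 𝟙 _) ≫ μ[(B.obj t).X] := by
          simp
        refine Eq.trans ?_ key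
        exact congrArg (((B.obj t).X ◁ (ρ_ (B.obj t).X).inv) ≫ ·)
          (ofFunctor_prodOp B hB (c := fun _ : Fin 2 => t) (fun _ => 𝟙 t))))
    (fun {c t} f => by
      refine Mon.Hom.ext ?_
      refine (Category.comp_id _).trans (Eq.trans ?_ (Category.id_comp _).symm)
      have key : (ρ_ (B.obj c).X).inv ≫ ((B.map f).hom ⊗ₘ η[(B.obj t).X]) ≫ μ[(B.obj t).X] =
          (B.map f).hom := by
        rw [MonoidalCategory.tensorHom_def, Category.assoc, MonObj.mul_one]
        simp
      refine Eq.trans ?_ key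
      exact congrArg ((ρ_ (B.obj c).X).inv ≫ ·)
        (ofFunctor_prodOp B hB (c := fun _ : Fin 1 => c) (fun _ => f)))

end OfFunctor

/-! ### Algebra operations are permuted products; full faithfulness. -/

section FullyFaithful

variable {C : Type v} [SmallCategory C] {R : OrthogonalityRelation C}
  {M : Type u} [Category.{v} M] [MonoidalCategory M] [SymmetricCategory M]

theorem compPerm_one {m : ℕ} (k : Fin m → ℕ) : compPerm k 1 (fun _ => 1) = 1 := by
  refine equiv_ext_of_lt _ _ fun p q h => ?_
  obtain ⟨i, j, rfl⟩ := inBlock_surj _ p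
  obtain ⟨i', j', rfl⟩ := inBlock_surj _ q
  rw [compPerm_lt_iff] at h
  exact (inBlock_lt_iff k i i' j j').2 h

theorem seqProd_blocks {A : M} [MonObj A] {m : ℕ} (k : Fin m → ℕ) {X : Fin (total m k) → M}
    (g : ∀ p, X p ⟶ A) : seqProd g = (tblocks k X).hom ≫
      seqProd (fun i => seqProd (fun j => g (inBlock k i j))) := by
  have h := permProd_blocks k 1 (fun _ => 1) g
  rw [compPerm_one, permProd_one, permProd_one] at h
  simp only [permProd_one] at h
  exact h

theorem seqProd_map {A : M} [MonObj A] {n : ℕ} {X Y : Fin n → M} (f : ∀ i, X i ⟶ Y i)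
    (g : ∀ i, Y i ⟶ A) : tmap f ≫ seqProd g = seqProd (fun i => f i ≫ g i) := by
  rw [← permProd_one, ← permProd_one, permProd_map]

/-- The components are monoid morphisms natural in the object, so they commute with permuted
products. This is the source of fullness. -/
theorem wordOp_naturality {A B : C ⥤ Mon M} (θ : A ⟶ B) {n : ℕ} {c : Fin n → C} {t : C}
    (x : Word c t) : wordOp A x ≫ (θ.app t).hom =
      tmap (fun i => (θ.app (c i)).hom) ≫ wordOp B x := by
  rw [wordOp, wordOp, permProd_hom, permProd_map]
  congr 1
  funext i
  exact congrArg Mon.Hom.hom (θ.naturality (x.2 i))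

variable [HasColimits M]

noncomputable instance (A : Algebra (monOperad C) M) (t : C) : MonObj (A.obj t) :=
  (A.toMon t).mon

/-- The operations `(e, f)` are products of the images of the inputs. -/
theorem prodOp_eq_seqProd (A : Algebra (monOperad C) M) (n : ℕ) :
    ∀ {c : Fin n → C} {t : C} (f : ∀ i, c i ⟶ t),
      A.prodOp f = seqProd (fun i => A.mapOp (f i)) := by
  induction n using Nat.strong_induction_on with
  | _ n ih =>
    intro c t f
    match n, c, f, ih with
    | 0, c, f, ih => exact A.prodOp_elim0 f
    | 1, c, f, ih =>
      have key : A.unOp (f 0) = (A.mapOp (f 0) ⊗ₘ η[A.obj t]) ≫ μ[A.obj t] := by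
        refine Eq.trans ?_ (MonObj.mul_one_hom (M := A.obj t) (A.mapOp (f 0))).symm
        rw [Algebra.mapOp, Iso.hom_inv_id_assoc]
      refine Eq.trans ?_ key
      obtain ⟨d, rfl⟩ : ∃ d, c = fun _ => d :=
        ⟨c 0, funext fun i => congrArg c (Fin.fin_one_eq_zero i)⟩
      exact congrArg A.prodOp (funext fun i => congrArg f (Fin.fin_one_eq_zero i))
    | n + 2, c, f, ih =>
      -- The profile is cut into a first block of length one and a second of length `n + 1`, both
      -- shorter than `n + 2`. The total of these lengths is `n + 2` only propositionally, so the
      -- length is generalized before substituting.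
      obtain ⟨N, hN⟩ : ∃ N, N = n + 2 := ⟨_, rfl⟩
      have hk : N = total 2 (@Fin.cases 1 (fun _ => ℕ) 1 (fun _ => n + 1)) := by
        rw [hN, total_eq_sum, Fin.sum_univ_two]
        change n + 2 = 1 + (n + 1)
        omega
      revert c f ih
      rw [← hN]
      subst hk
      intro c f ih
      rw [seqProd_blocks, A.prodOp_comp _ (a := fun _ => t) (fun _ => 𝟙 t)
        (fun i j => f (inBlock _ i j)) f (fun _ _ => (Category.comp_id _).symm)]
      congr 1
      have h1 : ∀ i : Fin 2, (@Fin.cases 1 (fun _ => ℕ) 1 (fun _ => n + 1)) i < n + 2 := by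
        intro i
        induction i using Fin.cases with
        | zero => change 1 < n + 2; omega
        | succ i => change n + 1 < n + 2; omega
      have h2 : A.prodOp (c := fun _ : Fin 2 => t) (fun _ => 𝟙 t) =
          seqProd (X := fun _ : Fin 2 => A.obj t) (fun _ => 𝟙 (A.obj t)) := by
        have key : A.binOp (𝟙 t) = (𝟙 (A.obj t) ⊗ₘ ((𝟙 (A.obj t) ⊗ₘ η[A.obj t]) ≫
            μ[A.obj t])) ≫ μ[A.obj t] := by
          rw [MonObj.mul_one_hom]
          have : μ[A.obj t] = (A.obj t ◁ (ρ_ (A.obj t)).inv) ≫ A.binOp (𝟙 t) := rfl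
          rw [this, id_tensorHom]
          exact (by simp : A.binOp (𝟙 t) = A.obj t ◁ ((ρ_ (A.obj t)).hom ≫ 𝟙 _) ≫
            A.obj t ◁ (ρ_ (A.obj t)).inv ≫ A.binOp (𝟙 t))
        exact key
      rw [h2]
      refine (congrArg (tmap · ≫ _) (funext fun i => ih _ (by rw [hN]; exact h1 i) _)).trans ?_
      refine (seqProd_map _ _).trans ?_
      congr 1
      funext i
      exact Category.comp_id _

/-- Equivariance under the inverse of the word's permutation brings the word to identity order,
where `prodOp_eq_seqProd` applies. -/
theorem op_eq_wordOp (A : Algebra (monOperad C) M) {n : ℕ} {c : Fin n → C} {t : C}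
    (x : Word c t) : A.op (O := monOperad C) x = wordOp A.toFunctor x := by
  refine (A.equivariance x.1.symm x).symm.trans ?_
  have : Word.map (c' := fun i => c (x.1.symm i)) x.1.symm (fun _ => rfl) x =
      (1, fun i => x.2 (x.1.symm i)) :=
    Prod.ext (by ext; simp [Word.map]) (funext fun i => by simp [Word.map])
  refine (congrArg (fun y => _ ≫ A.op (O := monOperad C) y) this).trans ?_
  exact congrArg (_ ≫ ·) (prodOp_eq_seqProd A n _)

theorem op_mk_eq_wordOp (A : Algebra (orthOperad R) M) {n : ℕ} {c : Fin n → C} {t : C}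
    (x : Word c t) :
    A.op (O := orthOperad R) (OrthWord.mk x) = wordOp ((projPullback R M).obj A) x :=
  (Algebra.operation_pullbackStr (projHom R) A x).symm.trans
    (op_eq_wordOp ((Algebra.pullback M (projHom R)).obj A) x)

/-- The words `(e, (f₁, f₂))` and `(swap, (f₁, f₂))` are one element of the quotient operad. Their
operations are the two products in opposite order, up to a trailing unit factor that `key` and
`key2` cancel. -/
theorem isPerpCommutative_projPullback (A : Algebra (orthOperad R) M) :
    IsPerpCommutative R ((projPullback R M).obj A) := by
  intro c₁ c₂ t f₁ f₂ h
  let c : Fin 2 → C := @Fin.cases 1 (fun _ => C) c₁ (fun _ => c₂)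
  let f : ∀ i, c i ⟶ t := @Fin.cases 1 (fun i => c i ⟶ t) f₁ (fun _ => f₂)
  let x : Word c t := (1, f)
  let y : Word c t := (Equiv.swap 0 1, f)
  have hxy : OrthWord.mk (R := R) x = OrthWord.mk y := by
    refine Quotient.sound (Relation.ReflTransGen.single ⟨rfl, 0, 1, rfl, h, ?_⟩)
    simp [x, y]
  have e := congrArg (A.op (O := orthOperad R)) hxy
  set B := (projPullback R M).obj A
  replace e : wordOp B x = wordOp B y :=
    (op_mk_eq_wordOp A x).symm.trans (e.trans (op_mk_eq_wordOp A y))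
  have e1 : wordOp B x = ((B.map f₁).hom ⊗ₘ (((B.map f₂).hom ⊗ₘ η[(B.obj t).X]) ≫
      μ[(B.obj t).X])) ≫ μ[(B.obj t).X] := permProd_one _
  have hL : ([1, 0] : List (Fin 2)) = toList fun i => (Equiv.swap (0 : Fin 2) 1).symm i := by
    simp [toList]
  have e2 : wordOp B y = (B.obj c₁).X ◁ (B.obj c₂).X ◁ 𝟙 (𝟙_ M) ≫
      swapHeads (B.obj c₁).X (B.obj c₂).X (𝟙_ M) ≫
      ((B.map f₂).hom ⊗ₘ (((B.map f₁).hom ⊗ₘ η[(B.obj t).X]) ≫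
      μ[(B.obj t).X])) ≫ μ[(B.obj t).X] :=
    permProd_eq (fun i => (B.obj (c i)).X) (a := fun i => i) (fun _ _ h => h) (Equiv.swap 0 1) hL
      (.swap 0 1 []) (fun i => (B.map (f i)).hom)
  rw [e1, e2, MonObj.mul_one_hom, MonObj.mul_one_hom] at e
  have e3 := congrArg ((B.obj c₁).X ◁ (ρ_ (B.obj c₂).X).inv ≫ ·) e
  have key : ∀ {X Y Z : M} (f : X ⟶ Z) (g : Y ⟶ Z),
      X ◁ (ρ_ Y).inv ≫ (f ⊗ₘ ((ρ_ Y).hom ≫ g)) = f ⊗ₘ g := by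
    intro X Y Z f g
    rw [← id_tensorHom, tensorHom_comp_tensorHom]
    simp
  have key2 : ∀ {X Y Z : M} (f : X ⟶ Z) (g : Y ⟶ Z),
      X ◁ (ρ_ Y).inv ≫ X ◁ Y ◁ 𝟙 (𝟙_ M) ≫ swapHeads X Y (𝟙_ M) ≫ (g ⊗ₘ ((ρ_ X).hom ≫ f)) =
        (β_ X Y).hom ≫ (g ⊗ₘ f) := by
    intro X Y Z f g
    have : X ◁ (ρ_ Y).inv ≫ X ◁ Y ◁ 𝟙 (𝟙_ M) ≫ swapHeads X Y (𝟙_ M) =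
        (β_ X Y).hom ≫ Y ◁ (ρ_ X).inv := by
      rw [swapHeads]; monoidal
    rw [reassoc_of% this, key]
  rw [reassoc_of% key, reassoc_of% key2] at e3
  exact e3

instance : (projPullback R M).Faithful where
  map_injective {A B _ _} h := Algebra.Hom.ext <| funext fun t =>
    congrArg (fun θ : (projPullback R M).obj A ⟶ (projPullback R M).obj B => (θ.app t).hom) h

variable [MonoidalClosed M]

/-- The components of `θ` already form the algebra morphism: on each summand the operation is a
`wordOp`, which `θ` respects. -/
instance : (projPullback R M).Full where
  map_surjective {A B} θ := by
    refine ⟨⟨fun t => (θ.app t).hom, fun {n} c t => copower_hom_ext fun o => ?_⟩, ?_⟩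
    · obtain ⟨x, rfl⟩ := Quotient.exists_rep o
      have h : A.op (O := orthOperad R) (OrthWord.mk x) ≫ (θ.app t).hom =
          tmap (fun i => (θ.app (c i)).hom) ≫ B.op (O := orthOperad R) (OrthWord.mk x) := by
        refine (congrArg (· ≫ (θ.app t).hom) (op_mk_eq_wordOp A x)).trans ?_
        exact (wordOp_naturality θ x).trans (congrArg (_ ≫ ·) (op_mk_eq_wordOp B x).symm)
      have key : ∀ {S T U V W : M} (s : 𝟙_ M ⟶ S) (a : S ⊗ T ⟶ U) (b : S ⊗ V ⟶ W) (f : U ⟶ W)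
          (g : T ⟶ V), ((λ_ T).inv ≫ s ▷ T ≫ a) ≫ f = g ≫ (λ_ V).inv ≫ s ▷ V ≫ b →
          (λ_ T).inv ≫ s ▷ T ≫ a ≫ f = (λ_ T).inv ≫ s ▷ T ≫ S ◁ g ≫ b := by
        intro S T U V W s a b f g h
        simp only [Category.assoc] at h
        rw [h, ← whisker_exchange_assoc, leftUnitor_inv_naturality_assoc]
      exact key _ _ _ _ _ h
    · ext t
      rfl

end FullyFaithful

/-! ### Tensoring preserves epimorphisms, coequalizers and coproducts. -/

section ClosedDesc

variable {M : Type u} [Category.{v} M] [MonoidalCategory M] [MonoidalClosed M]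

instance epi_whiskerLeft (X : M) {A B : M} (f : A ⟶ B) [Epi f] : Epi (X ◁ f) :=
  inferInstanceAs (Epi ((tensorLeft X).map f))

variable [HasColimits M]

/-- After currying, `h` coequalizes `f` and `g` themselves; its factorization through the
coequalizer is then uncurried. -/
theorem exists_whiskerLeft_desc (X : M) {P E Y : M} {f g : P ⟶ E} (h : X ⊗ E ⟶ Y)
    (w : X ◁ f ≫ h = X ◁ g ≫ h) :
    ∃ l : X ⊗ coequalizer f g ⟶ Y, X ◁ coequalizer.π f g ≫ l = h := by
  have w' : f ≫ MonoidalClosed.curry h = g ≫ MonoidalClosed.curry h := by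
    rw [← MonoidalClosed.curry_natural_left, ← MonoidalClosed.curry_natural_left, w]
  refine ⟨MonoidalClosed.uncurry (coequalizer.desc _ w'), ?_⟩
  rw [← MonoidalClosed.uncurry_natural_left, coequalizer.π_desc, MonoidalClosed.uncurry_curry]

variable {J : Type v} {A : J → M}

/-- A morphism out of `X ⊗ ∐ A`, given on the summands. -/
noncomputable def whiskerLeftSigmaDesc (X : M) {Y : M} (f : ∀ j, X ⊗ A j ⟶ Y) : X ⊗ ∐ A ⟶ Y :=
  MonoidalClosed.uncurry (Sigma.desc fun j => MonoidalClosed.curry (f j))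

@[simp]
theorem whiskerLeft_ι_sigmaDesc (X : M) {Y : M} (f : ∀ j, X ⊗ A j ⟶ Y) (j : J) :
    X ◁ Sigma.ι A j ≫ whiskerLeftSigmaDesc X f = f j := by
  rw [whiskerLeftSigmaDesc, ← MonoidalClosed.uncurry_natural_left, Sigma.ι_desc,
    MonoidalClosed.uncurry_curry]

theorem whiskerLeft_sigma_hom_ext {X Y : M} {f g : X ⊗ ∐ A ⟶ Y}
    (h : ∀ j, X ◁ Sigma.ι A j ≫ f = X ◁ Sigma.ι A j ≫ g) : f = g := by
  apply MonoidalClosed.curry_injective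
  refine Sigma.hom_ext _ _ fun j => ?_
  rw [← MonoidalClosed.curry_natural_left, ← MonoidalClosed.curry_natural_left, h]

variable [SymmetricCategory M]

instance epi_whiskerRight (X : M) {A B : M} (f : A ⟶ B) [Epi f] : Epi (f ▷ X) := by
  have h : f ▷ X = (β_ A X).hom ≫ X ◁ f ≫ (β_ B X).inv := by simp
  rw [h]
  infer_instance

instance epi_tensorHom {A B A' B' : M} (f : A ⟶ B) (g : A' ⟶ B') [Epi f] [Epi g] :
    Epi (f ⊗ₘ g) := by
  rw [MonoidalCategory.tensorHom_def]
  infer_instance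

theorem exists_whiskerRight_desc (X : M) {P E Y : M} {f g : P ⟶ E} (h : E ⊗ X ⟶ Y)
    (w : f ▷ X ≫ h = g ▷ X ≫ h) :
    ∃ l : coequalizer f g ⊗ X ⟶ Y, coequalizer.π f g ▷ X ≫ l = h := by
  obtain ⟨l, hl⟩ := exists_whiskerLeft_desc X ((β_ X E).hom ≫ h)
    (f := f) (g := g) (by simp only [BraidedCategory.braiding_naturality_right_assoc, w])
  exact ⟨(β_ _ _).hom ≫ l, by simp [hl]⟩

theorem whiskerRight_sigma_hom_ext {X Y : M} {f g : (∐ A) ⊗ X ⟶ Y}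
    (h : ∀ j, Sigma.ι A j ▷ X ≫ f = Sigma.ι A j ▷ X ≫ g) : f = g := by
  rw [← cancel_epi (β_ X _).hom]
  refine whiskerLeft_sigma_hom_ext fun j => ?_
  simp only [BraidedCategory.braiding_naturality_right_assoc, h]

end ClosedDesc

/-! ### Quotients of a monoid by relations, built in the underlying category. -/

section Quotient

variable {M : Type u} [Category.{v} M] [MonoidalCategory M]

/-- The map `t ⊗ r ⊗ t' ↦ t r t'` that generates the two-sided ideal of a relation. -/
def sandwich {T R : M} [MonObj T] (r : R ⟶ T) : T ⊗ (R ⊗ T) ⟶ T :=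
  T ◁ (r ▷ T ≫ μ[T]) ≫ μ[T]

/-- In elements, `t' (t r t'') = (t' t) r t''`. With `sandwich_mul` this shows that the relations
are stable under multiplication on both sides. -/
theorem mul_sandwich {T R : M} [MonObj T] (r : R ⟶ T) :
    T ◁ sandwich r ≫ μ[T] = (α_ _ _ _).inv ≫ μ[T] ▷ (R ⊗ T) ≫ sandwich r := by
  rw [sandwich, MonoidalCategory.whiskerLeft_comp, Category.assoc, MonObj.mul_assoc_flip,
    associator_inv_naturality_right_assoc, whisker_exchange_assoc]

theorem sandwich_mul {T R : M} [MonObj T] (r : R ⟶ T) :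
    sandwich r ▷ T ≫ μ[T] = (α_ _ _ _).hom ≫ T ◁ ((α_ _ _ _).hom ≫ R ◁ μ[T]) ≫ sandwich r := by
  have h : (r ▷ T ≫ μ[T]) ▷ T ≫ μ[T] = ((α_ _ _ _).hom ≫ R ◁ μ[T]) ≫ r ▷ T ≫ μ[T] := by
    rw [comp_whiskerRight, Category.assoc, Category.assoc, MonObj.mul_assoc,
      associator_naturality_left_assoc, whisker_exchange_assoc]
  rw [sandwich, comp_whiskerRight, Category.assoc, MonObj.mul_assoc, whisker_assoc]
  simp only [Category.assoc, Iso.inv_hom_id_assoc]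
  rw [← whiskerLeft_comp_assoc, h, whiskerLeft_comp_assoc]

/-- The right side depends on `r` only through `r ≫ f`, so a monoid morphism that identifies `r` and
`s` identifies their sandwiches. -/
theorem sandwich_hom {T R N : M} [MonObj T] [MonObj N] (r : R ⟶ T) (f : T ⟶ N) [IsMonHom f] :
    sandwich r ≫ f = (f ⊗ₘ (((r ≫ f) ⊗ₘ f) ≫ μ[N])) ≫ μ[N] := by
  simp only [sandwich, ← id_tensorHom, ← tensorHom_id, Category.assoc, IsMonHom.mul_hom,
    tensorHom_comp_tensorHom_assoc, Category.id_comp]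

/-- Taking both outer factors to be the unit recovers `r`, so coequalizing the sandwiches also
coequalizes the original pair. -/
theorem unit_sandwich {T R : M} [MonObj T] (r : R ⟶ T) :
    (λ_ R).inv ≫ η[T] ▷ R ≫ T ◁ ((ρ_ R).inv ≫ R ◁ η[T]) ≫ sandwich r = r := by
  have h : ((ρ_ R).inv ≫ R ◁ η[T]) ≫ r ▷ T ≫ μ[T] = r := by
    rw [Category.assoc, whisker_exchange_assoc, MonObj.mul_one]
    simp
  rw [sandwich, ← whiskerLeft_comp_assoc, h, ← whisker_exchange_assoc, MonObj.one_mul]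
  simp

variable [SymmetricCategory M] [MonoidalClosed M] [HasColimits M]

/-- The coequalizer of the two sandwiches in `M` is the quotient by the generated congruence.
Keeping `q.hom` epi in `M`, not merely in `Mon M`, lets later equations be tested before passing to
the quotient. -/
theorem exists_mon_quotient (T : Mon M) {R : M} (r s : R ⟶ T.X) :
    ∃ (Q : Mon M) (q : T ⟶ Q), Epi q.hom ∧ r ≫ q.hom = s ≫ q.hom ∧
      ∀ (N : Mon M) (f : T ⟶ N), r ≫ f.hom = s ≫ f.hom → ∃ g : Q ⟶ N, q ≫ g = f := by
  obtain ⟨T⟩ := T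
  change R ⟶ T at r s
  let q := coequalizer.π (sandwich r) (sandwich s)
  have hq : sandwich r ≫ q = sandwich s ≫ q := coequalizer.condition _ _
  -- The multiplication followed by `q` descends in its right factor by `mul_sandwich`, and
  -- afterwards in its left factor by `sandwich_mul`, the latter being tested on the epimorphism `_
  -- ◁ q`.
  obtain ⟨m₁, h₁⟩ := exists_whiskerLeft_desc T (f := sandwich r) (g := sandwich s) (μ[T] ≫ q)
    (by rw [← Category.assoc, ← Category.assoc, mul_sandwich, mul_sandwich]; simp [hq])
  obtain ⟨m, h₂⟩ := exists_whiskerRight_desc (coequalizer (sandwich r) (sandwich s))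
    (f := sandwich r) (g := sandwich s) m₁
    (by
      rw [← cancel_epi (_ ◁ q), whisker_exchange_assoc, h₁, whisker_exchange_assoc, h₁,
        ← Category.assoc, ← Category.assoc, sandwich_mul, sandwich_mul]
      simp [hq])
  have hm : (q ⊗ₘ q) ≫ m = μ[T] ≫ q := by
    rw [MonoidalCategory.tensorHom_def', Category.assoc, h₂, h₁]
  let inst : MonObj (coequalizer (sandwich r) (sandwich s)) :=
    { one := η[T] ≫ q
      mul := m
      one_mul := by
        rw [← cancel_epi (_ ◁ q), comp_whiskerRight_assoc, h₂, whisker_exchange_assoc, h₁]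
        simp
      mul_one := by
        rw [← cancel_epi (q ▷ _), ← whisker_exchange_assoc, h₂,
          MonoidalCategory.whiskerLeft_comp_assoc, h₁]
        simp
      mul_assoc := by
        have e₁ : ((μ[T] ≫ q) ⊗ₘ q) ≫ m = (μ[T] ▷ T ≫ μ[T]) ≫ q := by
          rw [Category.assoc, ← hm, ← tensorHom_id, tensorHom_comp_tensorHom_assoc,
            Category.id_comp, hm]
        have e₂ : (q ⊗ₘ (μ[T] ≫ q)) ≫ m = (T ◁ μ[T] ≫ μ[T]) ≫ q := by
          rw [Category.assoc, ← hm, ← id_tensorHom, tensorHom_comp_tensorHom_assoc,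
            Category.id_comp, hm]
        rw [← cancel_epi ((q ⊗ₘ q) ⊗ₘ q), associator_naturality_assoc, ← tensorHom_id,
          ← id_tensorHom, tensorHom_comp_tensorHom_assoc, tensorHom_comp_tensorHom_assoc, hm,
          Category.comp_id, e₁, e₂, MonObj.mul_assoc, Category.assoc] }
  have : IsMonHom q := ⟨rfl, hm.symm⟩
  refine ⟨⟨coequalizer (sandwich r) (sandwich s)⟩, Mon.Hom.mk q, ?_, ?_, fun N f hf => ?_⟩
  · exact inferInstanceAs (Epi (coequalizer.π _ _))
  · change r ≫ q = s ≫ q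
    refine ((congrArg (· ≫ q) (unit_sandwich r)).symm.trans ?_).trans
      (congrArg (· ≫ q) (unit_sandwich s))
    simp only [Category.assoc, hq]
  · have w : sandwich r ≫ f.hom = sandwich s ≫ f.hom := by
      rw [sandwich_hom, sandwich_hom]
      exact congrArg (fun z => (f.hom ⊗ₘ (z ⊗ₘ f.hom) ≫ μ[N.X]) ≫ μ[N.X]) hf
    have hd : q ≫ coequalizer.desc f.hom w = f.hom := coequalizer.π_desc _ _
    have h1 : IsMonHom (coequalizer.desc f.hom w) := by
      refine ⟨?_, ?_⟩
      · refine (Category.assoc _ _ _).trans ((congrArg (_ ≫ ·) hd).trans ?_)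
        exact IsMonHom.one_hom f.hom
      · rw [← cancel_epi (q ⊗ₘ q)]
        refine (Category.assoc _ _ _).symm.trans ((congrArg (· ≫ _) hm).trans ?_)
        rw [tensorHom_comp_tensorHom_assoc, Category.assoc, hd]
        exact IsMonHom.mul_hom f.hom
    exact ⟨Mon.Hom.mk (coequalizer.desc f.hom w), Mon.Hom.ext hd⟩

end Quotient

/-! ### The free monoid on a family of objects. -/

section FreeMonoid

variable {M : Type u} [Category.{v} M] [MonoidalCategory M] {κ : Type v} (X : κ → M)

theorem whiskerLeft_listCast (a : κ) {L L' : List κ} (h : L = L') :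
    X a ◁ listCast X h = listCast X (congrArg (List.cons a) h) := by
  subst h
  exact MonoidalCategory.whiskerLeft_id _ _

theorem listAppend_nil : (L : List κ) →
    (listAppend X L []).hom = listCast X L.append_nil ≫ (ρ_ (listTensor X L)).inv
  | [] => by
    have key : (λ_ (𝟙_ M)).inv = 𝟙 _ ≫ (ρ_ (𝟙_ M)).inv := by
      rw [unitors_inv_equal, Category.id_comp]
    exact key
  | a :: L => by
    have key : ∀ {A U V : M} (u : U ⟶ V ⊗ 𝟙_ M) (c : U ⟶ V), u = c ≫ (ρ_ V).inv →
        A ◁ u ≫ (α_ _ _ _).inv = A ◁ c ≫ (ρ_ (A ⊗ V)).inv := by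
      rintro A U V _ c rfl
      simp
    refine (key _ _ (listAppend_nil L)).trans ?_
    rw [whiskerLeft_listCast]
    rfl

/-- Coherence of splitting a triple concatenation; the cast accounts for the two bracketings. This
becomes associativity of `freeMul`. -/
theorem listAppend_assoc (L' L'' : List κ) : (L : List κ) →
    (listAppend X (L ++ L') L'').hom ≫ (listAppend X L L').hom ▷ listTensor X L'' ≫
        (α_ _ _ _).hom =
      listCast X (List.append_assoc L L' L'') ≫ (listAppend X L (L' ++ L'')).hom ≫
        listTensor X L ◁ (listAppend X L' L'').hom
  | [] => by
    have key : ∀ {A B U : M} (u : U ⟶ A ⊗ B), u ≫ (λ_ A).inv ▷ B ≫ (α_ _ _ _).hom =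
        𝟙 _ ≫ (λ_ U).inv ≫ 𝟙_ M ◁ u := by
      intro A B U u; simp
    exact key _
  | a :: L => by
    have key : ∀ {A P Q S U U' V W : M} (u : U ⟶ V ⊗ S) (p : V ⟶ P ⊗ Q) (c : U ⟶ U')
        (q : U' ⟶ P ⊗ W) (w : W ⟶ Q ⊗ S),
        u ≫ p ▷ S ≫ (α_ _ _ _).hom = c ≫ q ≫ P ◁ w →
        (A ◁ u ≫ (α_ _ _ _).inv) ≫ (A ◁ p ≫ (α_ _ _ _).inv) ▷ S ≫ (α_ (A ⊗ P) Q S).hom =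
          A ◁ c ≫ (A ◁ q ≫ (α_ _ _ _).inv) ≫ (A ⊗ P) ◁ w := by
      intro A P Q S U U' V W u p c q w h
      have h2 := congrArg (fun z => A ◁ z ≫ (α_ _ _ _).inv) h
      simp only [MonoidalCategory.whiskerLeft_comp, Category.assoc] at h2
      simp only [Category.assoc, tensor_whiskerLeft, Iso.inv_hom_id_assoc]
      rw [← h2]
      monoidal
    refine (key _ _ _ _ _ (listAppend_assoc L' L'' L)).trans ?_
    rw [whiskerLeft_listCast]
    rfl

section

variable [SymmetricCategory M] [MonoidalClosed M] [HasColimits M] {J J' J'' : Type v}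
  {A : J → M} {B : J' → M} {D : J'' → M}

theorem sigma_tensor_hom_ext {Y : M} {f g : (∐ A) ⊗ (∐ B) ⟶ Y}
    (h : ∀ i j, (Sigma.ι A i ⊗ₘ Sigma.ι B j) ≫ f = (Sigma.ι A i ⊗ₘ Sigma.ι B j) ≫ g) : f = g := by
  refine whiskerRight_sigma_hom_ext fun i => whiskerLeft_sigma_hom_ext fun j => ?_
  have := h i j
  rw [MonoidalCategory.tensorHom_def', Category.assoc, Category.assoc] at this
  exact this

theorem sigma_tensor_tensor_hom_ext {Y : M} {f g : ((∐ A) ⊗ (∐ B)) ⊗ (∐ D) ⟶ Y}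
    (h : ∀ i j k, ((Sigma.ι A i ⊗ₘ Sigma.ι B j) ⊗ₘ Sigma.ι D k) ≫ f =
      ((Sigma.ι A i ⊗ₘ Sigma.ι B j) ⊗ₘ Sigma.ι D k) ≫ g) : f = g := by
  rw [← cancel_epi (β_ _ _).hom]
  apply MonoidalClosed.curry_injective
  refine sigma_tensor_hom_ext fun i j => ?_
  rw [← MonoidalClosed.curry_natural_left, ← MonoidalClosed.curry_natural_left,
    BraidedCategory.braiding_naturality_right_assoc,
    BraidedCategory.braiding_naturality_right_assoc]
  congr 2
  refine whiskerLeft_sigma_hom_ext fun k => ?_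
  have := h i j k
  rw [MonoidalCategory.tensorHom_def', Category.assoc, Category.assoc] at this
  exact this

end

variable [HasColimits M]

/-- The object underlying the free monoid on a family of objects. -/
noncomputable abbrev freeMonObj : M := ∐ fun L : List κ => listTensor X L

/-- The inclusion of a summand into the free monoid. -/
noncomputable abbrev freeIncl (L : List κ) : listTensor X L ⟶ freeMonObj X :=
  Sigma.ι (fun L : List κ => listTensor X L) L

theorem listCast_freeIncl {L L' : List κ} (h : L = L') :
    listCast X h ≫ freeIncl X L' = freeIncl X L := by
  subst h; simp

variable [SymmetricCategory M] [MonoidalClosed M]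

/-- The multiplication of the free monoid. -/
noncomputable def freeMul : freeMonObj X ⊗ freeMonObj X ⟶ freeMonObj X :=
  whiskerLeftSigmaDesc _ fun L' => (β_ _ _).hom ≫ whiskerLeftSigmaDesc _ fun L =>
    (β_ _ _).hom ≫ (listAppend X L L').inv ≫ freeIncl X (L ++ L')

theorem freeIncl_mul (L L' : List κ) : (freeIncl X L ⊗ₘ freeIncl X L') ≫ freeMul X =
    (listAppend X L L').inv ≫ freeIncl X (L ++ L') := by
  rw [MonoidalCategory.tensorHom_def, Category.assoc, freeMul, whiskerLeft_ι_sigmaDesc,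
    BraidedCategory.braiding_naturality_left_assoc, whiskerLeft_ι_sigmaDesc]
  simp

/-- Multiplication concatenates words, and each law is checked on summands. The left unit law needs
no cast, as `[] ++ L` is `L` by definition; the right unit law uses `listAppend_nil`. -/
noncomputable instance : MonObj (freeMonObj X) where
  one := freeIncl X []
  mul := freeMul X
  one_mul := by
    refine whiskerLeft_sigma_hom_ext fun L => ?_
    have key : ∀ {U T : M} (e : 𝟙_ M ⟶ T) (l : U ⟶ T) (m : T ⊗ T ⟶ T),
        (e ⊗ₘ l) ≫ m = (λ_ U).hom ≫ l → 𝟙_ M ◁ l ≫ e ▷ T ≫ m = 𝟙_ M ◁ l ≫ (λ_ T).hom := by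
      intro U T e l m h
      rw [leftUnitor_naturality, ← h, MonoidalCategory.tensorHom_def', Category.assoc]
    exact key _ _ _ (freeIncl_mul X [] L)
  mul_one := by
    refine whiskerRight_sigma_hom_ext fun L => ?_
    have key : ∀ {U T : M} (e : 𝟙_ M ⟶ T) (l : U ⟶ T) (m : T ⊗ T ⟶ T),
        (l ⊗ₘ e) ≫ m = (ρ_ U).hom ≫ l → l ▷ 𝟙_ M ≫ T ◁ e ≫ m = l ▷ 𝟙_ M ≫ (ρ_ T).hom := by
      intro U T e l m h
      rw [rightUnitor_naturality, ← h, MonoidalCategory.tensorHom_def, Category.assoc]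
    refine key _ _ _ ((freeIncl_mul X L []).trans ?_)
    refine (Iso.inv_comp_eq _).2 ?_
    rw [listAppend_nil]
    refine Eq.trans ?_ (Category.assoc _ _ _).symm
    exact ((congrArg (_ ≫ ·) (Iso.inv_hom_id_assoc _ _)).trans (listCast_freeIncl X _)).symm
  mul_assoc := by
    refine sigma_tensor_tensor_hom_ext fun L L' L'' => ?_
    rw [associator_naturality_assoc, ← tensorHom_id, ← id_tensorHom,
      tensorHom_comp_tensorHom_assoc, tensorHom_comp_tensorHom_assoc, freeIncl_mul, freeIncl_mul,
      Category.comp_id, Category.comp_id]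
    have h₁ : ((listAppend X L L').inv ≫ freeIncl X (L ++ L') ⊗ₘ freeIncl X L'') ≫ freeMul X =
        (listAppend X L L').inv ▷ _ ≫ (listAppend X (L ++ L') L'').inv ≫
          freeIncl X (L ++ L' ++ L'') := by
      rw [← freeIncl_mul X (L ++ L') L'', ← tensorHom_id, tensorHom_comp_tensorHom_assoc,
          Category.id_comp]
    have h₂ : (freeIncl X L ⊗ₘ (listAppend X L' L'').inv ≫ freeIncl X (L' ++ L'')) ≫ freeMul X =
        _ ◁ (listAppend X L' L'').inv ≫ (listAppend X L (L' ++ L'')).inv ≫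
          freeIncl X (L ++ (L' ++ L'')) := by
      rw [← freeIncl_mul X L (L' ++ L''), ← id_tensorHom, tensorHom_comp_tensorHom_assoc,
          Category.id_comp]
    refine h₁.trans (Eq.trans ?_ (congrArg (_ ≫ ·) h₂).symm)
    have h₃ := listAppend_assoc X L' L'' L
    rw [← listCast_freeIncl X (List.append_assoc L L' L''), ← Category.assoc, ← Category.assoc,
      ← Category.assoc, ← Category.assoc]
    congr 1
    rw [← cancel_mono ((listAppend X L (L' ++ L'')).hom ≫ _ ◁ (listAppend X L' L'').hom)]
    simp only [Category.assoc, Iso.inv_hom_id_assoc]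
    rw [← h₃]
    simp [← MonoidalCategory.whiskerLeft_comp, ← comp_whiskerRight_assoc]

/-- The free monoid on a family of objects. -/
noncomputable abbrev freeMon : Mon M := ⟨freeMonObj X⟩

/-- The generators of the free monoid. -/
noncomputable def freeGen (a : κ) : X a ⟶ freeMonObj X := (ρ_ (X a)).inv ≫ freeIncl X [a]

/-- Every summand is thereby a product of generators, which yields uniqueness in `freeMon_hom_ext`
by induction on the word. -/
theorem freeIncl_cons (a : κ) (L : List κ) :
    freeIncl X (a :: L) = (freeGen X a ⊗ₘ freeIncl X L) ≫ μ[freeMonObj X] := by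
  have h := freeIncl_mul X [a] L
  have key : ∀ {A T U : M} (l : A ⊗ T ⟶ U) (g : A ⊗ 𝟙_ M ⟶ U) (i : T ⟶ U) (m : U ⊗ U ⟶ U),
      (g ⊗ₘ i) ≫ m = ((α_ _ _ _).hom ≫ A ◁ (λ_ T).hom) ≫ l →
      l = (((ρ_ A).inv ≫ g) ⊗ₘ i) ≫ m := by
    intro A T U l g i m h
    have : ((ρ_ A).inv ≫ g) ⊗ₘ i = (ρ_ A).inv ▷ T ≫ (g ⊗ₘ i) := by
      rw [← tensorHom_id, tensorHom_comp_tensorHom, Category.id_comp]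
    rw [this, Category.assoc, h]
    simp
  exact key _ _ _ _ h

/-- The monoid morphism out of the free monoid given on the generators. -/
noncomputable def freeLift {N : Mon M} (g : ∀ a, X a ⟶ N.X) : freeMon X ⟶ N :=
  Mon.Hom.mk' (M := freeMon X) (Sigma.desc fun L => listProd g L) (Sigma.ι_desc _ _) <| by
    refine sigma_tensor_hom_ext fun L L' => ?_
    rw [tensorHom_comp_tensorHom_assoc, Sigma.ι_desc, Sigma.ι_desc]
    refine (Category.assoc _ _ _).symm.trans ((congrArg (· ≫ _) (freeIncl_mul X L L')).trans ?_)
    rw [Category.assoc, Sigma.ι_desc, Iso.inv_comp_eq, listProd_append]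

theorem freeGen_lift {N : Mon M} (g : ∀ a, X a ⟶ N.X) (a : κ) :
    freeGen X a ≫ (freeLift X g).hom = g a := by
  refine (Category.assoc _ _ _).trans ((congrArg ((ρ_ (X a)).inv ≫ ·)
    (Sigma.ι_desc (fun L => listProd g L) [a])).trans ?_)
  have key : ∀ {Y : M} (f : Y ⟶ N.X), (ρ_ Y).inv ≫ (f ⊗ₘ η[N.X]) ≫ μ[N.X] = f := by
    intro Y f; simp
  exact key _

theorem freeMon_hom_ext {N : Mon M} {f g : freeMon X ⟶ N}
    (h : ∀ a, freeGen X a ≫ f.hom = freeGen X a ≫ g.hom) : f = g := by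
  refine Mon.Hom.ext (Sigma.hom_ext _ _ fun L => ?_)
  change freeIncl X L ≫ f.hom = freeIncl X L ≫ g.hom
  induction L with
  | nil => exact (IsMonHom.one_hom f.hom).trans (IsMonHom.one_hom g.hom).symm
  | cons a L ih =>
    have key : ∀ {A B : M} (r : A ⟶ freeMonObj X) (s : B ⟶ freeMonObj X)
        (_ : r ≫ f.hom = r ≫ g.hom) (_ : s ≫ f.hom = s ≫ g.hom),
        ((r ⊗ₘ s) ≫ μ[freeMonObj X]) ≫ f.hom = ((r ⊗ₘ s) ≫ μ[freeMonObj X]) ≫ g.hom := by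
      intro A B r s h₁ h₂
      rw [Category.assoc, Category.assoc]
      refine (congrArg (_ ≫ ·) (IsMonHom.mul_hom f.hom)).trans
        (Eq.trans ?_ (congrArg (_ ≫ ·) (IsMonHom.mul_hom g.hom)).symm)
      rw [tensorHom_comp_tensorHom_assoc, tensorHom_comp_tensorHom_assoc, h₁, h₂]
    rw [freeIncl_cons]
    exact key _ _ (h a) ih

end FreeMonoid

/-! ### Cocompleteness of the category of monoids. -/

section Colimits

variable {M : Type u} [Category.{v} M] [MonoidalCategory M] [SymmetricCategory M]
  [MonoidalClosed M] [HasColimits M]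

/-- The quotient of a monoid by a family of relations; it is a quotient of the underlying
object. -/
theorem exists_mon_quotient_family (T : Mon M) {I : Type v} (P : I → M)
    (r s : ∀ i, P i ⟶ T.X) :
    ∃ (Q : Mon M) (q : T ⟶ Q), Epi q.hom ∧ (∀ i, r i ≫ q.hom = s i ≫ q.hom) ∧
      ∀ (N : Mon M) (f : T ⟶ N), (∀ i, r i ≫ f.hom = s i ≫ f.hom) → ∃ g : Q ⟶ N, q ≫ g = f := by
  obtain ⟨Q, q, h₁, h₂, h₃⟩ := exists_mon_quotient T (Sigma.desc r) (Sigma.desc s)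
  refine ⟨Q, q, h₁, fun i => ?_, fun N f hf => h₃ N f (Sigma.hom_ext _ _ fun i => ?_)⟩
  · simpa using congrArg (Sigma.ι P i ≫ ·) h₂
  · simpa using hf i

/-- The colimit is the free monoid on all the objects `K.obj j`, modulo the relations that make the
generators `freeGen X j` into monoid morphisms forming a cocone. A morphism out of it is determined
on generators because `q.hom` is epi. -/
theorem hasColimit_mon {J : Type v} [SmallCategory J] (K : J ⥤ Mon M) : HasColimit K := by
  let X : J → M := fun j => (K.obj j).X
  -- Three families of relations: preservation of units, preservation of products, and compatibility
  -- with the arrows of the diagram.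
  let P : J ⊕ J ⊕ (Σ p : J × J, p.1 ⟶ p.2) → M
    | .inl _ => 𝟙_ M
    | .inr (.inl j) => X j ⊗ X j
    | .inr (.inr f) => X f.1.1
  let r : ∀ i, P i ⟶ (freeMon X).X
    | .inl _ => η[freeMonObj X]
    | .inr (.inl j) => μ[(K.obj j).X] ≫ freeGen X j
    | .inr (.inr f) => freeGen X f.1.1
  let s : ∀ i, P i ⟶ (freeMon X).X
    | .inl j => η[(K.obj j).X] ≫ freeGen X j
    | .inr (.inl j) => (freeGen X j ⊗ₘ freeGen X j) ≫ μ[freeMonObj X]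
    | .inr (.inr f) => (K.map f.2).hom ≫ freeGen X f.1.2
  obtain ⟨Q, q, hq, hrel, hQ⟩ := exists_mon_quotient_family (freeMon X) P r s
  have h₁ : ∀ j, η[(K.obj j).X] ≫ freeGen X j ≫ q.hom = η[Q.X] := fun j => by
    have h := hrel (.inl j)
    rw [← Category.assoc]
    exact h.symm.trans (IsMonHom.one_hom q.hom)
  have h₂ : ∀ j, μ[(K.obj j).X] ≫ freeGen X j ≫ q.hom =
      ((freeGen X j ≫ q.hom) ⊗ₘ (freeGen X j ≫ q.hom)) ≫ μ[Q.X] := fun j => by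
    have h := hrel (.inr (.inl j))
    rw [← tensorHom_comp_tensorHom_assoc, ← Category.assoc]
    refine h.trans ((Category.assoc _ _ _).trans ?_)
    exact congrArg (_ ≫ ·) (IsMonHom.mul_hom q.hom)
  let c : Cocone K := Cocone.mk Q
    { app := fun j => Mon.Hom.mk' (M := K.obj j) (freeGen X j ≫ q.hom) (h₁ j) (h₂ j)
      naturality := fun i j f => Mon.Hom.ext <| by
        have h := hrel (.inr (.inr ⟨(i, j), f⟩))
        exact ((Category.assoc _ _ _).symm.trans h.symm).trans (Category.comp_id _).symm }
  have hdesc : ∀ t : Cocone K, ∃ g : Q ⟶ t.pt, q ≫ g = freeLift X fun j => (t.ι.app j).hom := by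
    intro t
    refine hQ _ _ ?_
    have hg : ∀ j, freeGen X j ≫ (freeLift X fun j => (t.ι.app j).hom).hom =
      (t.ι.app j).hom := fun j => freeGen_lift X _ j
    rintro (j | j | ⟨⟨i, j⟩, f⟩)
    · refine (IsMonHom.one_hom (freeLift X fun j => (t.ι.app j).hom).hom).trans ?_
      refine Eq.trans ?_ (Category.assoc _ _ _).symm
      rw [hg]
      exact (IsMonHom.one_hom _).symm
    · refine (Category.assoc _ _ _).trans (Eq.trans ?_ (Category.assoc _ _ _).symm)
      refine Eq.trans ?_ (congrArg (_ ≫ ·)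
        (IsMonHom.mul_hom (freeLift X fun j => (t.ι.app j).hom).hom)).symm
      rw [hg, tensorHom_comp_tensorHom_assoc, hg]
      exact IsMonHom.mul_hom _
    · refine (hg i).trans (Eq.trans ?_ (Category.assoc _ _ _).symm)
      rw [hg]
      exact (congrArg Mon.Hom.hom (t.w f)).symm
  choose g hg using hdesc
  refine ⟨⟨⟨c, ⟨g, fun t j => Mon.Hom.ext ?_, fun t m hm => ?_⟩⟩⟩⟩
  · refine (Category.assoc _ _ _).trans ?_
    refine Eq.trans ?_ (freeGen_lift X (fun j => (t.ι.app j).hom) j)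
    exact congrArg (fun z => freeGen X j ≫ Mon.Hom.hom z) (hg t)
  · have h : q ≫ m = q ≫ g t := by
      rw [hg]
      refine freeMon_hom_ext X fun j => ?_
      refine Eq.trans ?_ (freeGen_lift X (fun j => (t.ι.app j).hom) j).symm
      exact (Category.assoc _ _ _).symm.trans (congrArg Mon.Hom.hom (hm j))
    exact Mon.Hom.ext ((cancel_epi q.hom).1 (congrArg Mon.Hom.hom h))

instance : HasColimits (Mon M) := ⟨fun _ _ => ⟨hasColimit_mon⟩⟩

end Colimits

/-! ### The reflection onto commutative functors. -/

section Abelianization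

variable {C : Type v} [SmallCategory C] (R : OrthogonalityRelation C)
  {M : Type u} [Category.{v} M] [MonoidalCategory M] [SymmetricCategory M] [MonoidalClosed M]
  [HasColimits M]

/-- Each `B.obj t` is divided by the commutation relations of all orthogonal pairs into `t`.
Uniqueness of the factorization is left to the objectwise epimorphisms. -/
theorem exists_perpAbelianization (B : C ⥤ Mon M) :
    ∃ (B' : C ⥤ Mon M) (q : B ⟶ B'), IsPerpCommutative R B' ∧ (∀ t, Epi (q.app t).hom) ∧
      ∀ N : C ⥤ Mon M, IsPerpCommutative R N → ∀ f : B ⟶ N, ∃ g : B' ⟶ N, q ≫ g = f := by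
  let I : C → Type v := fun t =>
    Σ c : C × C, { p : (c.1 ⟶ t) × (c.2 ⟶ t) // R.perp p.1 p.2 }
  let P : ∀ t, I t → M := fun t i => (B.obj i.1.1).X ⊗ (B.obj i.1.2).X
  let r : ∀ t (i : I t), P t i ⟶ (B.obj t).X := fun t i =>
    ((B.map i.2.1.1).hom ⊗ₘ (B.map i.2.1.2).hom) ≫ μ[(B.obj t).X]
  let s : ∀ t (i : I t), P t i ⟶ (B.obj t).X := fun t i =>
    (β_ _ _).hom ≫ ((B.map i.2.1.2).hom ⊗ₘ (B.map i.2.1.1).hom) ≫ μ[(B.obj t).X]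
  choose Q q hq hrel hQ using fun t => exists_mon_quotient_family (B.obj t) (P t) (r t) (s t)
  have hr : ∀ {t : C} {N : Mon M} (f : B.obj t ⟶ N) (i : I t), r t i ≫ f.hom =
      ((B.map i.2.1.1 ≫ f).hom ⊗ₘ (B.map i.2.1.2 ≫ f).hom) ≫ μ[N.X] := fun f i => by
    simp [r]
  have hs : ∀ {t : C} {N : Mon M} (f : B.obj t ⟶ N) (i : I t), s t i ≫ f.hom = (β_ _ _).hom ≫
      ((B.map i.2.1.2 ≫ f).hom ⊗ₘ (B.map i.2.1.1 ≫ f).hom) ≫ μ[N.X] := fun f i => by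
    simp [s]
  have hext : ∀ {t : C} {N : Mon M} {f g : Q t ⟶ N}, q t ≫ f = q t ≫ g → f = g := by
    intro t N f g h
    have := hq t
    exact Mon.Hom.ext ((cancel_epi (q t).hom).1 (congrArg Mon.Hom.hom h))
  -- A relation at `t` is sent by `B.map h` to the relation of the pair composed with `h`, which is
  -- again orthogonal.
  have hmap : ∀ {t t' : C} (h : t ⟶ t'), ∃ g : Q t ⟶ Q t', q t ≫ g = B.map h ≫ q t' := by
    intro t t' h
    refine hQ t _ _ fun i => ?_
    have e := hrel t' ⟨i.1, (i.2.1.1 ≫ h, i.2.1.2 ≫ h), R.postcomp h i.2.2⟩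
    rw [hr, hs] at e ⊢
    simpa only [B.map_comp, Category.assoc] using e
  choose m hm using @hmap
  let B' : C ⥤ Mon M :=
    { obj := Q
      map := m
      map_id := fun t => hext (by simp [hm])
      map_comp := fun f g => hext (by rw [hm, reassoc_of% hm, hm, B.map_comp, Category.assoc]) }
  refine ⟨B', { app := q, naturality := fun t t' h => (hm h).symm }, ?_, hq, fun N hN f => ?_⟩
  · intro c₁ c₂ t f₁ f₂ hf
    have := hq c₁
    have := hq c₂
    have e := hrel t ⟨(c₁, c₂), (f₁, f₂), hf⟩
    rw [hr, hs, ← hm, ← hm] at e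
    -- Commutation is needed for all elements of the quotients `Q c₁` and `Q c₂`, but the relations
    -- concern only `B`; a tensor product of epimorphisms is epi, so these suffice.
    rw [← cancel_epi ((q c₁).hom ⊗ₘ (q c₂).hom), BraidedCategory.braiding_naturality_assoc,
      tensorHom_comp_tensorHom_assoc, tensorHom_comp_tensorHom_assoc]
    exact e
  · have hg : ∀ t, ∃ g : Q t ⟶ N.obj t, q t ≫ g = f.app t := fun t => by
      refine hQ t _ _ fun i => ?_
      rw [hr, hs, f.naturality, f.naturality, Mon.comp_hom', Mon.comp_hom',
        ← tensorHom_comp_tensorHom_assoc, ← tensorHom_comp_tensorHom_assoc,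
        ← BraidedCategory.braiding_naturality_assoc, hN _ _ i.2.2]
    choose g hg using hg
    refine ⟨{ app := g, naturality := fun t t' h => hext ?_ }, ?_⟩
    · rw [reassoc_of% hg]
      refine Eq.trans ?_ (f.naturality h)
      exact (reassoc_of% hm h) _ |>.trans (congrArg (_ ≫ ·) (hg t'))
    · ext t : 2
      exact hg t

/-- The algebra of the abelianization of `B` is initial among arrows from `B` to `projPullback R M`.
Fullness lifts the factorizations to algebra morphisms; faithfulness and the epimorphisms `q` make
them unique. -/
instance isRightAdjoint_projPullback : (projPullback R M).IsRightAdjoint := by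
  have : ∀ B : C ⥤ Mon M, HasInitial (StructuredArrow B (projPullback R M)) := by
    intro B
    obtain ⟨B', q, hB', hq, hu⟩ := exists_perpAbelianization R B
    let e := projPullbackOfFunctorIso B' hB'
    have hext : ∀ {N : C ⥤ Mon M} {f g : B' ⟶ N}, q ≫ f = q ≫ g → f = g := by
      intro N f g h
      ext t : 2
      have := hq t
      refine Mon.Hom.ext ((cancel_epi (q.app t).hom).1 ?_)
      exact congrArg (fun z : B ⟶ N => (z.app t).hom) h
    have hex : ∀ Y : StructuredArrow B (projPullback R M),
        ∃ g : Algebra.ofFunctor B' hB' ⟶ Y.right,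
          (q ≫ e.inv) ≫ (projPullback R M).map g = Y.hom := by
      intro Y
      obtain ⟨g, hg⟩ := hu _ (isPerpCommutative_projPullback Y.right) Y.hom
      refine ⟨(projPullback R M).preimage (e.hom ≫ g), ?_⟩
      rw [Functor.map_preimage, Category.assoc, e.inv_hom_id_assoc]
      exact hg
    choose g hg using hex
    refine IsInitial.hasInitial (X := StructuredArrow.mk (q ≫ e.inv)) <|
      IsInitial.ofUniqueHom (fun Y => StructuredArrow.homMk (g Y) (hg Y)) fun Y f => ?_
    ext
    apply (projPullback R M).map_injective
    rw [← cancel_epi e.inv]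
    refine hext ?_
    have h₁ := StructuredArrow.w f
    have h₂ := hg Y
    simp only [Category.assoc] at h₂
    refine Eq.trans ?_ (h₁.trans h₂.symm)
    exact (Category.assoc _ _ _).symm
  exact isRightAdjointOfStructuredArrowInitials _

noncomputable instance : Reflective (projPullback R M) where
  L := (projPullback R M).leftAdjoint
  adj := Adjunction.ofIsRightAdjoint _

end Abelianization

/-! ### Change of orthogonal category along a functor. -/

section Extension

variable {C D : Type v} [SmallCategory C] [SmallCategory D] {R : OrthogonalityRelation C}
  {S : OrthogonalityRelation D} (F : C ⥤ D) (hF : IsOrthogonalFunctor R S F)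
  {M : Type u} [Category.{v} M] [MonoidalCategory M] [SymmetricCategory M] [HasColimits M]

/-- Restricting along `F` turns the operation of `(e, f)` into that of `(e, F f)`; units, products
and transition maps are all of this form. -/
theorem orthPullback_prodOp (A : Algebra (orthOperad S) M) {n : ℕ} {c : Fin n → C} {t : C}
    (f : ∀ i, c i ⟶ t) :
    ((Algebra.pullback M (projHom R)).obj
      ((Algebra.pullback M (orthOperadHom F hF)).obj A)).prodOp f =
    ((Algebra.pullback M (projHom S)).obj A).prodOp (c := fun i => F.obj (c i))
      (fun i => F.map (f i)) :=
  (Algebra.operation_pullbackStr (projHom R)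
    ((Algebra.pullback M (orthOperadHom F hF)).obj A) (1, f)).trans
    ((Algebra.operation_pullbackStr (orthOperadHom F hF) A (OrthWord.mk (1, f))).trans
      (Algebra.operation_pullbackStr (projHom S) A (1, fun i => F.map (f i))).symm)

/-- Restriction along `F` is compatible with taking the underlying monoid-valued functor. -/
noncomputable def pullbackCompProjPullbackIso :
    Algebra.pullback M (orthOperadHom F hF) ⋙ projPullback R M ≅
      projPullback S M ⋙ (Functor.whiskeringLeft C D (Mon M)).obj F :=
  NatIso.ofComponents (fun A => NatIso.ofComponents
    (fun t => Mon.mkIso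
      (M := ((projPullback R M).obj ((Algebra.pullback M (orthOperadHom F hF)).obj A)).obj t)
      (N := ((projPullback S M).obj A).obj (F.obj t)) (Iso.refl (A.obj (F.obj t)))
      (by
        refine (Category.comp_id _).trans ((orthPullback_prodOp F hF A _).trans ?_)
        exact Algebra.prodOp_elim0 _ _)
      (by
        have key : ∀ {A : M} (m : A ⊗ A ⟶ A), m = (𝟙 A ⊗ₘ 𝟙 A) ≫ m := by simp
        refine (Category.comp_id _).trans (Eq.trans ?_ (key _))
        have h := orthPullback_prodOp F hF A (c := fun _ : Fin 2 => t) (fun _ => 𝟙 t)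
        simp only [F.map_id] at h
        exact congrArg ((A.obj (F.obj t) ◁ (ρ_ (A.obj (F.obj t))).inv) ≫ ·) h))
    (fun {c t} f => by
      refine Mon.Hom.ext ((Category.comp_id _).trans (Eq.trans ?_ (Category.id_comp _).symm))
      exact congrArg ((ρ_ (A.obj (F.obj c))).inv ≫ ·)
        (orthPullback_prodOp F hF A (c := fun _ : Fin 1 => c) (fun _ => f))))
    (fun {A B} g => by
      ext t
      exact (Category.comp_id _).trans (Category.id_comp _).symm)

/-- The left adjoint of restriction along `F`, computed as `p_! Lan_F p^*`. -/
noncomputable def extensionAdjunction [MonoidalClosed M] {Lan : (C ⥤ Mon M) ⥤ (D ⥤ Mon M)}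
    (adjLan : Lan ⊣ (Functor.whiskeringLeft C D (Mon M)).obj F)
    {p : (D ⥤ Mon M) ⥤ Algebra (orthOperad S) M} (adjp : p ⊣ projPullback S M) :
    projPullback R M ⋙ Lan ⋙ p ⊣ Algebra.pullback M (orthOperadHom F hF) :=
  -- The composite adjunction is between functors `C ⥤ Mon M` and algebras over `orthOperad S`. Its
  -- right adjoint lands, up to isomorphism, in the image of the fully faithful `projPullback R M`,
  -- so the left adjoint may be restricted to that image.
  (adjLan.comp adjp).restrictFullyFaithful (iC := projPullback R M) (iD := 𝟭 _)
    (Functor.FullyFaithful.ofFullyFaithful _) (Functor.FullyFaithful.id _)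
    (Functor.rightUnitor _).symm
    (Functor.leftUnitor _ ≪≫ (pullbackCompProjPullbackIso F hF).symm)

end Extension
end QFTOperad

theorem proposition5p3
    (M : Type u) [Category.{v} M] [MonoidalCategory M] [SymmetricCategory M] [MonoidalClosed M]
    [HasLimits M] [HasColimits M] :
    -- `p_C̄^*` exhibits `Alg(O_C̄)` as a full reflective subcategory of `Mon_M^C`
    (∀ (C : Type v) [SmallCategory C] (R : QFTOperad.OrthogonalityRelation C),
      Nonempty (Reflective (QFTOperad.projPullback R M)) ∧
      ∀ (p : (C ⥤ Mon M) ⥤ QFTOperad.Algebra (QFTOperad.orthOperad R) M)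
        (adj : p ⊣ QFTOperad.projPullback R M), IsIso adj.counit) ∧
    -- the factorization of the left adjoint of `O_F^*`
    (∀ (C D : Type v) [SmallCategory C] [SmallCategory D]
      (R : QFTOperad.OrthogonalityRelation C) (S : QFTOperad.OrthogonalityRelation D)
      (F : C ⥤ D) (hF : QFTOperad.IsOrthogonalFunctor R S F),
      (QFTOperad.Algebra.pullback M (QFTOperad.orthOperadHom F hF)).IsRightAdjoint ∧
      (∀ G : C ⥤ Mon M, F.HasLeftKanExtension G) ∧
      ∀ (OF : QFTOperad.Algebra (QFTOperad.orthOperad R) M ⥤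
            QFTOperad.Algebra (QFTOperad.orthOperad S) M)
        (_ : OF ⊣ QFTOperad.Algebra.pullback M (QFTOperad.orthOperadHom F hF))
        (Lan : (C ⥤ Mon M) ⥤ (D ⥤ Mon M))
        (_ : Lan ⊣ (Functor.whiskeringLeft C D (Mon M)).obj F)
        (p : (D ⥤ Mon M) ⥤ QFTOperad.Algebra (QFTOperad.orthOperad S) M)
        (_ : p ⊣ QFTOperad.projPullback S M),
        Nonempty (OF ≅ QFTOperad.projPullback R M ⋙ Lan ⋙ p)) := by
  -- The counit is invertible because the right adjoint is fully faithful, and Kan extensions exist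
  -- because `Mon M` has colimits.
  refine ⟨fun C _ R => ⟨⟨inferInstance⟩, fun p adj => inferInstance⟩,
    fun C D _ _ R S F hF => ⟨?_, fun G => inferInstance, fun OF adjOF Lan adjLan p adjp => ?_⟩⟩
  · exact (QFTOperad.extensionAdjunction F hF (F.lanAdjunction (Mon M))
      (Adjunction.ofIsRightAdjoint (QFTOperad.projPullback S M))).isRightAdjoint
  · exact ⟨adjOF.leftAdjointUniq (QFTOperad.extensionAdjunction F hF adjLan adjp)⟩
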